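/- **Setting.** Let $\mathcal I_A,\mathcal O_A,\mathcal I_B,\mathcal O_B$ be finite sets. A *strategy* is a triple $S=(|\psi\rangle,\{E_{xa}\},\{F_{yb}\})$ consisting of a unit vector $|\psi\rangle\in\mathbb C^{m}\otimes\mathbb C^{n}$ (with $m,n$ arbitrary and finite), positive semidefinite matrices $E_{xa}$ on $\mathbb C^m$ with $\sum_{a\in\mathcal O_A}E_{xa}=\mathsf{Id}$ for all $x\in\mathcal I_A$, and positive semidefinite matrices $F_{yb}$ on $\mathbb C^n$ with $\sum_{b\in\mathcal O_B}F_{yb}=\mathsf{Id}$ for all $y\in\mathcal I_B$. It *produces* $p$ if $p(a,b|x,y)=\langle\psi|E_{xa}\otimes F_{yb}|\psi\rangle$ for all $a,b,x,y$; $C_q$ is the set of all $p$ produced by some strategy. $S$ is *support-preserving* if every $E_{xa}$ commutes with the projection onto the support of $\operatorname{Tr}_B|\psi\rangle\langle\psi|$ and every $F_{yb}$ commutes with the projection onto the support of $\operatorname{Tr}_A|\psi\rangle\langle\psi|$. A strategy $\tilde S=(|\tilde\psi\rangle,\{\tilde E_{xa}\},\{\tilde F_{yb}\})$ on $\mathcal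 H_{\tilde A}\otimes\mathcal H_{\tilde B}$ is a *complex local dilation* of a strategy $S$ on $\mathcal H_A\otimes\mathcal H_B$ if there are finite-dimensional spaces $\mathcal H_{\hat A},\mathcal H_{\hat B}$, isometries $U_A:\mathcal H_A\to\mathcal H_{\tilde A}\otimes\mathcal H_{\hat A}\otimes\mathbb C^2$ and $U_B:\mathcal H_B\to\mathcal H_{\tilde B}\otimes\mathcal H_{\hat B}\otimes\mathbb C^2$, and vectors $|\mathsf{aux}_0\rangle,|\mathsf{aux}_1\rangle\in\mathcal H_{\hat A}\otimes\mathcal H_{\hat B}$ with $\langle\mathsf{aux}_0|\mathsf{aux}_0\rangle+\langle\mathsf{aux}_1|\mathsf{aux}_1\rangle=1$ such that, with $U=U_A\otimes U_B$ and bars denoting entrywise complex conjugation, $$U|\psi\rangle=|\tilde\psi\rangle|\mathsf{aux}_0\rangle|00\rangle+|\overline{\tilde\psi}\rangle|\mathsf{aux}_1\rangle|11\rangle,$$ $$U(E_{xa}\otimes\mathsf{Id})|\psi\rangle=(\tilde E_{xa}\otimes\mathsf{Id})|\tilde\psi\rangle|\mathsf{aux}_0\rangle|00\rangle+(\overline{\tilde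 E_{xa}}\otimes\mathsf{Id})|\overline{\tilde\psi}\rangle|\mathsf{aux}_1\rangle|11\rangle,$$ $$U(\mathsf{Id}\otimes F_{yb})|\psi\rangle=(\mathsf{Id}\otimes\tilde F_{yb})|\tilde\psi\rangle|\mathsf{aux}_0\rangle|00\rangle+(\mathsf{Id}\otimes\overline{\tilde F_{yb}})|\overline{\tilde\psi}\rangle|\mathsf{aux}_1\rangle|11\rangle$$ for all $a,b,x,y$. The strategy $\tilde S$ is *complex self-tested* by $p$ if it is a complex local dilation of every strategy producing $p$. Let $\mathcal A_{\mathbb R,\mathrm{POVM}}^{\mathcal I_A,\mathcal O_A}$ be the universal real C*-algebra generated by positive contractions $e_{xa}$ ($x\in\mathcal I_A$, $a\in\mathcal O_A$) subject to $\sum_a e_{xa}=1$ for all $x$, and $\mathcal A_{\mathbb R,\mathrm{POVM}}^{\mathcal I_B,\mathcal O_B}$ likewise with generators $f_{yb}$. A *real state* on a unital real C*-algebra is a bounded real-linear functional $f$ with $f(1)=1$, $f(c^*)=f(c)$ and $f(c^*c)\ge0$ for all $c$; it is *finite-dimensional* if its GNS space is finite-dimensional. A real state $f$ on $\mathcal A_{\mathbb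 R,\mathrm{POVM}}^{\mathcal I_A,\mathcal O_A}\otimes_{\min}\mathcal A_{\mathbb R,\mathrm{POVM}}^{\mathcal I_B,\mathcal O_B}$ *agrees with* $p$ if $f(e_{xa}\otimes f_{yb})=p(a,b|x,y)$ for all $a,b,x,y$. **Theorem.** 1. Let $p\in C_q$. If a support-preserving strategy $\tilde S$ is complex self-tested by $p$, then there is exactly one finite-dimensional real state on $\mathcal A_{\mathbb R,\mathrm{POVM}}^{\mathcal I_A,\mathcal O_A}\otimes_{\min}\mathcal A_{\mathbb R,\mathrm{POVM}}^{\mathcal I_B,\mathcal O_B}$ that agrees with $p$. 2. Let $p$ be an extreme point of $C_q$. If there is exactly one finite-dimensional real state on $\mathcal A_{\mathbb R,\mathrm{POVM}}^{\mathcal I_A,\mathcal O_A}\otimes_{\min}\mathcal A_{\mathbb R,\mathrm{POVM}}^{\mathcal I_B,\mathcal O_B}$ that agrees with $p$, then there is a strategy $\tilde S$ that is complex self-tested by $p$. -/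

import Mathlib

open scoped ENNReal TensorProduct Kronecker ComplexConjugate ComplexOrder

noncomputable section

namespace ComplexSelfTest

/-! ### Bell scenarios: strategies, correlations, complex self-testing -/

/-- A correlation `p(a,b|x,y)`, written `p x y a b`. -/
abbrev Correlation (IA OA IB OB : Type*) : Type _ := IA → IB → OA → OB → ℝ

/-- A finite-dimensional bipartite quantum strategy on `ℂ^m ⊗ ℂ^n`: a unit vector `ψ` together with
one POVM on `ℂ^m` for each question in `IA` and one POVM on `ℂ^n` for each question in `IB`.
Vectors of `ℂ^m ⊗ ℂ^n` are given by their coordinates in the product basis. -/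
structure Strategy (IA OA IB OB : Type*) [Fintype OA] [Fintype OB] (m n : ℕ) where
  ψ : Fin m × Fin n → ℂ
  E : IA → OA → Matrix (Fin m) (Fin m) ℂ
  F : IB → OB → Matrix (Fin n) (Fin n) ℂ
  norm_ψ : ∑ i, ‖ψ i‖ ^ 2 = 1
  E_pos : ∀ x a, (E x a).PosSemidef
  F_pos : ∀ y b, (F y b).PosSemidef
  E_sum : ∀ x, ∑ a, E x a = 1
  F_sum : ∀ y, ∑ b, F y b = 1

section Strategies

variable {IA OA IB OB : Type*} [Fintype OA] [Fintype OB] {m n m' n' : ℕ}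

/-- `S` produces `p` if `⟨ψ| E_{xa} ⊗ F_{yb} |ψ⟩ = p(a,b|x,y)` for all `a, b, x, y`. -/
def Strategy.Produces (S : Strategy IA OA IB OB m n) (p : Correlation IA OA IB OB) : Prop :=
  ∀ x y a b, star S.ψ ⬝ᵥ ((S.E x a ⊗ₖ S.F y b).mulVec S.ψ) = (p x y a b : ℂ)

variable (IA OA IB OB) in
/-- The set `C_q` of all correlations of finite-dimensional tensor product quantum strategies. -/
def Cq : Set (Correlation IA OA IB OB) :=
  {p | ∃ (m n : ℕ) (S : Strategy IA OA IB OB m n), S.Produces p}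

/-- The reduced density matrix `Tr_B |ψ⟩⟨ψ|`. -/
def Strategy.rhoA (S : Strategy IA OA IB OB m n) : Matrix (Fin m) (Fin m) ℂ :=
  Matrix.of fun i i' => ∑ j, S.ψ (i, j) * conj (S.ψ (i', j))

/-- The reduced density matrix `Tr_A |ψ⟩⟨ψ|`. -/
def Strategy.rhoB (S : Strategy IA OA IB OB m n) : Matrix (Fin n) (Fin n) ℂ :=
  Matrix.of fun j j' => ∑ i, S.ψ (i, j) * conj (S.ψ (i, j'))

/-- The orthogonal projection onto the support of a Hermitian matrix (the support of a Hermitian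
operator is its range). -/
def suppProj {d : ℕ} (ρ : Matrix (Fin d) (Fin d) ℂ) :
    EuclideanSpace ℂ (Fin d) →L[ℂ] EuclideanSpace ℂ (Fin d) :=
  (LinearMap.range (Matrix.toEuclideanLin ρ)).starProjection

/-- `S` is support-preserving: the projections onto the supports of the reduced states commute
with the local measurement operators. -/
def Strategy.SupportPreserving (S : Strategy IA OA IB OB m n) : Prop :=
  (∀ x a, Commute (suppProj S.rhoA) (Matrix.toEuclideanCLM (𝕜 := ℂ) (S.E x a))) ∧
  (∀ y b, Commute (suppProj S.rhoB) (Matrix.toEuclideanCLM (𝕜 := ℂ) (S.F y b)))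

/-- The vector `v₀ ⊗ aux₀ ⊗ |00⟩ + v₁ ⊗ aux₁ ⊗ |11⟩`, where `v₀, v₁` live on the registers `Ã B̃`,
`aux₀, aux₁` on `Â B̂`, and `|00⟩, |11⟩` on `A' B'`; the registers are grouped as
`(Ã Â A')(B̃ B̂ B')`. -/
def combine {k l : ℕ} (v₀ v₁ : Fin m' × Fin n' → ℂ) (aux₀ aux₁ : Fin k × Fin l → ℂ) :
    (Fin m' × Fin k × Fin 2) × (Fin n' × Fin l × Fin 2) → ℂ :=
  fun ⟨⟨i, s, e⟩, ⟨j, t, f⟩⟩ =>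
    (if e = 0 ∧ f = 0 then v₀ (i, j) * aux₀ (s, t) else 0) +
    (if e = 1 ∧ f = 1 then v₁ (i, j) * aux₁ (s, t) else 0)

/-- `T` is a complex local dilation of `S`. The complex conjugate of a vector or of a matrix is
taken entrywise, `M.map conj`. -/
def IsComplexLocalDilation (S : Strategy IA OA IB OB m n) (T : Strategy IA OA IB OB m' n') :
    Prop :=
  ∃ (k l : ℕ) (UA : Matrix (Fin m' × Fin k × Fin 2) (Fin m) ℂ)
    (UB : Matrix (Fin n' × Fin l × Fin 2) (Fin n) ℂ) (aux₀ aux₁ : Fin k × Fin l → ℂ),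
    UA.conjTranspose * UA = 1 ∧ UB.conjTranspose * UB = 1 ∧
    ∑ i, ‖aux₀ i‖ ^ 2 + ∑ i, ‖aux₁ i‖ ^ 2 = 1 ∧
    (UA ⊗ₖ UB).mulVec S.ψ = combine T.ψ (star T.ψ) aux₀ aux₁ ∧
    (∀ x a, (UA ⊗ₖ UB).mulVec ((S.E x a ⊗ₖ (1 : Matrix (Fin n) (Fin n) ℂ)).mulVec S.ψ) =
      combine ((T.E x a ⊗ₖ (1 : Matrix (Fin n') (Fin n') ℂ)).mulVec T.ψ)
        (((T.E x a).map conj ⊗ₖ (1 : Matrix (Fin n') (Fin n') ℂ)).mulVec (star T.ψ))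
        aux₀ aux₁) ∧
    (∀ y b, (UA ⊗ₖ UB).mulVec (((1 : Matrix (Fin m) (Fin m) ℂ) ⊗ₖ S.F y b).mulVec S.ψ) =
      combine (((1 : Matrix (Fin m') (Fin m') ℂ) ⊗ₖ T.F y b).mulVec T.ψ)
        (((1 : Matrix (Fin m') (Fin m') ℂ) ⊗ₖ (T.F y b).map conj).mulVec (star T.ψ))
        aux₀ aux₁)

/-- `T` is complex self-tested by `p`: it is a complex local dilation of every strategy that
produces `p`. -/
def ComplexSelfTested (T : Strategy IA OA IB OB m' n') (p : Correlation IA OA IB OB) : Prop :=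
  ∀ (m n : ℕ) (S : Strategy IA OA IB OB m n), S.Produces p → IsComplexLocalDilation S T

end Strategies

/-! ### Real C*-algebras

Real C*-algebras are, up to isometric `*`-isomorphism, the norm-closed real `*`-subalgebras of
`B(H)` for real Hilbert spaces `H`. Here they are realised as norm-closed unital `*`-subalgebras
of an `ℓ^∞`-product `∏ᵢ B(Hᵢ)`, which is the algebra of block diagonal operators on `⨁ᵢ Hᵢ`. -/

/-- The real C*-algebra `∏ᵢ B(Hᵢ)` of bounded families of operators on real Hilbert spaces, with
pointwise operations and supremum norm. -/
def OpProd {ι : Type*} (H : ι → Type*) [∀ i, NormedAddCommGroup (H i)]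
    [∀ i, InnerProductSpace ℝ (H i)] : Type _ :=
  lp (fun i => H i →L[ℝ] H i) ∞

section OpProd

variable {ι : Type*} {H : ι → Type*} [∀ i, NormedAddCommGroup (H i)]
  [∀ i, InnerProductSpace ℝ (H i)]

instance : CoeFun (OpProd H) (fun _ => ∀ i, H i →L[ℝ] H i) := ⟨fun a => a.1⟩

/-- A uniformly bounded family of operators, as an element of the product. -/
def OpProd.mk (T : ∀ i, H i →L[ℝ] H i) (C : ℝ) (hT : ∀ i, ‖T i‖ ≤ C) : OpProd H :=
  ⟨T, memℓp_infty ⟨C, by rintro _ ⟨i, rfl⟩; exact hT i⟩⟩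

variable [∀ i, Nontrivial (H i)]

instance : NormedRing (OpProd H) :=
  inferInstanceAs (NormedRing (lp (fun i => H i →L[ℝ] H i) ∞))

instance : NormedAlgebra ℝ (OpProd H) :=
  inferInstanceAs (NormedAlgebra ℝ (lp (fun i => H i →L[ℝ] H i) ∞))

theorem OpProd.norm_apply_le (a : OpProd H) (i : ι) : ‖a i‖ ≤ ‖a‖ :=
  lp.norm_apply_le_norm (E := fun i => H i →L[ℝ] H i) ENNReal.top_ne_zero a i

variable [∀ i, CompleteSpace (H i)]

instance : CompleteSpace (OpProd H) :=
  inferInstanceAs (CompleteSpace (lp (fun i => H i →L[ℝ] H i) ∞))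

instance : StarRing (OpProd H) :=
  inferInstanceAs (StarRing (lp (fun i => H i →L[ℝ] H i) ∞))

instance : CStarRing (OpProd H) :=
  inferInstanceAs (CStarRing (lp (fun i => H i →L[ℝ] H i) ∞))

instance : StarModule ℝ (OpProd H) :=
  inferInstanceAs (StarModule ℝ (lp (fun i => H i →L[ℝ] H i) ∞))

/-- The norm-closed unital real `*`-subalgebra generated by a set. -/
def closedAdjoin (s : Set (OpProd H)) : StarSubalgebra ℝ (OpProd H) :=
  (StarAlgebra.adjoin ℝ s).topologicalClosure

theorem subset_closedAdjoin {s : Set (OpProd H)} {a : OpProd H} (ha : a ∈ s) :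
    a ∈ closedAdjoin s :=
  StarSubalgebra.le_topologicalClosure _ (StarAlgebra.subset_adjoin ℝ s ha)

end OpProd

/-- A family of POVMs on a (nonzero) real Hilbert space: positive contractions `E x a` with
`∑ₐ E x a = 1` for every `x`. -/
structure RealPOVM (I O : Type*) [Fintype O] where
  H : Type
  [normed : NormedAddCommGroup H]
  [inner : InnerProductSpace ℝ H]
  [complete : CompleteSpace H]
  [nontrivial : Nontrivial H]
  E : I → O → H →L[ℝ] H
  pos : ∀ x a, (E x a).IsPositive
  contr : ∀ x a, ‖E x a‖ ≤ 1
  sum_eq : ∀ x, ∑ a, E x a = 1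

attribute [instance] RealPOVM.normed RealPOVM.inner RealPOVM.complete RealPOVM.nontrivial

section Universal

variable (I O : Type*) [Fintype O]

/-- The product of `B(H)` over all families of POVMs on real Hilbert spaces. -/
abbrev POVMProd : Type _ := OpProd (fun S : RealPOVM I O => S.H)

variable {I O} in
/-- The canonical generator `e_{xa}`: its coordinate at a family of POVMs is the operator `E x a`
of that family. -/
def povmGen (x : I) (a : O) : POVMProd I O :=
  OpProd.mk (fun S => S.E x a) 1 fun S => S.contr x a

/-- The universal real C*-algebra generated by positive contractions `e_{xa}` subject to
`∑ₐ e_{xa} = 1`: the norm-closed unital real `*`-algebra generated by the canonical generators,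
the norm being the supremum over all representations of the relations on real Hilbert spaces. -/
def POVMAlgebra : StarSubalgebra ℝ (POVMProd I O) :=
  closedAdjoin {e | ∃ x a, e = povmGen x a}

variable {I O}

theorem povmGen_mem (x : I) (a : O) : povmGen x a ∈ POVMAlgebra I O :=
  subset_closedAdjoin ⟨x, a, rfl⟩

theorem sum_povmGen (x : I) : ∑ a, povmGen (O := O) x a = 1 := by
  have h : ∀ s : Finset O, (∑ a ∈ s, povmGen x a).1 = fun S : RealPOVM I O => ∑ a ∈ s, S.E x a := by
    intro s
    classical
    induction s using Finset.induction_on with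
    | empty => simp; rfl
    | insert a s ha ih =>
      rw [Finset.sum_insert ha]
      change (povmGen x a).1 + (∑ a ∈ s, povmGen x a).1 = _
      rw [ih]
      funext S
      rw [Finset.sum_insert ha]
      rfl
  apply Subtype.ext
  rw [h]
  funext S
  exact S.sum_eq x

/-- The coordinate at `S`, as a `*`-homomorphism to `B(S.H)`. -/
def POVMAlgebra.rep (S : RealPOVM I O) : POVMAlgebra I O →⋆ₐ[ℝ] (S.H →L[ℝ] S.H) where
  toFun a := a.1 S
  map_one' := rfl
  map_mul' _ _ := rfl
  map_zero' := rfl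
  map_add' _ _ := rfl
  commutes' _ := rfl
  map_star' _ := rfl

/-- The universal property of `POVMAlgebra I O`: every family of POVMs on a real Hilbert space is
the image of the canonical generators under a unique continuous `*`-homomorphism. -/
theorem POVMAlgebra.existsUnique_rep (S : RealPOVM I O) :
    ∃! π : POVMAlgebra I O →⋆ₐ[ℝ] (S.H →L[ℝ] S.H),
      Continuous π ∧ ∀ x a, π ⟨povmGen x a, povmGen_mem x a⟩ = S.E x a := by
  refine ⟨POVMAlgebra.rep S, ⟨?_, fun x a => rfl⟩, ?_⟩
  · refine AddMonoidHomClass.continuous_of_bound (POVMAlgebra.rep S) 1 fun a => ?_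
    rw [one_mul]
    exact OpProd.norm_apply_le a.1 S
  · rintro π ⟨hπ, hgen⟩
    have hρ : Continuous (POVMAlgebra.rep S) :=
      AddMonoidHomClass.continuous_of_bound (POVMAlgebra.rep S) 1 fun a => by
        rw [one_mul]
        exact OpProd.norm_apply_le a.1 S
    refine StarAlgHom.ext_topologicalClosure hπ hρ ?_
    refine StarAlgHom.ext_adjoin ?_
    rintro ⟨_, h⟩ ⟨x, a, rfl⟩
    exact hgen x a

end Universal

/-! ### The minimal tensor product -/

section MinTensor

open UniformSpace (Completion)

/-- The Hilbert space tensor product of two real Hilbert spaces. -/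
abbrev HilbertTensor (H K : Type*) [NormedAddCommGroup H] [InnerProductSpace ℝ H]
    [NormedAddCommGroup K] [InnerProductSpace ℝ K] : Type _ :=
  Completion (H ⊗[ℝ] K)

instance {H K : Type*} [NormedAddCommGroup H] [InnerProductSpace ℝ H] [Nontrivial H]
    [NormedAddCommGroup K] [InnerProductSpace ℝ K] [Nontrivial K] :
    Nontrivial (HilbertTensor H K) := by
  obtain ⟨v, hv⟩ := exists_ne (0 : H)
  obtain ⟨w, hw⟩ := exists_ne (0 : K)
  refine ⟨⟨((v ⊗ₜ[ℝ] w : H ⊗[ℝ] K) : Completion (H ⊗[ℝ] K)), 0, fun h => ?_⟩⟩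
  have h1 : ‖((v ⊗ₜ[ℝ] w : H ⊗[ℝ] K) : Completion (H ⊗[ℝ] K))‖ = ‖v‖ * ‖w‖ := by
    rw [Completion.norm_coe, TensorProduct.norm_tmul]
  rw [h, norm_zero] at h1
  exact mul_ne_zero (norm_ne_zero_iff.2 hv) (norm_ne_zero_iff.2 hw) h1.symm

/-- The operator `T ⊗ S` on the Hilbert space tensor product. -/
def opTensor {H K : Type*} [NormedAddCommGroup H] [InnerProductSpace ℝ H]
    [NormedAddCommGroup K] [InnerProductSpace ℝ K] (T : H →L[ℝ] H) (S : K →L[ℝ] K) :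
    HilbertTensor H K →L[ℝ] HilbertTensor H K :=
  (TensorProduct.mapL T S).completion

theorem norm_opTensor_le {H K : Type*} [NormedAddCommGroup H] [InnerProductSpace ℝ H]
    [NormedAddCommGroup K] [InnerProductSpace ℝ K] (T : H →L[ℝ] H) (S : K →L[ℝ] K) :
    ‖opTensor T S‖ ≤ ‖T‖ * ‖S‖ := by
  refine ContinuousLinearMap.opNorm_le_bound _ (by positivity) fun v => ?_
  induction v using Completion.induction_on with
  | hp => exact isClosed_le (by fun_prop) (by fun_prop)
  | ih v =>
    rw [opTensor, ContinuousLinearMap.completion_apply_coe, Completion.norm_coe,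
      Completion.norm_coe]
    exact ContinuousLinearMap.le_of_opNorm_le _ (TensorProduct.norm_mapL_le T S) v

variable {ι κ : Type*} {H : ι → Type*} {K : κ → Type*}
  [∀ i, NormedAddCommGroup (H i)] [∀ i, InnerProductSpace ℝ (H i)]
  [∀ j, NormedAddCommGroup (K j)] [∀ j, InnerProductSpace ℝ (K j)]
  [∀ i, Nontrivial (H i)] [∀ j, Nontrivial (K j)]

/-- The elementary tensor `a ⊗ b`, acting on all the Hilbert spaces `Hᵢ ⊗ Kⱼ`. -/
def elemTensor (a : OpProd H) (b : OpProd K) :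
    OpProd (fun ij : ι × κ => HilbertTensor (H ij.1) (K ij.2)) :=
  OpProd.mk (fun ij => opTensor (a ij.1) (b ij.2)) (‖a‖ * ‖b‖) fun ij =>
    (norm_opTensor_le _ _).trans (mul_le_mul (a.norm_apply_le ij.1) (b.norm_apply_le ij.2)
      (norm_nonneg _) (norm_nonneg _))

variable [∀ i, CompleteSpace (H i)] [∀ j, CompleteSpace (K j)]

/-- The minimal (spatial) tensor product of two real C*-algebras `A ⊆ ∏ᵢ B(Hᵢ)` and
`B ⊆ ∏ⱼ B(Kⱼ)`: the norm closure, inside `∏ᵢⱼ B(Hᵢ ⊗ Kⱼ)`, of the `*`-algebra generated by all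
`a ⊗ b` with `a ∈ A` and `b ∈ B`. -/
def minTensor (A : StarSubalgebra ℝ (OpProd H)) (B : StarSubalgebra ℝ (OpProd K)) :
    StarSubalgebra ℝ (OpProd (fun ij : ι × κ => HilbertTensor (H ij.1) (K ij.2))) :=
  closedAdjoin {t | ∃ a ∈ A, ∃ b ∈ B, t = elemTensor a b}

theorem elemTensor_mem {A : StarSubalgebra ℝ (OpProd H)} {B : StarSubalgebra ℝ (OpProd K)}
    {a : OpProd H} {b : OpProd K} (ha : a ∈ A) (hb : b ∈ B) : elemTensor a b ∈ minTensor A B :=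
  subset_closedAdjoin ⟨a, ha, b, hb, rfl⟩

end MinTensor

/-! ### Real states -/

section States

variable {A : Type*} [NormedRing A] [NormedAlgebra ℝ A] [StarRing A]

/-- A real state on a unital real C*-algebra: a unital, hermitian, positive bounded real-linear
functional (in the real setting positivity on the elements `a* a` does not imply hermiticity). -/
structure IsRealState (f : A →L[ℝ] ℝ) : Prop where
  map_one : f 1 = 1
  map_star : ∀ a, f (star a) = f a
  nonneg : ∀ a, 0 ≤ f (star a * a)

/-- The kernel of the GNS form `(b, a) ↦ f (b* a)`. For a real state this is the left ideal
`{a | f (a* a) = 0}`, by the Cauchy-Schwarz inequality. -/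
def gnsKernel (f : A →L[ℝ] ℝ) : Submodule ℝ A where
  carrier := {a | ∀ b, f (star b * a) = 0}
  add_mem' ha hb c := by simp [mul_add, ha c, hb c]
  zero_mem' c := by simp
  smul_mem' r a ha c := by simp [ha c]

/-- A state is finite-dimensional if its GNS space is finite-dimensional. -/
def IsFiniteDimensionalState (f : A →L[ℝ] ℝ) : Prop :=
  FiniteDimensional ℝ (A ⧸ gnsKernel f)

end States

/-- The minimal tensor product of the universal real POVM C*-algebras of the two parties. -/
def BellAlgebra (IA OA IB OB : Type*) [Fintype OA] [Fintype OB] :=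
  minTensor (POVMAlgebra IA OA) (POVMAlgebra IB OB)

/-- The element `e_{xa} ⊗ f_{yb}`. -/
def bellGen {IA OA IB OB : Type*} [Fintype OA] [Fintype OB] (x : IA) (y : IB) (a : OA) (b : OB) :
    BellAlgebra IA OA IB OB :=
  ⟨elemTensor (povmGen x a) (povmGen y b), elemTensor_mem (povmGen_mem x a) (povmGen_mem y b)⟩

/-- `f` is a finite-dimensional real state on the minimal tensor product of the universal real
POVM C*-algebras that agrees with the correlation `p`. -/
def IsAgreeingState {IA OA IB OB : Type*} [Fintype OA] [Fintype OB]
    (p : Correlation IA OA IB OB) (f : BellAlgebra IA OA IB OB →L[ℝ] ℝ) : Prop :=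
  IsRealState f ∧ IsFiniteDimensionalState f ∧ ∀ x y a b, f (bellGen x y a b) = p x y a b

end ComplexSelfTest

end

/-!
Both directions rest on one invariant of a strategy, its moments: the numbers `⟨ψ, (E_{x₁a₁} ⋯
E_{xᵣaᵣ} ⊗ F_{y₁b₁} ⋯ F_{yₛbₛ}) ψ⟩`, one for each pair of words. In matrix form, with the
coefficient matrix `Ψ` of `ψ` and `G = Fᵀ`, such a moment is `tr (Ψᴴ E⋯E Ψ G⋯G)`, where the second
word has to be reversed because of the transpose.

*States and moments.* The span of the words is dense in the minimal tensor product, so a bounded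
functional is determined by its values on words (`ext_bellWord`). A strategy yields a
finite-dimensional real state whose values on words are the real parts of its moments
(`Strategy.exists_isAgreeingState`), since a complex Hilbert space is a real one and `ℂᵐ ⊗_ℂ ℂⁿ`
embeds into `ℂᵐ ⊗_ℝ ℂⁿ`. Conversely, every finite-dimensional real state arises in this way from a
strategy (`IsAgreeingState.exists_strategy`): its GNS representation consists of two commuting
families of real matrices, the corresponding functional on the algebra generated by their tensor
products is given by a density matrix (`exists_density_matrix`), and this density matrix can be
purified. Hence the agreeing state is unique if and only if the real parts of the moments are the
same for all strategies that produce `p`.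

*From self-testing to uniqueness.* A complex local dilation of a strategy writes it as a
combination of a copy of the ideal strategy and a copy of its conjugate. If the ideal strategy is
support-preserving, the dilation relations extend from letters to words. The conjugate branch has
conjugate moments and the weights of the branches add up to one, so that the real parts of the
moments agree (`IsComplexLocalDilation.re_moment_eq`).

*From uniqueness to self-testing.* Choose the ideal strategy of minimal dimension. If `p` is
extreme, the operators of each party are then irreducible: a nontrivial projection commuting with
them would split `p` into strategies of smaller dimension (`IsMinimalFor.isIrreducibleFamily_E`
and its counterpart for `G`). For any other strategy producing `p`, equality of the real parts of
the moments gives an isometry between the real subspaces spanned by the words applied to the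
states. It extends to a real-linear intertwiner, the sum of a complex-linear and an antilinear one
(`MatrixStrategy.exists_intertwiners`). By Schur's lemma these are combinations of products of
local intertwiners (`exists_eq_sum_of_intertwines`), which are orthonormal for each party within
each of the two kinds and so define the isometries (`isComplexLocalDilation_of_eq_sum`). The
linear and the antilinear local intertwiners have orthogonal ranges unless a party's operators are
equivalent to their complex conjugates. In that case extremality and unique moments force all
moments to be real (`IsMinimalFor.conj_moment_eq`). The linear and the antilinear intertwiner then
take the same value on the state of the ideal strategy, and the linear one suffices.
-/


open scoped ENNReal TensorProduct Kronecker ComplexConjugate ComplexOrder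

noncomputable section

namespace ComplexSelfTest

open Matrix

/-! ### Words and strategies in matrix form -/

/-- The product `E x₁ a₁ ⋯ E xₙ aₙ` of operators labelled by the letters of a word. -/
def word {I O R : Type*} [Monoid R] (E : I → O → R) (w : List (I × O)) : R :=
  (w.map fun i => E i.1 i.2).prod

section Word

variable {I O : Type*}

@[simp]
theorem word_nil {R : Type*} [Monoid R] (E : I → O → R) : word E [] = 1 := rfl

@[simp]
theorem word_cons {R : Type*} [Monoid R] (E : I → O → R) (i : I × O) (w : List (I × O)) :
    word E (i :: w) = E i.1 i.2 * word E w := by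
  simp [word]

theorem word_append {R : Type*} [Monoid R] (E : I → O → R) (w w' : List (I × O)) :
    word E (w ++ w') = word E w * word E w' := by
  simp [word]

theorem star_word {R : Type*} [Monoid R] [StarMul R] {E : I → O → R}
    (hE : ∀ x a, star (E x a) = E x a) (w : List (I × O)) :
    star (word E w) = word E w.reverse := by
  induction w with
  | nil => simp
  | cons i w ih =>
    rw [word_cons, star_mul, ih, hE, List.reverse_cons, word_append, word_cons, word_nil, mul_one]

theorem map_word {R R' F : Type*} [Monoid R] [Monoid R'] [FunLike F R R'] [MonoidHomClass F R R']
    (f : F) (E : I → O → R) (w : List (I × O)) :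
    f (word E w) = word (fun x a => f (E x a)) w := by
  induction w with
  | nil => simp
  | cons i w ih => simp [ih]

/-- An intertwiner of two families of matrices intertwines all words. -/
theorem word_mul_eq_mul_word {α β : Type*} [Fintype α] [Fintype β] [DecidableEq α] [DecidableEq β]
    {E : I → O → Matrix α α ℂ} {E' : I → O → Matrix β β ℂ} {X : Matrix α β ℂ}
    (h : ∀ x a, E x a * X = X * E' x a) (w : List (I × O)) :
    word E w * X = X * word E' w := by
  induction w with
  | nil => simp
  | cons i w ih => rw [word_cons, word_cons, Matrix.mul_assoc, ih, ← Matrix.mul_assoc, h,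
      Matrix.mul_assoc]

theorem map_conj_word {α : Type*} [Fintype α] [DecidableEq α] (E : I → O → Matrix α α ℂ)
    (w : List (I × O)) :
    (word E w).map conj = word (fun x a => (E x a).map conj) w :=
  map_word (RingHom.mapMatrix (starRingEnd ℂ)) E w

end Word

/-- A strategy in matrix form. The vector `ψ` is recorded by its matrix `Ψ` of coefficients and the
measurements of the second party by the transposes `G = Fᵀ`, so that `(E ⊗ F) ψ` has the coefficient
matrix `E * Ψ * G`. -/
structure MatrixStrategy (IA OA IB OB : Type*) [Fintype OA] [Fintype OB] (α β : Type*)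
    [Fintype α] [Fintype β] [DecidableEq α] [DecidableEq β] where
  Ψ : Matrix α β ℂ
  E : IA → OA → Matrix α α ℂ
  G : IB → OB → Matrix β β ℂ
  norm_Ψ : (Ψᴴ * Ψ).trace = 1
  E_pos : ∀ x a, (E x a).PosSemidef
  G_pos : ∀ y b, (G y b).PosSemidef
  E_sum : ∀ x, ∑ a, E x a = 1
  G_sum : ∀ y, ∑ b, G y b = 1

/-- The matrix of coefficients of a bipartite vector. -/
def coeffMatrix {α β R : Type*} (ψ : α × β → R) : Matrix α β R := Matrix.of fun i j => ψ (i, j)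

theorem coeffMatrix_injective {α β : Type*} :
    Function.Injective (coeffMatrix : (α × β → ℂ) → Matrix α β ℂ) := fun _ _ h =>
  funext fun ⟨i, j⟩ => congrFun (congrFun h i) j

theorem coeffMatrix_kronecker_mulVec {α β α' β' R : Type*} [Fintype α] [Fintype β]
    [CommSemiring R] (X : Matrix α' α R) (Y : Matrix β' β R) (ψ : α × β → R) :
    coeffMatrix ((X ⊗ₖ Y).mulVec ψ) = X * coeffMatrix ψ * Yᵀ := by
  ext i j
  simp only [coeffMatrix, Matrix.of_apply, Matrix.mulVec, dotProduct, Matrix.mul_apply,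
    Fintype.sum_prod_type, Matrix.kroneckerMap_apply, Matrix.transpose_apply, Finset.sum_mul]
  rw [Finset.sum_comm]
  exact Finset.sum_congr rfl fun _ _ => Finset.sum_congr rfl fun _ _ => by ring

theorem star_dotProduct_eq_trace {α β R : Type*} [Fintype α] [Fintype β] [CommSemiring R]
    [StarRing R] (φ χ : α × β → R) :
    star φ ⬝ᵥ χ = ((coeffMatrix φ)ᴴ * coeffMatrix χ).trace := by
  simp only [coeffMatrix, dotProduct, Matrix.trace, Matrix.diag, Matrix.mul_apply,
    Matrix.conjTranspose_apply, Matrix.of_apply, Fintype.sum_prod_type, Pi.star_apply]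
  exact Finset.sum_comm

theorem coeffMatrix_star {α β : Type*} (ψ : α × β → ℂ) :
    coeffMatrix (star ψ) = (coeffMatrix ψ).map conj := rfl

theorem trace_conjTranspose_mul_self_eq_sum {α β : Type*} [Fintype α] [Fintype β]
    (ψ : α × β → ℂ) :
    ((coeffMatrix ψ)ᴴ * coeffMatrix ψ).trace = ((∑ i, ‖ψ i‖ ^ 2 : ℝ) : ℂ) := by
  rw [← star_dotProduct_eq_trace]
  simp [dotProduct, Complex.conj_mul']

section MatrixStrategy

variable {IA OA IB OB : Type*} [Fintype OA] [Fintype OB]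

/-- The matrix form of a strategy. -/
def Strategy.toMatrixStrategy {m n : ℕ} (S : Strategy IA OA IB OB m n) :
    MatrixStrategy IA OA IB OB (Fin m) (Fin n) where
  Ψ := coeffMatrix S.ψ
  E := S.E
  G y b := (S.F y b)ᵀ
  norm_Ψ := by rw [trace_conjTranspose_mul_self_eq_sum, S.norm_ψ, Complex.ofReal_one]
  E_pos := S.E_pos
  G_pos y b := (S.F_pos y b).transpose
  E_sum := S.E_sum
  G_sum y := by rw [← Matrix.transpose_sum, S.F_sum, Matrix.transpose_one]

namespace MatrixStrategy

variable {α β : Type*} [Fintype α] [Fintype β] [DecidableEq α] [DecidableEq β]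

theorem E_star (S : MatrixStrategy IA OA IB OB α β) (x : IA) (a : OA) : (S.E x a)ᴴ = S.E x a :=
  (S.E_pos x a).1

theorem G_star (S : MatrixStrategy IA OA IB OB α β) (y : IB) (b : OB) : (S.G y b)ᴴ = S.G y b :=
  (S.G_pos y b).1

/-- The moment `⟨ψ| E_{x₁a₁} ⋯ ⊗ F_{y₁b₁} ⋯ |ψ⟩`. -/
def moment (S : MatrixStrategy IA OA IB OB α β) (w : List (IA × OA)) (v : List (IB × OB)) : ℂ :=
  (S.Ψᴴ * word S.E w * S.Ψ * word S.G v).trace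

/-- A strategy in matrix form produces `p`. -/
def Produces (S : MatrixStrategy IA OA IB OB α β) (p : Correlation IA OA IB OB) : Prop :=
  ∀ x y a b, (S.Ψᴴ * S.E x a * S.Ψ * S.G y b).trace = (p x y a b : ℂ)

/-- Exchange of the two parties. -/
def swap (S : MatrixStrategy IA OA IB OB α β) : MatrixStrategy IB OB IA OA β α where
  Ψ := S.Ψᴴ
  E := S.G
  G := S.E
  norm_Ψ := by rw [Matrix.conjTranspose_conjTranspose, Matrix.trace_mul_comm, S.norm_Ψ]
  E_pos := S.G_pos
  G_pos := S.E_pos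
  E_sum := S.G_sum
  G_sum := S.E_sum

theorem moment_swap (S : MatrixStrategy IA OA IB OB α β) (w : List (IA × OA))
    (v : List (IB × OB)) : S.swap.moment v w = S.moment w v := by
  simp only [moment, swap, Matrix.conjTranspose_conjTranspose]
  rw [Matrix.mul_assoc, Matrix.trace_mul_comm]
  simp only [Matrix.mul_assoc]

theorem produces_iff_moment (S : MatrixStrategy IA OA IB OB α β) (p : Correlation IA OA IB OB) :
    S.Produces p ↔ ∀ x y a b, S.moment [(x, a)] [(y, b)] = (p x y a b : ℂ) := by
  simp [Produces, moment]

theorem Produces.swap {S : MatrixStrategy IA OA IB OB α β} {p : Correlation IA OA IB OB}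
    (h : S.Produces p) : S.swap.Produces fun y x b a => p x y a b := by
  rw [produces_iff_moment] at h ⊢
  intro y x b a
  rw [moment_swap, h]

/-- The strategy with coordinates relabelled by `Fin`. -/
def toStrategy (S : MatrixStrategy IA OA IB OB α β) :
    Strategy IA OA IB OB (Fintype.card α) (Fintype.card β) where
  ψ i := S.Ψ ((Fintype.equivFin α).symm i.1) ((Fintype.equivFin β).symm i.2)
  E x a := (S.E x a).submatrix (Fintype.equivFin α).symm (Fintype.equivFin α).symm
  F y b := (S.G y b)ᵀ.submatrix (Fintype.equivFin β).symm (Fintype.equivFin β).symm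
  norm_ψ := by
    have h := S.norm_Ψ
    have h2 := trace_conjTranspose_mul_self_eq_sum fun i : α × β => S.Ψ i.1 i.2
    change (S.Ψᴴ * S.Ψ).trace = _ at h2
    rw [h2] at h
    rw [← Complex.ofReal_inj, Complex.ofReal_one, ← h]
    congr 1
    exact Fintype.sum_equiv ((Fintype.equivFin α).symm.prodCongr (Fintype.equivFin β).symm) _ _
      fun _ => rfl
  E_pos x a := (S.E_pos x a).submatrix _
  F_pos y b := (S.G_pos y b).transpose.submatrix _
  E_sum x := by
    rw [← Matrix.submatrix_one_equiv (Fintype.equivFin α).symm, ← S.E_sum x]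
    ext i j
    simp [Matrix.sum_apply]
  F_sum y := by
    rw [← Matrix.submatrix_one_equiv (Fintype.equivFin β).symm, ← Matrix.transpose_one,
      ← S.G_sum y]
    ext i j
    simp [Matrix.sum_apply]

theorem word_submatrix {I O γ δ : Type*} [Fintype γ] [DecidableEq γ] [Fintype δ] [DecidableEq δ]
    (E : I → O → Matrix γ γ ℂ) (e : δ ≃ γ) (w : List (I × O)) :
    word (fun x a => (E x a).submatrix e e) w = (word E w).submatrix e e := by
  induction w with
  | nil => simp
  | cons i w ih => rw [word_cons, word_cons, ih, Matrix.submatrix_mul_equiv]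

theorem moment_toStrategy (S : MatrixStrategy IA OA IB OB α β) (w : List (IA × OA))
    (v : List (IB × OB)) : S.toStrategy.toMatrixStrategy.moment w v = S.moment w v := by
  have h1 : S.toStrategy.toMatrixStrategy.Ψ =
      S.Ψ.submatrix (Fintype.equivFin α).symm (Fintype.equivFin β).symm := rfl
  have h2 : S.toStrategy.toMatrixStrategy.E = fun x a =>
      (S.E x a).submatrix (Fintype.equivFin α).symm (Fintype.equivFin α).symm := rfl
  have h3 : S.toStrategy.toMatrixStrategy.G = fun x a =>
      (S.G x a).submatrix (Fintype.equivFin β).symm (Fintype.equivFin β).symm := rfl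
  rw [moment, h1, h2, h3, word_submatrix, word_submatrix, Matrix.conjTranspose_submatrix,
    Matrix.submatrix_mul_equiv, Matrix.submatrix_mul_equiv, Matrix.submatrix_mul_equiv, moment]
  simp only [Matrix.trace, Matrix.diag, Matrix.submatrix_apply]
  exact Fintype.sum_equiv (Fintype.equivFin β).symm _ _ fun _ => rfl

end MatrixStrategy

theorem Strategy.toMatrixStrategy_produces {m n : ℕ} {S : Strategy IA OA IB OB m n}
    {p : Correlation IA OA IB OB} : S.toMatrixStrategy.Produces p ↔ S.Produces p := by
  refine forall_congr' fun x => forall_congr' fun y => forall_congr' fun a => forall_congr' fun b =>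
    ?_
  rw [star_dotProduct_eq_trace, coeffMatrix_kronecker_mulVec]
  simp [Strategy.toMatrixStrategy, Matrix.mul_assoc]

namespace MatrixStrategy

variable {α β : Type*} [Fintype α] [Fintype β] [DecidableEq α] [DecidableEq β]

theorem Produces.toStrategy {S : MatrixStrategy IA OA IB OB α β} {p : Correlation IA OA IB OB}
    (h : S.Produces p) : S.toStrategy.Produces p := by
  rw [← Strategy.toMatrixStrategy_produces]
  rw [produces_iff_moment] at h ⊢
  intro x y a b
  rw [moment_toStrategy, h]

end MatrixStrategy

end MatrixStrategy

open UniformSpace (Completion)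

/-! ### Complex strategies as real representations -/

/-- An operator between `0` and `1` is a contraction; over the reals this is not available from the
theory of C*-algebras. -/
theorem norm_le_one_of_isPositive {H : Type*} [NormedAddCommGroup H] [InnerProductSpace ℝ H]
    {T : H →L[ℝ] H} (hT : T.IsPositive) (hT' : (1 - T).IsPositive) : ‖T‖ ≤ 1 := by
  refine ContinuousLinearMap.opNorm_le_bound _ zero_le_one fun x => ?_
  rw [one_mul]
  -- `T (1 - T) = T (1 - T) T + (1 - T) T (1 - T)` is positive
  have h1 := hT'.inner_nonneg_left (T x)
  have h2 := hT.inner_nonneg_left (x - T x)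
  have h3 := hT.inner_left_eq_inner_right (T x) x
  have h4 := hT.inner_left_eq_inner_right (T x) (T x)
  have h5 : inner ℝ x (T x) = inner ℝ (T x) x := real_inner_comm _ _
  have h6 := norm_sub_sq_real x (T x)
  have h7 := sq_nonneg ‖x - T x‖
  simp only [_root_.sub_apply, one_apply_eq_self, map_sub,
    inner_sub_left, inner_sub_right, real_inner_self_eq_norm_sq] at h1 h2 h3 h4
  rw [h5] at h6
  refine le_of_sq_le_sq ?_ (norm_nonneg _)
  nlinarith

/-- The operator on `ℂᵐ`, seen as a real Hilbert space, of a complex matrix. -/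
def realOp {m : ℕ} (A : Matrix (Fin m) (Fin m) ℂ) :
    EuclideanSpace ℂ (Fin m) →L[ℝ] EuclideanSpace ℂ (Fin m) :=
  (Matrix.toEuclideanCLM (𝕜 := ℂ) A).restrictScalars ℝ

theorem realOp_apply {m : ℕ} (A : Matrix (Fin m) (Fin m) ℂ) (u : EuclideanSpace ℂ (Fin m)) :
    realOp A u = WithLp.toLp 2 (A.mulVec u.ofLp) := rfl

theorem realOp_mul {m : ℕ} (A B : Matrix (Fin m) (Fin m) ℂ) :
    realOp (A * B) = realOp A * realOp B := by
  rw [realOp, map_mul]; rfl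

theorem realOp_one {m : ℕ} : realOp (1 : Matrix (Fin m) (Fin m) ℂ) = 1 := by
  rw [realOp, map_one]; rfl

theorem real_inner_euclidean {m : ℕ} (u v : EuclideanSpace ℂ (Fin m)) :
    inner ℝ u v = (star u.ofLp ⬝ᵥ v.ofLp).re := by
  simp only [PiLp.inner_apply, dotProduct, Complex.inner, Complex.re_sum, Pi.star_apply,
    RCLike.star_def, mul_comm]

theorem isPositive_realOp {m : ℕ} {A : Matrix (Fin m) (Fin m) ℂ} (hA : A.PosSemidef) :
    (realOp A).IsPositive := by
  refine ⟨fun u v => ?_, fun u => ?_⟩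
  · change inner ℝ (realOp A u) v = inner ℝ u (realOp A v)
    rw [real_inner_euclidean, real_inner_euclidean, realOp_apply, realOp_apply]
    change (star (A.mulVec u.ofLp) ⬝ᵥ _).re = (_ ⬝ᵥ A.mulVec v.ofLp).re
    rw [Matrix.star_mulVec, hA.1.eq, Matrix.dotProduct_mulVec]
  · change 0 ≤ inner ℝ (realOp A u) u
    rw [real_inner_comm, real_inner_euclidean, realOp_apply]
    exact hA.re_dotProduct_nonneg u.ofLp

theorem realOp_add {m : ℕ} (A B : Matrix (Fin m) (Fin m) ℂ) :
    realOp (A + B) = realOp A + realOp B := by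
  rw [realOp, map_add]; rfl

theorem realOp_sum {m : ℕ} {O : Type*} (s : Finset O) (A : O → Matrix (Fin m) (Fin m) ℂ) :
    realOp (∑ a ∈ s, A a) = ∑ a ∈ s, realOp (A a) :=
  map_sum (AddMonoidHom.mk' (realOp (m := m)) realOp_add) A s

/-- A family of complex POVMs, seen as a family of POVMs on a real Hilbert space. -/
def realPOVM {I O : Type*} [Fintype O] {m : ℕ} [NeZero m] (E : I → O → Matrix (Fin m) (Fin m) ℂ)
    (hE : ∀ x a, (E x a).PosSemidef) (hsum : ∀ x, ∑ a, E x a = 1) : RealPOVM I O where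
  H := EuclideanSpace ℂ (Fin m)
  E x a := realOp (E x a)
  pos x a := isPositive_realOp (hE x a)
  contr x a := by
    refine norm_le_one_of_isPositive (isPositive_realOp (hE x a)) ?_
    classical
    have h := hsum x
    rw [← Finset.add_sum_erase _ _ (Finset.mem_univ a)] at h
    rw [← realOp_one, ← h, realOp_add, add_sub_cancel_left]
    exact isPositive_realOp (Matrix.posSemidef_sum _ fun a _ => hE x a)
  sum_eq x := by rw [← realOp_sum, hsum, realOp_one]

section opTensor

variable {H K : Type*} [NormedAddCommGroup H] [InnerProductSpace ℝ H]
  [NormedAddCommGroup K] [InnerProductSpace ℝ K]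

theorem opTensor_coe (T : H →L[ℝ] H) (S : K →L[ℝ] K) (v : H ⊗[ℝ] K) :
    opTensor T S (v : HilbertTensor H K) =
      ((TensorProduct.map (T : H →ₗ[ℝ] H) (S : K →ₗ[ℝ] K) v : H ⊗[ℝ] K) : HilbertTensor H K) := by
  rw [opTensor, ContinuousLinearMap.completion_apply_coe, TensorProduct.mapL_apply]

theorem opTensor_ext {R R' : HilbertTensor H K →L[ℝ] HilbertTensor H K}
    (h : ∀ u v, R ((u ⊗ₜ[ℝ] v : H ⊗[ℝ] K) : HilbertTensor H K) =
      R' ((u ⊗ₜ[ℝ] v : H ⊗[ℝ] K) : HilbertTensor H K)) : R = R' := by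
  ext z
  induction z using Completion.induction_on with
  | hp => exact isClosed_eq R.continuous R'.continuous
  | ih z =>
    induction z using TensorProduct.induction_on with
    | zero => rw [Completion.coe_zero, map_zero, map_zero]
    | tmul u v => exact h u v
    | add x y hx hy => rw [Completion.coe_add, map_add, map_add, hx, hy]

theorem opTensor_mul (T T' : H →L[ℝ] H) (S S' : K →L[ℝ] K) :
    opTensor T S * opTensor T' S' = opTensor (T * T') (S * S') := by
  refine opTensor_ext fun u v => ?_
  rw [mul_apply_eq_comp, opTensor_coe, opTensor_coe, opTensor_coe]
  rfl

theorem opTensor_one : opTensor (1 : H →L[ℝ] H) (1 : K →L[ℝ] K) = 1 := by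
  refine opTensor_ext fun u v => ?_
  rw [opTensor_coe]
  rfl

theorem opTensor_add_left (T T' : H →L[ℝ] H) (S : K →L[ℝ] K) :
    opTensor (T + T') S = opTensor T S + opTensor T' S := by
  refine opTensor_ext fun u v => ?_
  rw [_root_.add_apply, opTensor_coe, opTensor_coe, opTensor_coe, ← Completion.coe_add]
  congr 1
  exact TensorProduct.add_tmul _ _ _

theorem opTensor_add_right (T : H →L[ℝ] H) (S S' : K →L[ℝ] K) :
    opTensor T (S + S') = opTensor T S + opTensor T S' := by
  refine opTensor_ext fun u v => ?_
  rw [_root_.add_apply, opTensor_coe, opTensor_coe, opTensor_coe, ← Completion.coe_add]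
  congr 1
  exact TensorProduct.tmul_add _ _ _

theorem opTensor_smul_left (r : ℝ) (T : H →L[ℝ] H) (S : K →L[ℝ] K) :
    opTensor (r • T) S = r • opTensor T S := by
  refine opTensor_ext fun u v => ?_
  rw [_root_.smul_apply, opTensor_coe, opTensor_coe, ← Completion.coe_smul]
  rfl

theorem opTensor_smul_right (r : ℝ) (T : H →L[ℝ] H) (S : K →L[ℝ] K) :
    opTensor T (r • S) = r • opTensor T S := by
  refine opTensor_ext fun u v => ?_
  rw [_root_.smul_apply, opTensor_coe, opTensor_coe, ← Completion.coe_smul]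
  congr 1
  exact TensorProduct.tmul_smul _ _ _

theorem star_opTensor [CompleteSpace H] [CompleteSpace K] (T : H →L[ℝ] H) (S : K →L[ℝ] K) :
    star (opTensor T S) = opTensor (star T) (star S) := by
  refine opTensor_ext fun u v => ?_
  refine ext_inner_left ℝ fun z => ?_
  rw [ContinuousLinearMap.star_eq_adjoint, ContinuousLinearMap.adjoint_inner_right]
  induction z using Completion.induction_on with
  | hp => exact isClosed_eq (by fun_prop) (by fun_prop)
  | ih z =>
    induction z using TensorProduct.induction_on with
    | zero => rw [Completion.coe_zero, map_zero, inner_zero_left, inner_zero_left]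
    | tmul x y =>
      rw [opTensor_coe, opTensor_coe, Completion.inner_coe, Completion.inner_coe]
      simp [ContinuousLinearMap.star_eq_adjoint, TensorProduct.inner_tmul,
        ContinuousLinearMap.adjoint_inner_right]
    | add x y hx hy => rw [Completion.coe_add, map_add, inner_add_left, inner_add_left, hx, hy]

end opTensor

theorem OpProd.ext {ι : Type*} {H : ι → Type*} [∀ i, NormedAddCommGroup (H i)]
    [∀ i, InnerProductSpace ℝ (H i)] {a b : OpProd H} (h : ∀ i, a i = b i) : a = b :=
  Subtype.ext (funext h)

section elemTensor

variable {ι κ : Type*} {H : ι → Type*} {K : κ → Type*}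
  [∀ i, NormedAddCommGroup (H i)] [∀ i, InnerProductSpace ℝ (H i)]
  [∀ j, NormedAddCommGroup (K j)] [∀ j, InnerProductSpace ℝ (K j)]
  [∀ i, Nontrivial (H i)] [∀ j, Nontrivial (K j)]

theorem elemTensor_mul (a a' : OpProd H) (b b' : OpProd K) :
    elemTensor a b * elemTensor a' b' = elemTensor (a * a') (b * b') :=
  OpProd.ext fun ij => opTensor_mul (a ij.1) (a' ij.1) (b ij.2) (b' ij.2)

theorem elemTensor_one : elemTensor (1 : OpProd H) (1 : OpProd K) = 1 :=
  OpProd.ext fun _ => opTensor_one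

theorem elemTensor_add_left (a a' : OpProd H) (b : OpProd K) :
    elemTensor (a + a') b = elemTensor a b + elemTensor a' b :=
  OpProd.ext fun ij => opTensor_add_left (a ij.1) (a' ij.1) (b ij.2)

theorem elemTensor_add_right (a : OpProd H) (b b' : OpProd K) :
    elemTensor a (b + b') = elemTensor a b + elemTensor a b' :=
  OpProd.ext fun ij => opTensor_add_right (a ij.1) (b ij.2) (b' ij.2)

theorem elemTensor_smul_left (r : ℝ) (a : OpProd H) (b : OpProd K) :
    elemTensor (r • a) b = r • elemTensor a b :=
  OpProd.ext fun ij => opTensor_smul_left r (a ij.1) (b ij.2)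

theorem elemTensor_smul_right (r : ℝ) (a : OpProd H) (b : OpProd K) :
    elemTensor a (r • b) = r • elemTensor a b :=
  OpProd.ext fun ij => opTensor_smul_right r (a ij.1) (b ij.2)

theorem norm_elemTensor_le (a : OpProd H) (b : OpProd K) : ‖elemTensor a b‖ ≤ ‖a‖ * ‖b‖ := by
  refine lp.norm_le_of_forall_le (by positivity) fun ij => ?_
  exact (norm_opTensor_le _ _).trans (mul_le_mul (a.norm_apply_le ij.1) (b.norm_apply_le ij.2)
    (norm_nonneg _) (norm_nonneg _))

theorem star_elemTensor [∀ i, CompleteSpace (H i)] [∀ j, CompleteSpace (K j)]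
    (a : OpProd H) (b : OpProd K) : star (elemTensor a b) = elemTensor (star a) (star b) :=
  OpProd.ext fun ij => star_opTensor (a ij.1) (b ij.2)

end elemTensor

section Bell

variable {IA OA IB OB : Type*} [Fintype OA] [Fintype OB]

/-- The element `e_{xa} ⊗ 1`. -/
def aliceGen (x : IA) (a : OA) : BellAlgebra IA OA IB OB :=
  ⟨elemTensor (povmGen x a) 1, elemTensor_mem (povmGen_mem x a) (one_mem _)⟩

/-- The element `1 ⊗ f_{yb}`. -/
def bobGen (y : IB) (b : OB) : BellAlgebra IA OA IB OB :=
  ⟨elemTensor 1 (povmGen y b), elemTensor_mem (one_mem _) (povmGen_mem y b)⟩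

/-- The element `e_{x₁a₁} ⋯ ⊗ f_{y₁b₁} ⋯`. -/
def bellWord (w : List (IA × OA)) (v : List (IB × OB)) : BellAlgebra IA OA IB OB :=
  word aliceGen w * word bobGen v

theorem bellGen_eq (x : IA) (y : IB) (a : OA) (b : OB) :
    bellGen x y a b = bellWord [(x, a)] [(y, b)] := by
  apply Subtype.ext
  simp only [bellWord, word_cons, word_nil, mul_one]
  change _ = elemTensor _ _ * elemTensor _ _
  rw [elemTensor_mul, mul_one, one_mul]
  rfl

theorem commute_aliceGen_bobGen (x : IA) (a : OA) (y : IB) (b : OB) :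
    Commute (aliceGen x a) (bobGen y b : BellAlgebra IA OA IB OB) := by
  apply Subtype.ext
  change elemTensor _ _ * elemTensor _ _ = elemTensor _ _ * elemTensor _ _
  rw [elemTensor_mul, elemTensor_mul, mul_one, mul_one, one_mul, one_mul]

theorem star_povmGen {I O : Type*} [Fintype O] (x : I) (a : O) :
    star (povmGen x a) = povmGen x a :=
  OpProd.ext fun S => (S.pos x a).isSelfAdjoint

theorem star_aliceGen (x : IA) (a : OA) :
    star (aliceGen x a : BellAlgebra IA OA IB OB) = aliceGen x a := by
  apply Subtype.ext
  change star (elemTensor _ _) = elemTensor _ _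
  rw [star_elemTensor, star_one, star_povmGen]

theorem star_bobGen (y : IB) (b : OB) :
    star (bobGen y b : BellAlgebra IA OA IB OB) = bobGen y b := by
  apply Subtype.ext
  change star (elemTensor _ _) = elemTensor _ _
  rw [star_elemTensor, star_one, star_povmGen]

/-- The coordinate of the minimal tensor product at a pair of families of POVMs. -/
def bellRep (S : RealPOVM IA OA) (R : RealPOVM IB OB) :
    BellAlgebra IA OA IB OB →⋆ₐ[ℝ] (HilbertTensor S.H R.H →L[ℝ] HilbertTensor S.H R.H) where
  toFun a := a.1 (S, R)
  map_one' := rfl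
  map_mul' _ _ := rfl
  map_zero' := rfl
  map_add' _ _ := rfl
  commutes' _ := rfl
  map_star' _ := rfl

theorem norm_bellRep_le (S : RealPOVM IA OA) (R : RealPOVM IB OB) (a : BellAlgebra IA OA IB OB) :
    ‖bellRep S R a‖ ≤ ‖a‖ :=
  OpProd.norm_apply_le a.1 (S, R)

theorem word_opTensor_left {I O H K : Type*} [NormedAddCommGroup H] [InnerProductSpace ℝ H]
    [NormedAddCommGroup K] [InnerProductSpace ℝ K] (E : I → O → H →L[ℝ] H) (w : List (I × O)) :
    word (fun x a => opTensor (E x a) (1 : K →L[ℝ] K)) w = opTensor (word E w) 1 := by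
  induction w with
  | nil => rw [word_nil, word_nil, opTensor_one]
  | cons i w ih => rw [word_cons, word_cons, ih, opTensor_mul, one_mul]

theorem word_opTensor_right {I O H K : Type*} [NormedAddCommGroup H] [InnerProductSpace ℝ H]
    [NormedAddCommGroup K] [InnerProductSpace ℝ K] (F : I → O → K →L[ℝ] K) (w : List (I × O)) :
    word (fun x a => opTensor (1 : H →L[ℝ] H) (F x a)) w = opTensor 1 (word F w) := by
  induction w with
  | nil => rw [word_nil, word_nil, opTensor_one]
  | cons i w ih => rw [word_cons, word_cons, ih, opTensor_mul, one_mul]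

theorem bellRep_bellWord (S : RealPOVM IA OA) (R : RealPOVM IB OB) (w : List (IA × OA))
    (v : List (IB × OB)) :
    bellRep S R (bellWord w v) = opTensor (word S.E w) (word R.E v) := by
  rw [bellWord, map_mul, map_word, map_word]
  have h1 : (fun x a => bellRep S R (aliceGen x a)) = fun x a => opTensor (S.E x a) 1 := rfl
  have h2 : (fun y b => bellRep S R (bobGen y b)) = fun y b => opTensor 1 (R.E y b) := rfl
  rw [h1, h2, word_opTensor_left, word_opTensor_right, opTensor_mul, mul_one, one_mul]

/-- The vector state of a unit vector in a coordinate of the minimal tensor product. -/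
def vectorState (S : RealPOVM IA OA) (R : RealPOVM IB OB) (φ : HilbertTensor S.H R.H) :
    BellAlgebra IA OA IB OB →L[ℝ] ℝ :=
  LinearMap.mkContinuous
    { toFun := fun a => inner ℝ φ (bellRep S R a φ)
      map_add' := fun a b => by rw [map_add, _root_.add_apply, inner_add_right]
      map_smul' := fun r a => by
        rw [map_smul, _root_.smul_apply, inner_smul_right]; rfl }
    (‖φ‖ * ‖φ‖) fun a => by
      refine (norm_inner_le_norm (𝕜 := ℝ) φ (bellRep S R a φ)).trans ?_
      calc ‖φ‖ * ‖bellRep S R a φ‖ ≤ ‖φ‖ * (‖a‖ * ‖φ‖) := by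
            gcongr
            exact ContinuousLinearMap.le_of_opNorm_le _ (norm_bellRep_le S R a) φ
        _ = ‖φ‖ * ‖φ‖ * ‖a‖ := by ring

theorem vectorState_apply (S : RealPOVM IA OA) (R : RealPOVM IB OB) (φ : HilbertTensor S.H R.H)
    (a : BellAlgebra IA OA IB OB) : vectorState S R φ a = inner ℝ φ (bellRep S R a φ) := rfl

theorem isRealState_vectorState (S : RealPOVM IA OA) (R : RealPOVM IB OB)
    (φ : HilbertTensor S.H R.H) (hφ : inner ℝ φ φ = (1 : ℝ)) :
    IsRealState (vectorState S R φ) where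
  map_one := by rw [vectorState_apply, map_one]; exact hφ
  map_star a := by
    rw [vectorState_apply, vectorState_apply, map_star, ContinuousLinearMap.star_eq_adjoint,
      ContinuousLinearMap.adjoint_inner_right, real_inner_comm]
  nonneg a := by
    rw [vectorState_apply, map_mul, map_star, mul_apply_eq_comp,
      ContinuousLinearMap.star_eq_adjoint, ContinuousLinearMap.adjoint_inner_right]
    exact real_inner_self_nonneg

theorem isFiniteDimensionalState_vectorState (S : RealPOVM IA OA) (R : RealPOVM IB OB)
    [FiniteDimensional ℝ S.H] [FiniteDimensional ℝ R.H] (φ : HilbertTensor S.H R.H) :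
    IsFiniteDimensionalState (vectorState S R φ) := by
  have hfin : FiniteDimensional ℝ (HilbertTensor S.H R.H) := by
    let c : S.H ⊗[ℝ] R.H →L[ℝ] HilbertTensor S.H R.H :=
      Completion.toComplL (𝕜 := ℝ) (E := S.H ⊗[ℝ] R.H)
    have hdense : DenseRange c := Completion.denseRange_coe (α := S.H ⊗[ℝ] R.H)
    have hc : LinearMap.range c.toLinearMap = ⊤ := by
      rw [← (Submodule.closed_of_finiteDimensional
        (LinearMap.range c.toLinearMap)).submodule_topologicalClosure_eq]
      exact Submodule.dense_iff_topologicalClosure_eq_top.mp hdense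
    exact Module.Finite.of_surjective c.toLinearMap (LinearMap.range_eq_top.mp hc)
  let ev : BellAlgebra IA OA IB OB →ₗ[ℝ] HilbertTensor S.H R.H :=
    { toFun := fun a => bellRep S R a φ
      map_add' := fun a b => by rw [map_add]; rfl
      map_smul' := fun r a => by rw [map_smul]; rfl }
  have hle : LinearMap.ker ev ≤ gnsKernel (vectorState S R φ) := fun a ha b => by
    have ha' : bellRep S R a φ = 0 := ha
    rw [vectorState_apply, map_mul, mul_apply_eq_comp, ha', map_zero, inner_zero_right]
  have : FiniteDimensional ℝ (BellAlgebra IA OA IB OB ⧸ LinearMap.ker ev) :=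
    (LinearMap.quotKerEquivRange ev).symm.finiteDimensional
  exact Module.Finite.of_surjective (Submodule.factor hle) (Submodule.factor_surjective hle)

/-- The vector of `ℂᵐ ⊗_ℝ ℂⁿ` corresponding to a vector of `ℂᵐ ⊗_ℂ ℂⁿ`: the complex tensor product
is embedded as the subspace on which `i ⊗ i = -1`, by `u ⊗ v ↦ (u ⊗ v - i u ⊗ i v) / √2`. -/
def realVector {m n : ℕ} (ψ : Fin m × Fin n → ℂ) :
    EuclideanSpace ℂ (Fin m) ⊗[ℝ] EuclideanSpace ℂ (Fin n) :=
  ∑ i : Fin m × Fin n,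
    (EuclideanSpace.single i.1 (((√2)⁻¹ : ℝ) * ψ i) ⊗ₜ[ℝ] EuclideanSpace.single i.2 1 -
      EuclideanSpace.single i.1 (((√2)⁻¹ : ℝ) * (Complex.I * ψ i)) ⊗ₜ[ℝ]
        EuclideanSpace.single i.2 Complex.I)

theorem inner_single_realOp_single {m : ℕ} (A : Matrix (Fin m) (Fin m) ℂ) (i i' : Fin m)
    (c c' : ℂ) :
    inner ℝ (EuclideanSpace.single i c) (realOp A (EuclideanSpace.single i' c')) =
      (conj c * (A i i' * c')).re := by
  rw [real_inner_euclidean, realOp_apply]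
  change (star (Pi.single i c) ⬝ᵥ A.mulVec (Pi.single i' c')).re = _
  rw [← Pi.single_star, single_dotProduct, Matrix.mulVec_single]
  simp

theorem inner_sum_tmul_sub_tmul {H K κ : Type*} [NormedAddCommGroup H] [InnerProductSpace ℝ H]
    [NormedAddCommGroup K] [InnerProductSpace ℝ K] [Fintype κ] (u u' : κ → H) (v v' : κ → K)
    (T : H →L[ℝ] H) (S : K →L[ℝ] K) :
    inner ℝ (∑ i, (u i ⊗ₜ[ℝ] v i - u' i ⊗ₜ[ℝ] v' i))
      (TensorProduct.map (T : H →ₗ[ℝ] H) (S : K →ₗ[ℝ] K)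
        (∑ i, (u i ⊗ₜ[ℝ] v i - u' i ⊗ₜ[ℝ] v' i))) =
    ∑ i, ∑ j, (inner ℝ (u i) (T (u j)) * inner ℝ (v i) (S (v j)) -
      inner ℝ (u i) (T (u' j)) * inner ℝ (v i) (S (v' j)) -
      (inner ℝ (u' i) (T (u j)) * inner ℝ (v' i) (S (v j)) -
      inner ℝ (u' i) (T (u' j)) * inner ℝ (v' i) (S (v' j)))) := by
  rw [map_sum, sum_inner]
  refine Finset.sum_congr rfl fun i _ => ?_
  rw [inner_sum]
  refine Finset.sum_congr rfl fun j _ => ?_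
  rw [map_sub, inner_sub_left, inner_sub_right, inner_sub_right]
  simp only [TensorProduct.map_tmul, TensorProduct.inner_tmul, ContinuousLinearMap.coe_coe]

theorem inner_opTensor_realVector {m n : ℕ} (ψ : Fin m × Fin n → ℂ) (A : Matrix (Fin m) (Fin m) ℂ)
    (B : Matrix (Fin n) (Fin n) ℂ) :
    inner ℝ ((realVector ψ : EuclideanSpace ℂ (Fin m) ⊗[ℝ] EuclideanSpace ℂ (Fin n)) :
        HilbertTensor (EuclideanSpace ℂ (Fin m)) (EuclideanSpace ℂ (Fin n)))
      (opTensor (realOp A) (realOp B)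
        ((realVector ψ : EuclideanSpace ℂ (Fin m) ⊗[ℝ] EuclideanSpace ℂ (Fin n)) :
        HilbertTensor (EuclideanSpace ℂ (Fin m)) (EuclideanSpace ℂ (Fin n)))) =
      ((coeffMatrix ψ)ᴴ * A * coeffMatrix ψ * Bᵀ).trace.re := by
  have h2 : (√2)⁻¹ * (√2)⁻¹ * 2 = (1 : ℝ) := by
    rw [← mul_inv, Real.mul_self_sqrt zero_le_two]; norm_num
  rw [opTensor_coe, Completion.inner_coe, Matrix.mul_assoc, Matrix.mul_assoc, ← Matrix.mul_assoc A,
    ← coeffMatrix_kronecker_mulVec, ← star_dotProduct_eq_trace]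
  refine (inner_sum_tmul_sub_tmul _ _ _ _ _ _).trans ?_
  simp only [inner_single_realOp_single, dotProduct, Matrix.mulVec,
    Matrix.kroneckerMap_apply, Pi.star_apply, Complex.re_sum, Finset.mul_sum]
  refine Finset.sum_congr rfl fun i _ => Finset.sum_congr rfl fun j _ => ?_
  rw [← one_mul (star (ψ i) * _).re, ← h2]
  simp only [Complex.mul_re, Complex.mul_im, Complex.conj_re, Complex.conj_im, Complex.I_re,
    Complex.I_im, Complex.one_re, Complex.one_im, map_mul, Complex.conj_I, Complex.neg_re,
    Complex.neg_im, RCLike.star_def, map_one, Complex.conj_ofReal, Complex.ofReal_re,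
    Complex.ofReal_im]
  ring

/-- Every strategy producing `p` gives a finite-dimensional real state agreeing with `p`, namely the
real part of its vector state. -/
theorem Strategy.exists_isAgreeingState {m n : ℕ} (S : Strategy IA OA IB OB m n)
    {p : Correlation IA OA IB OB} (hp : S.Produces p) :
    ∃ f : BellAlgebra IA OA IB OB →L[ℝ] ℝ, IsAgreeingState p f ∧
      ∀ w v, f (bellWord w v) = (S.toMatrixStrategy.moment w v.reverse).re := by
  have hm : NeZero m := ⟨by rintro rfl; simpa using S.norm_ψ⟩
  have hn : NeZero n := ⟨by rintro rfl; simpa using S.norm_ψ⟩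
  let RA : RealPOVM IA OA := realPOVM S.E S.E_pos S.E_sum
  let RB : RealPOVM IB OB := realPOVM S.F S.F_pos S.F_sum
  let φ : HilbertTensor RA.H RB.H := ((realVector S.ψ :
    EuclideanSpace ℂ (Fin m) ⊗[ℝ] EuclideanSpace ℂ (Fin n)) :
    HilbertTensor (EuclideanSpace ℂ (Fin m)) (EuclideanSpace ℂ (Fin n)))
  have hwordA (w : List (IA × OA)) : word RA.E w = realOp (word S.E w) := by
    induction w with
    | nil => rw [word_nil, word_nil, realOp_one]; rfl
    | cons i w ih => rw [word_cons, word_cons, realOp_mul, ih]; rfl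
  have hwordB (w : List (IB × OB)) : word RB.E w = realOp (word S.F w) := by
    induction w with
    | nil => rw [word_nil, word_nil, realOp_one]; rfl
    | cons i w ih => rw [word_cons, word_cons, realOp_mul, ih]; rfl
  have hword (w : List (IA × OA)) (v : List (IB × OB)) :
      vectorState RA RB φ (bellWord w v) = (S.toMatrixStrategy.moment w v.reverse).re := by
    rw [vectorState_apply, bellRep_bellWord, hwordA, hwordB]
    refine (inner_opTensor_realVector S.ψ (word S.E w) (word S.F v)).trans ?_
    congr 2
    simp only [Strategy.toMatrixStrategy]
    congr 1
    induction v with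
    | nil => simp
    | cons i v ih =>
      rw [word_cons, Matrix.transpose_mul, ih, List.reverse_cons, word_append, word_cons, word_nil,
        mul_one]
  refine ⟨vectorState RA RB φ, ⟨isRealState_vectorState RA RB φ ?_, ?_, fun x y a b => ?_⟩, hword⟩
  · have h := hword [] []
    have h1 : bellWord [] [] = (1 : BellAlgebra IA OA IB OB) := by simp [bellWord]
    rw [h1, vectorState_apply, map_one] at h
    refine h.trans ?_
    simp [MatrixStrategy.moment, S.toMatrixStrategy.norm_Ψ]
  · have : FiniteDimensional ℝ RA.H :=
      inferInstanceAs (FiniteDimensional ℝ (EuclideanSpace ℂ (Fin m)))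
    have : FiniteDimensional ℝ RB.H :=
      inferInstanceAs (FiniteDimensional ℝ (EuclideanSpace ℂ (Fin n)))
    exact isFiniteDimensionalState_vectorState RA RB φ
  · rw [bellGen_eq, hword]
    have h := (MatrixStrategy.produces_iff_moment _ _).mp
      (S.toMatrixStrategy_produces.mpr hp) x y a b
    rw [List.reverse_singleton, h, Complex.ofReal_re]

end Bell

/-! ### Density of the words -/

section Density

variable {ι κ : Type*} {H : ι → Type*} {K : κ → Type*}
  [∀ i, NormedAddCommGroup (H i)] [∀ i, InnerProductSpace ℝ (H i)]
  [∀ j, NormedAddCommGroup (K j)] [∀ j, InnerProductSpace ℝ (K j)]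
  [∀ i, Nontrivial (H i)] [∀ j, Nontrivial (K j)]

theorem norm_one_opProd_le : ‖(1 : OpProd H)‖ ≤ 1 :=
  lp.norm_le_of_forall_le zero_le_one fun _ => ContinuousLinearMap.norm_id_le

variable [∀ i, CompleteSpace (H i)] [∀ j, CompleteSpace (K j)]

/-- The embedding `a ↦ a ⊗ 1`. -/
def elemTensorLeft : OpProd H →⋆ₐ[ℝ]
    OpProd (fun ij : ι × κ => HilbertTensor (H ij.1) (K ij.2)) where
  toFun a := elemTensor a 1
  map_one' := elemTensor_one
  map_mul' a b := by rw [elemTensor_mul, one_mul]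
  map_zero' := by
    have h := elemTensor_add_left (0 : OpProd H) 0 (1 : OpProd K)
    rw [add_zero] at h
    exact left_eq_add.mp h
  map_add' a b := elemTensor_add_left a b 1
  commutes' r := by
    rw [Algebra.algebraMap_eq_smul_one, elemTensor_smul_left, elemTensor_one,
      Algebra.algebraMap_eq_smul_one]
  map_star' a := by rw [star_elemTensor, star_one]

/-- The embedding `b ↦ 1 ⊗ b`. -/
def elemTensorRight : OpProd K →⋆ₐ[ℝ]
    OpProd (fun ij : ι × κ => HilbertTensor (H ij.1) (K ij.2)) where
  toFun b := elemTensor 1 b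
  map_one' := elemTensor_one
  map_mul' a b := by rw [elemTensor_mul, one_mul]
  map_zero' := by
    have h := elemTensor_add_right (1 : OpProd H) (0 : OpProd K) 0
    rw [add_zero] at h
    exact left_eq_add.mp h
  map_add' a b := elemTensor_add_right 1 a b
  commutes' r := by
    rw [Algebra.algebraMap_eq_smul_one, elemTensor_smul_right, elemTensor_one,
      Algebra.algebraMap_eq_smul_one]
  map_star' a := by rw [star_elemTensor, star_one]

theorem continuous_elemTensorLeft :
    Continuous (elemTensorLeft (H := H) (K := K)) :=
  AddMonoidHomClass.continuous_of_bound (elemTensorLeft (H := H) (K := K)) 1 fun a =>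
    (norm_elemTensor_le a 1).trans (by
      rw [one_mul]; exact mul_le_of_le_one_right (norm_nonneg _) norm_one_opProd_le)

theorem continuous_elemTensorRight :
    Continuous (elemTensorRight (H := H) (K := K)) :=
  AddMonoidHomClass.continuous_of_bound (elemTensorRight (H := H) (K := K)) 1 fun a =>
    (norm_elemTensor_le 1 a).trans
      (mul_le_mul_of_nonneg_right norm_one_opProd_le (norm_nonneg _))

theorem closedAdjoin_le {s : Set (OpProd H)} {C : StarSubalgebra ℝ (OpProd H)}
    (hC : IsClosed (C : Set (OpProd H))) (hs : s ⊆ C) : closedAdjoin s ≤ C :=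
  StarSubalgebra.topologicalClosure_minimal (StarAlgebra.adjoin_le hs) hC

end Density

variable {IA OA IB OB : Type*} [Fintype OA] [Fintype OB]

theorem word_mul_comm {I O I' O' R : Type*} [Monoid R] {E : I → O → R} {F : I' → O' → R}
    (h : ∀ x a y b, Commute (E x a) (F y b)) (w : List (I × O)) (v : List (I' × O')) :
    Commute (word E w) (word F v) := by
  refine Commute.list_prod_left _ _ fun a ha => ?_
  obtain ⟨i, -, rfl⟩ := List.mem_map.mp ha
  refine Commute.list_prod_right _ _ fun b hb => ?_
  obtain ⟨j, -, rfl⟩ := List.mem_map.mp hb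
  exact h _ _ _ _

theorem bellWord_mul (w w' : List (IA × OA)) (v v' : List (IB × OB)) :
    (bellWord w v * bellWord w' v' : BellAlgebra IA OA IB OB) = bellWord (w ++ w') (v ++ v') := by
  rw [bellWord, bellWord, bellWord, word_append, word_append, mul_assoc, mul_assoc,
    ← mul_assoc (word bobGen v), ← (word_mul_comm commute_aliceGen_bobGen w' v).eq]
  simp only [mul_assoc]

variable (IA OA IB OB) in
/-- The product of operator algebras that contains the Bell algebra. -/
abbrev BellProd : Type _ :=
  OpProd (fun ij : RealPOVM IA OA × RealPOVM IB OB => HilbertTensor ij.1.H ij.2.H)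

theorem isClosed_bellAlgebra :
    IsClosed (BellAlgebra IA OA IB OB : Set (BellProd IA OA IB OB)) :=
  StarSubalgebra.isClosed_topologicalClosure _

/-- Elements of the minimal tensor product are limits of linear combinations of words. -/
theorem bellAlgebra_subset_closure_span :
    (BellAlgebra IA OA IB OB : Set (BellProd IA OA IB OB)) ⊆ closure (Submodule.span ℝ (Set.range
      fun wv : List (IA × OA) × List (IB × OB) => (bellWord wv.1 wv.2).1) :
        Set (BellProd IA OA IB OB)) := by
  set S : Set (BellProd IA OA IB OB) :=
    (Set.range fun i : IA × OA => elemTensor (povmGen i.1 i.2) 1) ∪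
      Set.range fun i : IB × OB => elemTensor 1 (povmGen i.1 i.2) with hS
  have hSstar : star S = S := by
    ext t
    have h1 (t) (ht : t ∈ S) : star t ∈ S := by
      rcases ht with ⟨i, rfl⟩ | ⟨i, rfl⟩
      · exact Or.inl ⟨i, by simp only [star_elemTensor, star_one, star_povmGen]⟩
      · exact Or.inr ⟨i, by simp only [star_elemTensor, star_one, star_povmGen]⟩
    exact ⟨fun ht => star_star t ▸ h1 _ ht, fun ht => h1 t ht⟩
  have hclosed : IsClosed (closedAdjoin S : Set (BellProd IA OA IB OB)) :=
    StarSubalgebra.isClosed_topologicalClosure _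
  have hleft : POVMAlgebra IA OA ≤ (closedAdjoin S).comap elemTensorLeft :=
    closedAdjoin_le (hclosed.preimage continuous_elemTensorLeft) (by
      rintro _ ⟨x, a, rfl⟩
      exact subset_closedAdjoin (Or.inl ⟨(x, a), rfl⟩))
  have hright : POVMAlgebra IB OB ≤ (closedAdjoin S).comap elemTensorRight :=
    closedAdjoin_le (hclosed.preimage continuous_elemTensorRight) (by
      rintro _ ⟨x, a, rfl⟩
      exact subset_closedAdjoin (Or.inr ⟨(x, a), rfl⟩))
  have hle : BellAlgebra IA OA IB OB ≤ closedAdjoin S :=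
    closedAdjoin_le hclosed (by
      rintro _ ⟨a, ha, b, hb, rfl⟩
      have ha' : elemTensor a 1 ∈ closedAdjoin S := hleft ha
      have hb' : elemTensor 1 b ∈ closedAdjoin S := hright hb
      have h := mul_mem ha' hb'
      rwa [elemTensor_mul, mul_one, one_mul] at h)
  refine Set.Subset.trans (SetLike.coe_subset_coe.mpr hle) ?_
  change ((StarAlgebra.adjoin ℝ S).topologicalClosure : Set (BellProd IA OA IB OB)) ⊆ _
  rw [StarSubalgebra.topologicalClosure_coe]
  refine closure_mono fun t ht => ?_
  have ht' : t ∈ Subalgebra.toSubmodule (Algebra.adjoin ℝ (S ∪ star S)) := ht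
  rw [hSstar, Set.union_self, Algebra.adjoin_eq_span] at ht'
  refine Submodule.span_mono ?_ ht'
  let W : Submonoid (BellProd IA OA IB OB) :=
    { carrier := Set.range
        fun wv : List (IA × OA) × List (IB × OB) => (bellWord wv.1 wv.2).1
      one_mem' := ⟨([], []), by simp only [bellWord, word_nil, mul_one]; rfl⟩
      mul_mem' := by
        rintro _ _ ⟨⟨w, v⟩, rfl⟩ ⟨⟨w', v'⟩, rfl⟩
        exact ⟨(w ++ w', v ++ v'), congrArg Subtype.val (bellWord_mul w w' v v').symm⟩ }
  change Submonoid.closure S ≤ W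
  rw [Submonoid.closure_le]
  rintro _ (⟨i, rfl⟩ | ⟨i, rfl⟩)
  · exact ⟨([i], []), by simp only [bellWord, word_cons, word_nil, mul_one]; rfl⟩
  · exact ⟨([], [i]), by simp only [bellWord, word_cons, word_nil, mul_one, one_mul]; rfl⟩

/-- A bounded functional on the minimal tensor product is determined by its values on words. -/
theorem ext_bellWord {f g : BellAlgebra IA OA IB OB →L[ℝ] ℝ}
    (h : ∀ w v, f (bellWord w v) = g (bellWord w v)) : f = g := by
  have hclosed : IsClosed (Subtype.val '' {a | f a = g a}) :=
    isClosed_bellAlgebra.isClosedEmbedding_subtypeVal.isClosedMap _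
      (isClosed_eq f.continuous g.continuous)
  have hsub : (Submodule.span ℝ (Set.range
      fun wv : List (IA × OA) × List (IB × OB) => (bellWord wv.1 wv.2).1) :
        Set (BellProd IA OA IB OB)) ⊆
      Subtype.val '' {a : BellAlgebra IA OA IB OB | f a = g a} := by
    let L : BellAlgebra IA OA IB OB →ₗ[ℝ] BellProd IA OA IB OB :=
      (BellAlgebra IA OA IB OB).subtype.toAlgHom.toLinearMap
    change Submodule.span ℝ _ ≤ (LinearMap.eqLocus f.toLinearMap g.toLinearMap).map L
    rw [Submodule.span_le]
    rintro _ ⟨wv, rfl⟩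
    exact ⟨bellWord wv.1 wv.2, h _ _, rfl⟩
  ext a
  obtain ⟨b, hb, hba⟩ := closure_minimal hsub hclosed (bellAlgebra_subset_closure_span a.2)
  rwa [Subtype.ext hba] at hb

/-! ### The GNS representation of a finite-dimensional real state -/

section GNS

variable {A : Type*} [NormedRing A] [NormedAlgebra ℝ A] [StarRing A]

theorem IsRealState.star_mul_comm {f : A →L[ℝ] ℝ} (hf : IsRealState f) (a b : A) :
    f (star a * b) = f (star b * a) := by
  rw [← hf.map_star (star a * b), star_mul, star_star]

/-- The GNS space of a real state. -/
def GNS (f : A →L[ℝ] ℝ) : Type _ := A ⧸ gnsKernel f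

instance (f : A →L[ℝ] ℝ) : AddCommGroup (GNS f) := inferInstanceAs (AddCommGroup (A ⧸ gnsKernel f))

instance (f : A →L[ℝ] ℝ) : Module ℝ (GNS f) := inferInstanceAs (Module ℝ (A ⧸ gnsKernel f))

/-- The class of an element in the GNS space. -/
def GNS.mk (f : A →L[ℝ] ℝ) : A →ₗ[ℝ] GNS f := (gnsKernel f).mkQ

theorem GNS.mk_surjective (f : A →L[ℝ] ℝ) : Function.Surjective (GNS.mk f) :=
  (gnsKernel f).mkQ_surjective

theorem GNS.mk_eq_zero {f : A →L[ℝ] ℝ} {a : A} : GNS.mk f a = 0 ↔ ∀ b, f (star b * a) = 0 :=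
  Submodule.Quotient.mk_eq_zero (gnsKernel f)

/-- Left multiplication on the GNS space. -/
def gnsMul (f : A →L[ℝ] ℝ) (c : A) : GNS f →ₗ[ℝ] GNS f :=
  (gnsKernel f).mapQ (gnsKernel f) (LinearMap.mulLeft ℝ c) fun a ha b => by
    have h := ha (star c * b)
    rw [star_mul, star_star] at h
    rwa [LinearMap.mulLeft_apply, ← mul_assoc]

theorem gnsMul_mk (f : A →L[ℝ] ℝ) (c a : A) : gnsMul f c (GNS.mk f a) = GNS.mk f (c * a) := rfl

variable [StarModule ℝ A]

/-- The Cauchy-Schwarz inequality for the GNS form. -/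
theorem IsRealState.sq_le {f : A →L[ℝ] ℝ} (hf : IsRealState f) (a b : A) :
    f (star a * b) ^ 2 ≤ f (star a * a) * f (star b * b) := by
  have h (t : ℝ) : 0 ≤ f (star b * b) * (t * t) + 2 * f (star a * b) * t + f (star a * a) := by
    have h0 := hf.nonneg (a + t • b)
    rw [star_add, star_smul, star_trivial t, add_mul, mul_add, mul_add] at h0
    simp only [smul_mul_assoc, mul_smul_comm, map_add, map_smul, smul_eq_mul] at h0
    rw [hf.star_mul_comm b a] at h0
    linarith
  have h1 := discrim_le_zero h
  rw [discrim] at h1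
  linarith

/-- A real state is positive on `1 - h` for every self-adjoint contraction `h`. The proof iterates
the Cauchy-Schwarz inequality instead of taking a square root of `1 - h`. -/
theorem IsRealState.nonneg_conj {f : A →L[ℝ] ℝ} (hf : IsRealState f) {e : A} (he : star e = e)
    (he' : ‖1 - e‖ ≤ 1) (b : A) : 0 ≤ f (star b * e * b) := by
  set x := 1 - e with hx
  have hxs : star x = x := by rw [hx, star_sub, star_one, he]
  set G := f (star b * b) with hG
  have hG0 : 0 ≤ G := hf.nonneg b
  let u (n : ℕ) : ℝ := f (star b * x ^ 2 ^ n * b)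
  have hpow (k : ℕ) : star (x ^ k) = x ^ k := by rw [star_pow, hxs]
  have hstep (n : ℕ) : u n ^ 2 ≤ G * u (n + 1) := by
    have h := hf.sq_le b (x ^ 2 ^ n * b)
    rw [star_mul, hpow, ← mul_assoc, ← mul_assoc (star b * x ^ 2 ^ n) (x ^ 2 ^ n) b,
      mul_assoc (star b) (x ^ 2 ^ n) (x ^ 2 ^ n), ← pow_add] at h
    change _ ≤ G * f (star b * x ^ 2 ^ (n + 1) * b)
    rwa [pow_succ 2 n, mul_two]
  have hxn (n : ℕ) : ‖x ^ (2 ^ n)‖ ≤ 1 :=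
    (norm_pow_le' x (pow_pos two_pos n)).trans (pow_le_one₀ (norm_nonneg _) he')
  have hbound (n : ℕ) : u n ≤ ‖f‖ * (‖star b‖ * ‖b‖) := by
    refine (le_abs_self _).trans ((f.le_opNorm _).trans ?_)
    gcongr
    calc ‖star b * x ^ 2 ^ n * b‖ ≤ ‖star b‖ * ‖x ^ 2 ^ n‖ * ‖b‖ :=
          (norm_mul_le _ _).trans (by gcongr; exact norm_mul_le _ _)
      _ ≤ ‖star b‖ * 1 * ‖b‖ := by gcongr; exact hxn n
      _ = _ := by ring
  have hmain : u 0 ≤ G := by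
    rcases hG0.eq_or_lt with h0 | hpos
    · have h := hstep 0
      rw [← h0, zero_mul] at h
      rw [← h0]
      nlinarith
    · by_contra! hlt
      have hgrow (n : ℕ) : (u 0 / G) ^ 2 ^ n ≤ u n / G := by
        induction n with
        | zero => simp
        | succ n ih =>
          have h1 : 0 ≤ (u 0 / G) ^ 2 ^ n := pow_nonneg (div_nonneg (hG0.trans hlt.le) hG0) _
          calc (u 0 / G) ^ 2 ^ (n + 1) = ((u 0 / G) ^ 2 ^ n) ^ 2 := by rw [pow_succ, pow_mul]
            _ ≤ (u n / G) ^ 2 := by gcongr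
            _ = u n ^ 2 / (G * G) := by rw [div_pow, sq G]
            _ ≤ G * u (n + 1) / (G * G) := by gcongr; exact hstep n
            _ = u (n + 1) / G := by rw [mul_div_mul_left _ _ hpos.ne']
      have h1 : 1 < u 0 / G := (one_lt_div hpos).mpr hlt
      obtain ⟨n, hn⟩ := pow_unbounded_of_one_lt (‖f‖ * (‖star b‖ * ‖b‖) / G) h1
      have h2 : (u 0 / G) ^ n ≤ (u 0 / G) ^ 2 ^ n :=
        pow_le_pow_right₀ h1.le Nat.lt_two_pow_self.le
      have h3 : u n / G ≤ ‖f‖ * (‖star b‖ * ‖b‖) / G := by gcongr; exact hbound n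
      linarith [hgrow n]
  have h4 : f (star b * e * b) = G - u 0 := by
    change _ = f _ - f (star b * x ^ 2 ^ 0 * b)
    rw [pow_zero, pow_one, ← map_sub, ← sub_mul, hx, mul_sub, mul_one, sub_sub_cancel]
  rw [h4]
  linarith

/-- The form `(a, b) ↦ f (a* b)`. -/
def gnsForm (f : A →L[ℝ] ℝ) : A →ₗ[ℝ] A →ₗ[ℝ] ℝ :=
  LinearMap.mk₂ ℝ (fun a b => f (star a * b))
    (fun a a' b => by rw [star_add, add_mul, map_add])
    (fun r a b => by rw [star_smul, star_trivial r, smul_mul_assoc, map_smul])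
    (fun a b b' => by rw [mul_add, map_add])
    (fun r a b => by rw [mul_smul_comm, map_smul])

/-- The form induced on the GNS space. -/
def gnsInner {f : A →L[ℝ] ℝ} (hf : IsRealState f) : GNS f →ₗ[ℝ] GNS f →ₗ[ℝ] ℝ :=
  (gnsKernel f).liftQ
    { toFun := fun a => (gnsKernel f).liftQ (gnsForm f a) fun _ hb => hb a
      map_add' := fun a a' => by
        refine LinearMap.ext fun b => ?_
        obtain ⟨b, rfl⟩ := (gnsKernel f).mkQ_surjective b
        change gnsForm f (a + a') b = gnsForm f a b + gnsForm f a' b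
        rw [map_add, LinearMap.add_apply]
      map_smul' := fun r a => by
        refine LinearMap.ext fun b => ?_
        obtain ⟨b, rfl⟩ := (gnsKernel f).mkQ_surjective b
        change gnsForm f (r • a) b = r • gnsForm f a b
        rw [map_smul, LinearMap.smul_apply] }
    fun a ha => by
      refine LinearMap.ext fun b => ?_
      obtain ⟨b, rfl⟩ := (gnsKernel f).mkQ_surjective b
      exact (hf.star_mul_comm a b).trans (ha b)

/-- The inner product of the GNS space. -/
@[reducible]
def gnsCore {f : A →L[ℝ] ℝ} (hf : IsRealState f) : InnerProductSpace.Core ℝ (GNS f) where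
  inner u v := gnsInner hf u v
  conj_inner_symm u v := by
    obtain ⟨a, rfl⟩ := GNS.mk_surjective f u
    obtain ⟨b, rfl⟩ := GNS.mk_surjective f v
    exact hf.star_mul_comm b a
  re_inner_nonneg u := by
    obtain ⟨a, rfl⟩ := GNS.mk_surjective f u
    exact hf.nonneg a
  add_left u v w := by rw [map_add]; rfl
  smul_left u v r := by rw [map_smul]; rfl
  definite u hu := by
    obtain ⟨a, rfl⟩ := GNS.mk_surjective f u
    refine GNS.mk_eq_zero.mpr fun b => ?_
    have h1 : f (star a * a) = 0 := hu
    have h2 := hf.sq_le b a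
    rw [h1, mul_zero] at h2
    exact pow_eq_zero_iff two_ne_zero |>.mp (le_antisymm h2 (sq_nonneg _))

/-- The GNS representation in coordinates: a finite-dimensional real state is a vector state of a
representation by real matrices, with a cyclic vector. -/
theorem IsRealState.exists_matrix_representation {f : A →L[ℝ] ℝ} (hf : IsRealState f)
    (hfin : IsFiniteDimensionalState f) :
    ∃ (N : ℕ) (π : A →⋆ₐ[ℝ] Matrix (Fin N) (Fin N) ℝ) (ξ : Fin N → ℝ),
      (∀ a b, f (star a * b) = (π a *ᵥ ξ) ⬝ᵥ (π b *ᵥ ξ)) ∧ ∀ v, ∃ a, v = π a *ᵥ ξ := by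
  let : NormedAddCommGroup (GNS f) := (gnsCore hf).toNormedAddCommGroup
  let : InnerProductSpace ℝ (GNS f) := InnerProductSpace.ofCore (gnsCore hf).toCore
  have : FiniteDimensional ℝ (GNS f) := hfin
  have hinner (a b : A) : inner ℝ (GNS.mk f a) (GNS.mk f b) = f (star a * b) := rfl
  let β := stdOrthonormalBasis ℝ (GNS f)
  let L : A →⋆ₐ[ℝ] (GNS f →ₗ[ℝ] GNS f) :=
    { toFun := gnsMul f
      map_one' := by
        refine LinearMap.ext fun u => ?_
        obtain ⟨a, rfl⟩ := GNS.mk_surjective f u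
        rw [gnsMul_mk, one_mul]; rfl
      map_mul' := fun c d => by
        refine LinearMap.ext fun u => ?_
        obtain ⟨a, rfl⟩ := GNS.mk_surjective f u
        rw [gnsMul_mk, mul_assoc]; rfl
      map_zero' := by
        refine LinearMap.ext fun u => ?_
        obtain ⟨a, rfl⟩ := GNS.mk_surjective f u
        rw [gnsMul_mk, zero_mul, map_zero]; rfl
      map_add' := fun c d => by
        refine LinearMap.ext fun u => ?_
        obtain ⟨a, rfl⟩ := GNS.mk_surjective f u
        rw [gnsMul_mk, add_mul, map_add]; rfl
      commutes' := fun r => by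
        refine LinearMap.ext fun u => ?_
        obtain ⟨a, rfl⟩ := GNS.mk_surjective f u
        rw [gnsMul_mk, Algebra.algebraMap_eq_smul_one, smul_mul_assoc, one_mul, map_smul]; rfl
      map_star' := fun c => by
        rw [LinearMap.star_eq_adjoint, LinearMap.eq_adjoint_iff]
        intro u v
        obtain ⟨a, rfl⟩ := GNS.mk_surjective f u
        obtain ⟨b, rfl⟩ := GNS.mk_surjective f v
        rw [gnsMul_mk, gnsMul_mk, hinner, hinner, star_mul, star_star, mul_assoc] }
  have hmv (a : A) : LinearMap.toMatrixOrthonormal β (L a) *ᵥ (β.repr (GNS.mk f 1)).ofLp =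
      (β.repr (GNS.mk f a)).ofLp := by
    have h := LinearMap.toMatrix_mulVec_repr β.toBasis β.toBasis (L a) (GNS.mk f 1)
    have h2 : L a (GNS.mk f 1) = GNS.mk f a := by
      change gnsMul f a _ = _
      rw [gnsMul_mk, mul_one]
    rw [h2] at h
    exact h
  refine ⟨_, (LinearMap.toMatrixOrthonormal β).toStarAlgHom.comp L, (β.repr (GNS.mk f 1)).ofLp,
    fun a b => ?_, fun v => ?_⟩
  · change _ = (LinearMap.toMatrixOrthonormal β (L a) *ᵥ _) ⬝ᵥ
      (LinearMap.toMatrixOrthonormal β (L b) *ᵥ _)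
    rw [hmv, hmv, ← hinner, ← β.repr.inner_map_map,
      EuclideanSpace.inner_eq_star_dotProduct, dotProduct_comm, star_trivial]
  · obtain ⟨a, ha⟩ := GNS.mk_surjective f (β.repr.symm (WithLp.toLp 2 v))
    refine ⟨a, ?_⟩
    change _ = LinearMap.toMatrixOrthonormal β (L a) *ᵥ _
    rw [hmv, ha, LinearIsometryEquiv.apply_symm_apply]

end GNS

/-! ### Finite-dimensional real states come from strategies -/

section DensityMatrix

variable {n : Type*} [Fintype n] [DecidableEq n]

open scoped MatrixOrder in
theorem exists_eq_conjTranspose_mul_self {𝕜 : Type*} [RCLike 𝕜] {D : Matrix n n 𝕜}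
    (hD : D.PosSemidef) : ∃ B : Matrix n n 𝕜, D = Bᴴ * B :=
  CStarAlgebra.nonneg_iff_eq_star_mul_self.mp hD.nonneg

/-- A positive hermitian functional on a `*`-algebra of real matrices has a density matrix. -/
theorem exists_density_matrix (𝓜 : StarSubalgebra ℝ (Matrix n n ℝ)) (φ : Matrix n n ℝ →ₗ[ℝ] ℝ)
    (hstar : ∀ X ∈ 𝓜, φ Xᴴ = φ X) (hpos : ∀ X ∈ 𝓜, 0 ≤ φ (Xᴴ * X)) :
    ∃ D : Matrix n n ℝ, D.PosSemidef ∧ ∀ X ∈ 𝓜, φ X = (D * X).trace := by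
  let B : 𝓜 →ₗ[ℝ] Module.Dual ℝ 𝓜 := LinearMap.mk₂ ℝ (fun X Y => (X.1ᴴ * Y.1).trace)
    (fun X X' Y => by simp [Matrix.add_mul])
    (fun r X Y => by simp)
    (fun X Y Y' => by simp [Matrix.mul_add])
    (fun r X Y => by simp)
  have hB (X Y : 𝓜) : B X Y = (X.1ᴴ * Y.1).trace := rfl
  have hzero (X : 𝓜) (h : B X X = 0) : X = 0 :=
    Subtype.ext (Matrix.trace_conjTranspose_mul_self_eq_zero_iff.mp h)
  have hfin : FiniteDimensional ℝ 𝓜 :=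
    FiniteDimensional.finiteDimensional_submodule (Subalgebra.toSubmodule 𝓜.toSubalgebra)
  have hinj : Function.Injective B := by
    refine (injective_iff_map_eq_zero B).mpr fun X hX => hzero X ?_
    rw [hX, LinearMap.zero_apply]
  have hsurj : Function.Surjective B :=
    (LinearMap.injective_iff_surjective_of_finrank_eq_finrank
      Subspace.dual_finrank_eq.symm).mp hinj
  obtain ⟨D, hD⟩ := hsurj (φ.comp 𝓜.subtype.toAlgHom.toLinearMap)
  have hDX (X : Matrix n n ℝ) (hX : X ∈ 𝓜) : (D.1ᴴ * X).trace = φ X :=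
    LinearMap.congr_fun hD ⟨X, hX⟩
  have hDs : star D = D := by
    rw [← sub_eq_zero]
    refine hzero _ ?_
    set Z := star D - D with hZ
    have h1 : (D.1ᴴ * Z.1).trace = φ Z.1 := hDX _ Z.2
    have h2 : (D.1ᴴ * Z.1ᴴ).trace = φ Z.1 := (hDX _ (star Z).2).trans (hstar _ Z.2)
    rw [← Matrix.conjTranspose_mul, Matrix.trace_conjTranspose, star_trivial,
      Matrix.trace_mul_comm] at h2
    have h3 : Z.1ᴴ = D.1 - D.1ᴴ := by
      rw [hZ]
      change (D.1ᴴ - D.1)ᴴ = _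
      rw [Matrix.conjTranspose_sub, Matrix.conjTranspose_conjTranspose]
    rw [hB, h3, Matrix.sub_mul, Matrix.trace_sub, h1, h2, sub_self]
  have hherm : D.1.IsHermitian := congrArg Subtype.val hDs
  refine ⟨D.1, hherm.posSemidef_iff_eigenvalues_nonneg.mpr fun i => ?_, fun X hX => ?_⟩
  · -- an eigenvalue `μ` of `D` has an eigenvector in `𝓜` for the right multiplication by `D`
    set μ := hherm.eigenvalues i with hμ
    have hroot : (minpoly ℝ D).IsRoot μ := by
      have h1 := spectrum.subset_polynomial_aeval D.1 (minpoly ℝ D)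
        ⟨μ, hherm.eigenvalues_mem_spectrum_real i, rfl⟩
      have h2 : Polynomial.aeval D.1 (minpoly ℝ D) = 0 := by
        have h := Polynomial.aeval_algHom_apply 𝓜.subtype.toAlgHom D (minpoly ℝ D)
        rw [minpoly.aeval, map_zero] at h
        exact h
      have : Nonempty n := ⟨i⟩
      rw [h2, spectrum.zero_eq] at h1
      exact h1
    obtain ⟨r, hr⟩ := Polynomial.dvd_iff_isRoot.mpr hroot
    have hint : IsIntegral ℝ D := Algebra.IsIntegral.isIntegral D
    have hm0 := minpoly.ne_zero hint
    have hr0 : r ≠ 0 := fun h => hm0 (by rw [hr, h, mul_zero])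
    set X := Polynomial.aeval D r with hX
    have hX0 : X ≠ 0 := by
      intro h
      have h1 := minpoly.degree_le_of_ne_zero ℝ D hr0 h
      rw [hr, Polynomial.degree_mul, Polynomial.degree_X_sub_C, Polynomial.degree_eq_natDegree hr0]
        at h1
      norm_cast at h1
      omega
    have hXD : X * D = μ • X := by
      have h := minpoly.aeval ℝ D
      rw [hr, mul_comm, map_mul, ← hX, map_sub, Polynomial.aeval_X, Polynomial.aeval_C, mul_sub,
        sub_eq_zero] at h
      rw [h, Algebra.algebraMap_eq_smul_one, mul_smul_comm, mul_one]
    have hXD' : X.1 * D.1 = μ • X.1 := congrArg Subtype.val hXD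
    have h1 : φ (X.1ᴴ * X.1) = μ * (X.1 * X.1ᴴ).trace := by
      rw [← hDX (X.1ᴴ * X.1) (mul_mem (star X).2 X.2), hherm.eq, ← Matrix.mul_assoc,
          Matrix.trace_mul_comm,
        ← Matrix.mul_assoc, hXD', Matrix.smul_mul, Matrix.trace_smul, smul_eq_mul]
    have h2 : 0 < (X.1 * X.1ᴴ).trace := by
      have h3 : 0 ≤ (X.1 * X.1ᴴ).trace :=
        (Matrix.posSemidef_self_mul_conjTranspose X.1).trace_nonneg
      refine lt_of_le_of_ne h3 fun h4 => hX0 (Subtype.ext ?_)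
      exact Matrix.trace_mul_conjTranspose_self_eq_zero_iff.mp h4.symm
    have h5 := hpos X.1 X.2
    rw [h1] at h5
    exact nonneg_of_mul_nonneg_left h5 h2
  · rw [← hDX X hX, hherm.eq]

end DensityMatrix

theorem posSemidef_map_ofReal {n : Type*} [Fintype n] [DecidableEq n] {D : Matrix n n ℝ}
    (hD : D.PosSemidef) : (D.map Complex.ofReal).PosSemidef := by
  obtain ⟨B, rfl⟩ := exists_eq_conjTranspose_mul_self hD
  have h : (Bᴴ * B).map Complex.ofReal = (B.map Complex.ofReal)ᴴ * B.map Complex.ofReal := by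
    ext i j
    simp [Matrix.mul_apply]
  rw [h]
  exact Matrix.posSemidef_conjTranspose_mul_self _

theorem star_word_mul_word_mul {IA OA IB OB R : Type*} [Monoid R] [StarMul R] {e : IA → OA → R}
    {g : IB → OB → R} (he : ∀ x a, star (e x a) = e x a) (hg : ∀ y b, star (g y b) = g y b)
    (hcomm : ∀ x a y b, Commute (e x a) (g y b)) (w w' : List (IA × OA)) (v v' : List (IB × OB)) :
    star (word e w * word g v) * (word e w' * word g v') =
      word e (w.reverse ++ w') * word g (v.reverse ++ v') := by
  have h := (word_mul_comm hcomm (w.reverse ++ w') v.reverse).eq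
  rw [word_append] at h
  rw [star_mul, star_word hg, star_word he, word_append, word_append, 
    ← mul_assoc (word e _ * word e _), h]
  simp only [mul_assoc]

section FromState

variable {IA OA IB OB : Type*} [Fintype OA] [Fintype OB]

theorem norm_one_sub_povmGen_le {I O : Type*} [Fintype O] (x : I) (a : O) :
    ‖1 - povmGen x a‖ ≤ 1 := by
  refine lp.norm_le_of_forall_le zero_le_one fun S => ?_
  change ‖1 - S.E x a‖ ≤ 1
  have hE := S.pos x a
  refine norm_le_one_of_isPositive ⟨?_, fun u => ?_⟩ (by rwa [sub_sub_cancel])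
  · exact LinearMap.IsSymmetric.sub LinearMap.IsSymmetric.id hE.isSymmetric
  · change 0 ≤ inner ℝ (u - S.E x a u) u
    rw [inner_sub_left, real_inner_self_eq_norm_sq, sub_nonneg]
    calc inner ℝ (S.E x a u) u ≤ ‖S.E x a u‖ * ‖u‖ := real_inner_le_norm _ _
      _ ≤ 1 * ‖u‖ * ‖u‖ := by
        gcongr
        exact ContinuousLinearMap.le_of_opNorm_le _ (S.contr x a) u
      _ = ‖u‖ ^ 2 := by ring

theorem norm_one_sub_aliceGen_le (x : IA) (a : OA) :
    ‖1 - (aliceGen x a : BellAlgebra IA OA IB OB)‖ ≤ 1 := by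
  change ‖(1 : BellProd IA OA IB OB) - elemTensor (povmGen x a) 1‖ ≤ 1
  have h : (1 : BellProd IA OA IB OB) - elemTensor (povmGen x a) 1 =
      elemTensor (1 - povmGen x a) 1 := by
    rw [sub_eq_iff_eq_add, ← elemTensor_add_left, sub_add_cancel, elemTensor_one]
  rw [h]
  exact (norm_elemTensor_le _ _).trans
    (mul_le_one₀ (norm_one_sub_povmGen_le x a) (norm_nonneg _) norm_one_opProd_le)

theorem norm_one_sub_bobGen_le (y : IB) (b : OB) :
    ‖1 - (bobGen y b : BellAlgebra IA OA IB OB)‖ ≤ 1 := by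
  change ‖(1 : BellProd IA OA IB OB) - elemTensor 1 (povmGen y b)‖ ≤ 1
  have h : (1 : BellProd IA OA IB OB) - elemTensor 1 (povmGen y b) =
      elemTensor 1 (1 - povmGen y b) := by
    rw [sub_eq_iff_eq_add, ← elemTensor_add_right, sub_add_cancel, elemTensor_one]
  rw [h]
  exact (norm_elemTensor_le _ _).trans
    (mul_le_one₀ norm_one_opProd_le (norm_nonneg _) (norm_one_sub_povmGen_le y b))

theorem sum_aliceGen (x : IA) : ∑ a, (aliceGen x a : BellAlgebra IA OA IB OB) = 1 := by
  apply Subtype.ext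
  have h := map_sum (elemTensorLeft (H := fun S : RealPOVM IA OA => S.H)
    (K := fun S : RealPOVM IB OB => S.H)) (fun a => povmGen x a) Finset.univ
  rw [sum_povmGen, map_one] at h
  rw [AddSubmonoidClass.coe_finsetSum]
  exact h.symm

theorem sum_bobGen (y : IB) : ∑ b, (bobGen y b : BellAlgebra IA OA IB OB) = 1 := by
  apply Subtype.ext
  have h := map_sum (elemTensorRight (H := fun S : RealPOVM IA OA => S.H)
    (K := fun S : RealPOVM IB OB => S.H)) (fun a => povmGen y a) Finset.univ
  rw [sum_povmGen, map_one] at h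
  rw [AddSubmonoidClass.coe_finsetSum]
  exact h.symm

/-- The linear map sending `A ⊗ B` to `A * B *ᵥ ξ`. -/
def contractMulVec {N : ℕ} (ξ : Fin N → ℝ) :
    Matrix (Fin N × Fin N) (Fin N × Fin N) ℝ →ₗ[ℝ] (Fin N → ℝ) where
  toFun X i := ∑ j, ∑ k, X (i, j) (j, k) * ξ k
  map_add' X Y := by
    ext i
    simp [add_mul, Finset.sum_add_distrib]
  map_smul' r X := by
    ext i
    simp [Finset.mul_sum, mul_assoc]

theorem contractMulVec_kronecker {N : ℕ} (ξ : Fin N → ℝ) (A B : Matrix (Fin N) (Fin N) ℝ) :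
    contractMulVec ξ (A ⊗ₖ B) = (A * B) *ᵥ ξ := by
  rw [← Matrix.mulVec_mulVec]
  ext i
  simp [contractMulVec, Matrix.mulVec, dotProduct, Finset.mul_sum, mul_assoc]

/-- The monoid of the tensor products of words in two families of real symmetric matrices. -/
def wordAlgebra {N : ℕ} (E : IA → OA → Matrix (Fin N) (Fin N) ℝ)
    (F : IB → OB → Matrix (Fin N) (Fin N) ℝ) :
    Submonoid (Matrix (Fin N × Fin N) (Fin N × Fin N) ℝ) where
  carrier := Set.range fun wv : List (IA × OA) × List (IB × OB) => word E wv.1 ⊗ₖ word F wv.2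
  one_mem' := ⟨([], []), by simp⟩
  mul_mem' := by
    rintro _ _ ⟨⟨w, v⟩, rfl⟩ ⟨⟨w', v'⟩, rfl⟩
    exact ⟨(w ++ w', v ++ v'), by simp only [word_append, Matrix.mul_kronecker_mul]⟩

theorem trace_purification {N : ℕ} (B : Matrix (Fin N × Fin N) (Fin N × Fin N) ℝ)
    (A C : Matrix (Fin N) (Fin N) ℝ) (Ψ : Matrix (Fin N) (Fin N × (Fin N × Fin N)) ℂ)
    (hΨ : ∀ i j k, Ψ i (j, k) = B k (i, j)) :
    (Ψᴴ * A.map Complex.ofReal * Ψ *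
      (C.map Complex.ofReal ⊗ₖ (1 : Matrix (Fin N × Fin N) (Fin N × Fin N) ℂ))).trace =
      ((Bᴴ * B * (A ⊗ₖ Cᵀ)).trace : ℝ) := by
  have h1 (k) : (B * ((A ⊗ₖ Cᵀ) * Bᴴ)) k k =
      ((coeffMatrix (B k))ᴴ * (A * coeffMatrix (B k) * C)).trace := by
    have h := star_dotProduct_eq_trace (B k) ((A ⊗ₖ Cᵀ) *ᵥ B k)
    rw [coeffMatrix_kronecker_mulVec, Matrix.transpose_transpose] at h
    exact h
  have h2 : (Bᴴ * B * (A ⊗ₖ Cᵀ)).trace =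
      ∑ k, ((coeffMatrix (B k))ᴴ * (A * coeffMatrix (B k) * C)).trace := by
    rw [Matrix.mul_assoc, Matrix.trace_mul_comm, Matrix.mul_assoc, Matrix.trace]
    exact Finset.sum_congr rfl fun k _ => h1 k
  have h3 (j : Fin N) (k : Fin N × Fin N) (j' : Fin N) :
      (Ψᴴ * A.map Complex.ofReal * Ψ) (j, k) (j', k) =
      (((coeffMatrix (B k))ᴴ * A * coeffMatrix (B k)) j j' : ℝ) := by
    simp [Matrix.mul_apply, hΨ, coeffMatrix]
  rw [h2, Complex.ofReal_sum, Matrix.trace]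
  simp only [Matrix.diag]
  rw [Fintype.sum_prod_type, Finset.sum_comm]
  refine Finset.sum_congr rfl fun k _ => ?_
  rw [← Matrix.mul_assoc, ← Matrix.mul_assoc, Matrix.trace, Complex.ofReal_sum]
  refine Finset.sum_congr rfl fun j _ => ?_
  rw [Matrix.mul_apply, Fintype.sum_prod_type, Matrix.diag, Matrix.mul_apply, Complex.ofReal_sum]
  refine Finset.sum_congr rfl fun j' _ => ?_
  rw [Finset.sum_eq_single k]
  · simp [h3]
  · intro k' _ hk
    simp [hk]
  · simp

/-- A finite-dimensional real state, restricted to the words in two commuting families of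
measurements, is the real part of the vector state of a strategy: the two commuting GNS
representations are separated into a tensor product by passing to a density matrix, which is then
purified. -/
theorem IsRealState.exists_matrixStrategy {A : Type*} [NormedRing A] [NormedAlgebra ℝ A]
    [StarRing A] [StarModule ℝ A] {f : A →L[ℝ] ℝ} (hstate : IsRealState f)
    (hfin : IsFiniteDimensionalState f) (e : IA → OA → A) (g : IB → OB → A)
    (he : ∀ x a, star (e x a) = e x a) (he' : ∀ x a, ‖1 - e x a‖ ≤ 1)
    (hesum : ∀ x, ∑ a, e x a = 1) (hg : ∀ y b, star (g y b) = g y b)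
    (hg' : ∀ y b, ‖1 - g y b‖ ≤ 1) (hgsum : ∀ y, ∑ b, g y b = 1)
    (hcomm : ∀ x a y b, Commute (e x a) (g y b)) :
    ∃ (N : ℕ) (S : MatrixStrategy IA OA IB OB (Fin N) (Fin N × (Fin N × Fin N))),
      ∀ w v, S.moment w v = f (word e w * word g v.reverse) := by
  obtain ⟨N, π, ξ, hπ, hcyc⟩ := hstate.exists_matrix_representation hfin
  have hf1 (c : A) : f c = ξ ⬝ᵥ (π c *ᵥ ξ) := by
    have h := hπ 1 c
    rwa [star_one, one_mul, _root_.map_one π, Matrix.one_mulVec] at h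
  have hpos (c : A) (hc : star c = c) (hc' : ‖1 - c‖ ≤ 1) :
      (π c).PosSemidef := by
    refine Matrix.PosSemidef.of_dotProduct_mulVec_nonneg ?_ fun v => ?_
    · rw [Matrix.IsHermitian, ← Matrix.star_eq_conjTranspose, ← StarHomClass.map_star π c, hc]
    · obtain ⟨b, rfl⟩ := hcyc v
      have h := hstate.nonneg_conj hc hc' b
      rwa [mul_assoc, hπ, map_mul, ← Matrix.mulVec_mulVec] at h
  set E : IA → OA → Matrix (Fin N) (Fin N) ℝ := fun x a => π (e x a) with hE
  set F : IB → OB → Matrix (Fin N) (Fin N) ℝ := fun y b => π (g y b) with hF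
  have hEpos (x a) : (E x a).PosSemidef :=
    hpos _ (he x a) (he' x a)
  have hFpos (y b) : (F y b).PosSemidef := hpos _ (hg y b) (hg' y b)
  have hEsum (x) : ∑ a, E x a = 1 := by rw [← map_sum, hesum, _root_.map_one π]
  have hFsum (y) : ∑ b, F y b = 1 := by rw [← map_sum, hgsum, _root_.map_one π]
  have hword (w v) : word E w * word F v = π (word e w * word g v) := by
    rw [map_mul, map_word, map_word]
  -- the functional `A ⊗ B ↦ ⟨ξ, A B ξ⟩` and its positivity on the algebra of words
  let φ : Matrix (Fin N × Fin N) (Fin N × Fin N) ℝ →ₗ[ℝ] ℝ :=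
    (dotProductBilin ℝ ℝ ξ).comp (contractMulVec ξ)
  have hφ (X) : φ X = ξ ⬝ᵥ contractMulVec ξ X := rfl
  have hφword (w v) : φ (word E w ⊗ₖ word F v) = f (word e w * word g v) := by
    rw [hφ, contractMulVec_kronecker, hword, hf1]
  have hstarE (w) : (word E w)ᴴ = word E w.reverse := star_word (fun x a => (hEpos x a).1) w
  have hstarF (v) : (word F v)ᴴ = word F v.reverse := star_word (fun y b => (hFpos y b).1) v
  let 𝓜 := StarAlgebra.adjoin ℝ
    (wordAlgebra E F : Set (Matrix (Fin N × Fin N) (Fin N × Fin N) ℝ))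
  have hspan {X} (hX : X ∈ 𝓜) : X ∈ Submodule.span ℝ
      (wordAlgebra E F : Set (Matrix (Fin N × Fin N) (Fin N × Fin N) ℝ)) := by
    have h1 : star (wordAlgebra E F : Set (Matrix (Fin N × Fin N) (Fin N × Fin N) ℝ)) ⊆
        wordAlgebra E F := by
      rintro X ⟨⟨w, v⟩, hwv⟩
      refine ⟨(w.reverse, v.reverse), ?_⟩
      rw [← star_star X, ← hwv]
      simp only [Matrix.star_eq_conjTranspose, Matrix.conjTranspose_kronecker, hstarE, hstarF]
    have h2 : X ∈ Subalgebra.toSubmodule (Algebra.adjoin ℝ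
      ((wordAlgebra E F : Set (Matrix (Fin N × Fin N) (Fin N × Fin N) ℝ)) ∪
        star (wordAlgebra E F : Set (Matrix (Fin N × Fin N) (Fin N × Fin N) ℝ)))) := hX
    rwa [Set.union_eq_left.mpr h1, Algebra.adjoin_eq_span, Submonoid.closure_eq] at h2
  have hform {X Y} (hX : X ∈ 𝓜) (hY : Y ∈ 𝓜) :
      φ (Xᴴ * Y) = contractMulVec ξ X ⬝ᵥ contractMulVec ξ Y := by
    replace hX := hspan hX
    replace hY := hspan hY
    induction hX using Submodule.span_induction with
    | zero => simp
    | add X X' _ _ h h' =>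
      rw [Matrix.conjTranspose_add, Matrix.add_mul, map_add, map_add, h, h', add_dotProduct]
    | smul r X _ h =>
      rw [Matrix.conjTranspose_smul, Matrix.smul_mul, map_smul, map_smul, h, smul_dotProduct,
        star_trivial]
    | mem X hX =>
      induction hY using Submodule.span_induction with
      | zero => simp
      | add X X' _ _ h h' =>
        rw [Matrix.mul_add, map_add, map_add, h, h', dotProduct_add]
      | smul r X _ h => rw [Matrix.mul_smul, map_smul, map_smul, h, dotProduct_smul]
      | mem Y hY =>
        obtain ⟨⟨w, v⟩, rfl⟩ := hX
        obtain ⟨⟨w', v'⟩, rfl⟩ := hY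
        simp only [Matrix.conjTranspose_kronecker, hstarE, hstarF, ← Matrix.mul_kronecker_mul,
          ← word_append, hφword, contractMulVec_kronecker, hword, ← hπ]
        rw [star_word_mul_word_mul he hg hcomm]
  have hone : (1 : Matrix (Fin N × Fin N) (Fin N × Fin N) ℝ) ∈ 𝓜 := one_mem _
  obtain ⟨D, hD, hDφ⟩ := exists_density_matrix 𝓜 φ
    (fun X hX => by
      have h1 := hform hX hone
      have h2 := hform hone hX
      rw [Matrix.mul_one] at h1
      rw [Matrix.conjTranspose_one, Matrix.one_mul] at h2
      rw [h1, h2, dotProduct_comm])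
    (fun X hX => by
      rw [hform hX hX]
      exact dotProduct_star_self_nonneg (contractMulVec ξ X))
  obtain ⟨B, rfl⟩ := exists_eq_conjTranspose_mul_self hD
  let Ψ : Matrix (Fin N) (Fin N × (Fin N × Fin N)) ℂ := Matrix.of fun i jk => B jk.2 (i, jk.1)
  have htrace (w v) : (Ψᴴ * (word E w).map Complex.ofReal * Ψ * ((word F v).map Complex.ofReal ⊗ₖ
      (1 : Matrix (Fin N × Fin N) (Fin N × Fin N) ℂ))).trace =
      (f (word e w * word g v.reverse) : ℂ) := by
    rw [trace_purification B _ _ Ψ fun _ _ _ => rfl, ← Matrix.conjTranspose_eq_transpose_of_trivial,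
      hstarF, ← hDφ _ (StarAlgebra.subset_adjoin ℝ _ ⟨(w, v.reverse), rfl⟩), hφword]
  let S : MatrixStrategy IA OA IB OB (Fin N) (Fin N × (Fin N × Fin N)) :=
    { Ψ := Ψ
      E := fun x a => (E x a).map Complex.ofReal
      G := fun y b => (F y b).map Complex.ofReal ⊗ₖ 1
      norm_Ψ := by
        have h := htrace [] []
        simpa [hstate.map_one] using h
      E_pos := fun x a => posSemidef_map_ofReal (hEpos x a)
      G_pos := fun y b => (posSemidef_map_ofReal (hFpos y b)).kronecker Matrix.PosSemidef.one
      E_sum := fun x => by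
        have h := congrArg (Complex.ofRealHom.mapMatrix (m := Fin N)) (hEsum x)
        rwa [map_sum, _root_.map_one] at h
      G_sum := fun y => by
        have h := congrArg (Complex.ofRealHom.mapMatrix (m := Fin N)) (hFsum y)
        rw [map_sum, _root_.map_one] at h
        refine Eq.trans ?_ ((congrArg (· ⊗ₖ (1 : Matrix (Fin N × Fin N) (Fin N × Fin N) ℂ))
          h).trans Matrix.one_kronecker_one)
        ext i j
        simp [Matrix.sum_apply, Finset.sum_mul] }
  have hS (w v) : S.moment w v = f (word e w * word g v.reverse) := by
    have h1 : word (fun x a => (E x a).map Complex.ofReal) w = (word E w).map Complex.ofReal :=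
      (map_word (Complex.ofRealHom.mapMatrix (m := Fin N)) E w).symm
    have h2 : word (fun y b => (F y b).map Complex.ofReal ⊗ₖ
        (1 : Matrix (Fin N × Fin N) (Fin N × Fin N) ℂ)) v = (word F v).map Complex.ofReal ⊗ₖ 1 := by
      induction v with
      | nil => simp
      | cons i v ih =>
        rw [word_cons, word_cons, ih, ← Matrix.mul_kronecker_mul, Matrix.one_mul]
        congr 1
        exact (map_mul (Complex.ofRealHom.mapMatrix (m := Fin N)) _ _).symm
    rw [← htrace, ← h1, ← h2]
    rfl
  exact ⟨N, S, hS⟩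

/-- Every finite-dimensional real state agreeing with `p` is the real part of the vector state of
a strategy producing `p`. -/
theorem IsAgreeingState.exists_strategy {p : Correlation IA OA IB OB}
    {f : BellAlgebra IA OA IB OB →L[ℝ] ℝ} (hf : IsAgreeingState p f) :
    ∃ (m n : ℕ) (S : Strategy IA OA IB OB m n), S.Produces p ∧
      ∀ w v, f (bellWord w v) = (S.toMatrixStrategy.moment w v.reverse).re := by
  obtain ⟨N, S, hS⟩ := hf.1.exists_matrixStrategy hf.2.1 aliceGen bobGen star_aliceGen
    norm_one_sub_aliceGen_le sum_aliceGen star_bobGen norm_one_sub_bobGen_le sum_bobGen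
    commute_aliceGen_bobGen
  refine ⟨_, _, S.toStrategy, MatrixStrategy.Produces.toStrategy
    ((S.produces_iff_moment p).mpr fun x y a b => ?_), fun w v => ?_⟩
  · rw [hS, List.reverse_singleton, ← hf.2.2, bellGen_eq, bellWord]
  · rw [S.moment_toStrategy, hS, List.reverse_reverse, Complex.ofReal_re, bellWord]

end FromState

/-! ### Moments are preserved by complex local dilations -/

section Dilate

variable {α β γ κ l μ : Type*}

/-- The block matrix `V₀ ⊗ A₀ ⊗ |0⟩⟨0| + V₁ ⊗ A₁ ⊗ |1⟩⟨1|`. -/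
def dilate (V₀ V₁ : Matrix α β ℂ) (A₀ A₁ : Matrix κ l ℂ) :
    Matrix (α × κ × Fin 2) (β × l × Fin 2) ℂ :=
  V₀ ⊗ₖ (A₀ ⊗ₖ Matrix.single 0 0 1) + V₁ ⊗ₖ (A₁ ⊗ₖ Matrix.single 1 1 1)

theorem coeffMatrix_combine {m n k l : ℕ} (v₀ v₁ : Fin m × Fin n → ℂ)
    (aux₀ aux₁ : Fin k × Fin l → ℂ) :
    coeffMatrix (combine v₀ v₁ aux₀ aux₁) =
      dilate (coeffMatrix v₀) (coeffMatrix v₁) (coeffMatrix aux₀) (coeffMatrix aux₁) := by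
  ext ⟨i, s, e⟩ ⟨j, t, f⟩
  simp [coeffMatrix, combine, dilate, Matrix.single_apply, eq_comm]

theorem dilate_mul [Fintype β] [Fintype l] (V₀ V₁ : Matrix α β ℂ) (W₀ W₁ : Matrix β γ ℂ)
    (A₀ A₁ : Matrix κ l ℂ) (B₀ B₁ : Matrix l μ ℂ) :
    dilate V₀ V₁ A₀ A₁ * dilate W₀ W₁ B₀ B₁ =
      dilate (V₀ * W₀) (V₁ * W₁) (A₀ * B₀) (A₁ * B₁) := by
  simp [dilate, Matrix.add_mul, Matrix.mul_add, ← Matrix.mul_kronecker_mul]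

theorem dilate_one [DecidableEq α] [DecidableEq κ] :
    dilate (1 : Matrix α α ℂ) 1 (1 : Matrix κ κ ℂ) 1 = 1 := by
  rw [dilate, ← Matrix.kronecker_add, ← Matrix.kronecker_add]
  have h : (Matrix.single 0 0 1 + Matrix.single 1 1 1 : Matrix (Fin 2) (Fin 2) ℂ) = 1 := by
    ext i j
    fin_cases i <;> fin_cases j <;> simp
  rw [h, Matrix.one_kronecker_one, Matrix.one_kronecker_one]

theorem conjTranspose_dilate (V₀ V₁ : Matrix α β ℂ) (A₀ A₁ : Matrix κ l ℂ) :
    (dilate V₀ V₁ A₀ A₁)ᴴ = dilate V₀ᴴ V₁ᴴ A₀ᴴ A₁ᴴ := by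
  simp [dilate, Matrix.conjTranspose_kronecker]

theorem trace_dilate [Fintype α] [Fintype κ] (V₀ V₁ : Matrix α α ℂ) (A₀ A₁ : Matrix κ κ ℂ) :
    (dilate V₀ V₁ A₀ A₁).trace = V₀.trace * A₀.trace + V₁.trace * A₁.trace := by
  simp [dilate, Matrix.trace_kronecker]

theorem word_dilate {I O : Type*} [Fintype α] [DecidableEq α] [Fintype κ] [DecidableEq κ]
    (E : I → O → Matrix α α ℂ) (w : List (I × O)) :
    word (fun x a => dilate (E x a) ((E x a).map conj) (1 : Matrix κ κ ℂ) 1) w =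
      dilate (word E w) ((word E w).map conj) 1 1 := by
  induction w with
  | nil => simp [dilate_one]
  | cons i w ih => simp [ih, dilate_mul, Matrix.map_mul]

end Dilate

/-- If the range of `Ψ` is invariant under the operators `E'`, then a compression that maps `E` to
`E'` on `Ψ` does so for all words. -/
theorem compress_word {I O α β γ δ : Type*} [Fintype α] [Fintype β] [Fintype γ] [Fintype δ]
    [DecidableEq α] [DecidableEq γ] {U : Matrix γ α ℂ} (hU : Uᴴ * U = 1) {Ψ : Matrix α β ℂ}
    {R : Matrix β δ ℂ} {Φ : Matrix γ δ ℂ} (hΦ : U * Ψ * R = Φ) {E : I → O → Matrix α α ℂ}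
    {E' : I → O → Matrix γ γ ℂ} (hE : ∀ x a, U * (E x a * Ψ) * R = E' x a * Φ)
    (hrange : ∀ w, ∃ G : Matrix δ δ ℂ, word E' w * Φ = Φ * G) (w : List (I × O)) :
    U * (word E w * Ψ) * R = word E' w * Φ := by
  induction w with
  | nil => simpa using hΦ
  | cons i w ih =>
    obtain ⟨G, hG⟩ := hrange w
    calc U * (word E (i :: w) * Ψ) * R = U * E i.1 i.2 * (Uᴴ * U) * (word E w * Ψ) * R := by
          rw [hU, word_cons]; simp only [Matrix.mul_assoc, Matrix.one_mul]
      _ = U * E i.1 i.2 * Uᴴ * (U * (word E w * Ψ) * R) := by simp only [Matrix.mul_assoc]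
      _ = U * E i.1 i.2 * (Uᴴ * U) * Ψ * R * G := by
          rw [ih, hG, ← hΦ]; simp only [Matrix.mul_assoc]
      _ = U * (E i.1 i.2 * Ψ) * R * G := by
          rw [hU]; simp only [Matrix.mul_assoc, Matrix.one_mul]
      _ = word E' (i :: w) * Φ := by rw [hE, Matrix.mul_assoc, ← hG, word_cons, Matrix.mul_assoc]

theorem exists_mul_eq_of_commute_suppProj {m n : ℕ} {Ψ : Matrix (Fin m) (Fin n) ℂ}
    {X : Matrix (Fin m) (Fin m) ℂ}
    (h : Commute (suppProj (Ψ * Ψᴴ)) (Matrix.toEuclideanCLM (𝕜 := ℂ) X)) :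
    ∃ G : Matrix (Fin n) (Fin n) ℂ, X * Ψ = Ψ * G := by
  have hrange : LinearMap.range (Ψ * Ψᴴ).mulVecLin = LinearMap.range Ψ.mulVecLin := by
    refine Submodule.eq_of_le_of_finrank_eq ?_ (Matrix.rank_self_mul_conjTranspose Ψ)
    rintro _ ⟨u, rfl⟩
    exact ⟨Ψᴴ *ᵥ u, by simp⟩
  have hcol (j : Fin n) : ∃ u : Fin n → ℂ, Ψ *ᵥ u = X *ᵥ (Ψ *ᵥ Pi.single j 1) := by
    obtain ⟨u, hu⟩ : Ψ *ᵥ Pi.single j 1 ∈ LinearMap.range (Ψ * Ψᴴ).mulVecLin := by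
      rw [hrange]
      exact ⟨_, rfl⟩
    rw [Matrix.mulVecLin_apply] at hu
    set v : EuclideanSpace ℂ (Fin m) := WithLp.toLp 2 (Ψ *ᵥ Pi.single j 1) with hv
    have hvr : v ∈ LinearMap.range (Matrix.toEuclideanLin (Ψ * Ψᴴ)) :=
      ⟨WithLp.toLp 2 u, by rw [hv, ← hu]; rfl⟩
    have h1 : suppProj (Ψ * Ψᴴ) v = v := Submodule.starProjection_eq_self_iff.mpr hvr
    have h2 := congrArg (fun T : EuclideanSpace ℂ (Fin m) →L[ℂ] EuclideanSpace ℂ (Fin m) => T v)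
      h.eq
    change suppProj (Ψ * Ψᴴ) (Matrix.toEuclideanCLM (𝕜 := ℂ) X v) =
      Matrix.toEuclideanCLM (𝕜 := ℂ) X (suppProj (Ψ * Ψᴴ) v) at h2
    rw [h1] at h2
    obtain ⟨t, ht⟩ := Submodule.starProjection_eq_self_iff.mp h2
    refine ⟨Ψᴴ *ᵥ t.ofLp, ?_⟩
    rw [Matrix.mulVec_mulVec]
    exact congrArg WithLp.ofLp ht
  choose u hu using hcol
  refine ⟨Matrix.of fun i j => u j i, ?_⟩
  ext i j
  have h1 := congrFun (hu j) i
  simp only [Matrix.mulVec_single_one] at h1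
  exact h1.symm

section Moments

variable {IA OA IB OB : Type*} [Fintype OA] [Fintype OB] {m n m' n' : ℕ}

theorem exists_word_mul_eq {I O α β : Type*} [Fintype α] [Fintype β] [DecidableEq α]
    [DecidableEq β] {E : I → O → Matrix α α ℂ} {Ψ : Matrix α β ℂ}
    (h : ∀ x a, ∃ G : Matrix β β ℂ, E x a * Ψ = Ψ * G) (w : List (I × O)) :
    ∃ G : Matrix β β ℂ, word E w * Ψ = Ψ * G := by
  induction w with
  | nil => exact ⟨1, by simp⟩
  | cons i w ih =>
    obtain ⟨G, hG⟩ := ih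
    obtain ⟨G', hG'⟩ := h i.1 i.2
    exact ⟨G' * G, by rw [word_cons, Matrix.mul_assoc, hG, ← Matrix.mul_assoc, hG',
      Matrix.mul_assoc]⟩

theorem Strategy.SupportPreserving.exists_word_mul {T : Strategy IA OA IB OB m n}
    (hT : T.SupportPreserving) (w : List (IA × OA)) :
    ∃ G : Matrix (Fin n) (Fin n) ℂ, word T.E w * T.toMatrixStrategy.Ψ = T.toMatrixStrategy.Ψ * G :=
  exists_word_mul_eq (fun x a => exists_mul_eq_of_commute_suppProj (hT.1 x a)) w

theorem Strategy.SupportPreserving.exists_word_mul_conjTranspose {T : Strategy IA OA IB OB m n}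
    (hT : T.SupportPreserving) (v : List (IB × OB)) :
    ∃ G : Matrix (Fin m) (Fin m) ℂ, word T.toMatrixStrategy.G v * T.toMatrixStrategy.Ψᴴ =
      T.toMatrixStrategy.Ψᴴ * G := by
  refine exists_word_mul_eq (fun y b => ?_) v
  have hρ : T.rhoB = T.toMatrixStrategy.Ψᵀ * T.toMatrixStrategy.Ψᵀᴴ := by
    ext j j'
    simp [Strategy.rhoB, Strategy.toMatrixStrategy, coeffMatrix, Matrix.mul_apply]
  have h := hT.2 y b
  rw [hρ] at h
  obtain ⟨G, hG⟩ := exists_mul_eq_of_commute_suppProj h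
  refine ⟨G.map conj, ?_⟩
  have h1 := congrArg (fun M => M.map conj) hG
  simp only [Matrix.map_mul] at h1
  have h2 : (T.F y b).map conj = T.toMatrixStrategy.G y b := by
    rw [← T.toMatrixStrategy.G_star]
    rfl
  rw [h2] at h1
  exact h1

/-- The real parts of all moments are preserved by complex local dilations of support-preserving
strategies. -/
theorem IsComplexLocalDilation.re_moment_eq {S : Strategy IA OA IB OB m n}
    {T : Strategy IA OA IB OB m' n'} (hST : IsComplexLocalDilation S T) (hT : T.SupportPreserving)
    (w : List (IA × OA)) (v : List (IB × OB)) :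
    (S.toMatrixStrategy.moment w v).re = (T.toMatrixStrategy.moment w v).re := by
  obtain ⟨k, l, UA, UB, aux₀, aux₁, hUA, hUB, haux, hψ, hE, hF⟩ := hST
  set Ψ := S.toMatrixStrategy.Ψ with hΨ
  set Ψ' := T.toMatrixStrategy.Ψ with hΨ'
  set A₀ := coeffMatrix aux₀
  set A₁ := coeffMatrix aux₁
  set Φ := dilate Ψ' (Ψ'.map conj) A₀ A₁ with hΦ
  have hR : UBᵀ * UBᵀᴴ = 1 := by
    have h := congrArg Matrix.transpose hUB
    rw [Matrix.transpose_mul, Matrix.transpose_one] at h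
    exact h
  have hψ' : UA * Ψ * UBᵀ = Φ := by
    have h := congrArg coeffMatrix hψ
    rwa [coeffMatrix_kronecker_mulVec, coeffMatrix_combine, coeffMatrix_star] at h
  have hE' (x a) : UA * (S.E x a * Ψ) * UBᵀ =
      dilate (T.E x a) ((T.E x a).map conj) (1 : Matrix (Fin k) (Fin k) ℂ) 1 * Φ := by
    have h := congrArg coeffMatrix (hE x a)
    simp only [coeffMatrix_kronecker_mulVec, coeffMatrix_combine, coeffMatrix_star,
      Matrix.transpose_one, Matrix.mul_one] at h
    rw [hΦ, dilate_mul, Matrix.one_mul, Matrix.one_mul]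
    exact h
  have hF' (y b) : UBᵀᴴ * (S.toMatrixStrategy.G y b * Ψᴴ) * UAᴴ =
      dilate (T.toMatrixStrategy.G y b) ((T.toMatrixStrategy.G y b).map conj)
        (1 : Matrix (Fin l) (Fin l) ℂ) 1 * Φᴴ := by
    have h := congrArg coeffMatrix (hF y b)
    simp only [coeffMatrix_kronecker_mulVec, coeffMatrix_combine, coeffMatrix_star,
      Matrix.one_mul] at h
    have h2 : UA * (Ψ * S.toMatrixStrategy.G y b) * UBᵀ =
        Φ * dilate (T.toMatrixStrategy.G y b) ((T.toMatrixStrategy.G y b).map conj)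
        (1 : Matrix (Fin l) (Fin l) ℂ) 1 := by
      rw [hΦ, dilate_mul, Matrix.mul_one, Matrix.mul_one]
      exact h
    have h3 := congrArg Matrix.conjTranspose h2
    have h4 : ((T.toMatrixStrategy.G y b).map conj)ᴴ = (T.toMatrixStrategy.G y b).map conj := by
      have := congrArg (fun M => M.map conj) (T.toMatrixStrategy.G_star y b)
      exact this
    rw [Matrix.conjTranspose_mul, Matrix.conjTranspose_mul, Matrix.conjTranspose_mul,
      Matrix.conjTranspose_mul, MatrixStrategy.G_star, conjTranspose_dilate, h4,
      MatrixStrategy.G_star, Matrix.conjTranspose_one,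
      ← Matrix.mul_assoc] at h3
    exact h3
  have hconjT : (Ψ'.map conj)ᴴ = Ψ'ᴴ.map conj := rfl
  have hA := compress_word hUA hψ' hE' (fun w => by
    obtain ⟨G, hG⟩ := hT.exists_word_mul w
    refine ⟨dilate G (G.map conj) (1 : Matrix (Fin l) (Fin l) ℂ) 1, ?_⟩
    rw [word_dilate, hΦ, dilate_mul, dilate_mul, ← Matrix.map_mul, ← Matrix.map_mul, hG]
    simp [hΨ']) w
  have hB := compress_word (Φ := Φᴴ) (E := S.toMatrixStrategy.G) (Ψ := Ψᴴ) (R := UAᴴ)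
    (U := UBᵀᴴ) (by rw [Matrix.conjTranspose_conjTranspose, hR])
    (by rw [← hψ', Matrix.conjTranspose_mul, Matrix.conjTranspose_mul, Matrix.mul_assoc]) hF'
    (fun v => by
      obtain ⟨G, hG⟩ := hT.exists_word_mul_conjTranspose v
      refine ⟨dilate G (G.map conj) (1 : Matrix (Fin k) (Fin k) ℂ) 1, ?_⟩
      rw [word_dilate, hΦ, conjTranspose_dilate, hconjT, dilate_mul, dilate_mul, ← Matrix.map_mul,
        ← Matrix.map_mul, hG]
      simp [hΨ']) v
  have hS : S.toMatrixStrategy.moment w v =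
      ((UBᵀᴴ * (word S.toMatrixStrategy.G v * Ψᴴ) * UAᴴ) *
        (UA * (word S.E w * Ψ) * UBᵀ)).trace := by
    calc S.toMatrixStrategy.moment w v
        = (word S.toMatrixStrategy.G v * (Ψᴴ * word S.E w * Ψ)).trace := Matrix.trace_mul_comm _ _
      _ = (word S.toMatrixStrategy.G v * Ψᴴ * (UAᴴ * UA) * (word S.E w * Ψ) *
            (UBᵀ * UBᵀᴴ)).trace := by
          rw [hUA, hR]; simp only [Matrix.mul_assoc, Matrix.mul_one]
      _ = _ := by
          rw [← Matrix.mul_assoc _ UBᵀ, Matrix.trace_mul_comm]; simp only [Matrix.mul_assoc]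
  set M := T.toMatrixStrategy.moment w v with hM
  have hN (A : Matrix (Fin k) (Fin l) ℂ) (aux) (h : A = coeffMatrix aux) :
      (Aᴴ * A).trace = ((∑ i, ‖aux i‖ ^ 2 : ℝ) : ℂ) := by
    rw [h, trace_conjTranspose_mul_self_eq_sum]
  have hM' : (word T.toMatrixStrategy.G v * Ψ'ᴴ * (word T.E w * Ψ')).trace = M := by
    rw [hM, MatrixStrategy.moment, Matrix.trace_mul_comm _ (word _ v)]
    simp only [Matrix.mul_assoc]
    rfl
  have htr (X : Matrix (Fin n') (Fin n') ℂ) : (X.map conj).trace = conj X.trace := by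
    simp [Matrix.trace]
  have hfinal : S.toMatrixStrategy.moment w v =
      M * ((∑ i, ‖aux₀ i‖ ^ 2 : ℝ) : ℂ) + conj M * ((∑ i, ‖aux₁ i‖ ^ 2 : ℝ) : ℂ) := by
    rw [hS, hA, hB, word_dilate, word_dilate, hΦ, conjTranspose_dilate, hconjT, dilate_mul,
      dilate_mul, dilate_mul, trace_dilate, ← Matrix.map_mul, ← Matrix.map_mul, ← Matrix.map_mul,
      htr, hM', Matrix.one_mul, Matrix.one_mul, Matrix.one_mul, Matrix.one_mul, hN _ _ rfl,
      hN _ _ rfl]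
  rw [hfinal, Complex.add_re, Complex.re_mul_ofReal, Complex.re_mul_ofReal, Complex.conj_re,
    ← mul_add, haux, mul_one]

theorem existsUnique_isAgreeingState_of_complexSelfTested {p : Correlation IA OA IB OB}
    (hp : p ∈ Cq IA OA IB OB) {T : Strategy IA OA IB OB m n} (hT : T.SupportPreserving)
    (hself : ComplexSelfTested T p) :
    ∃! f : BellAlgebra IA OA IB OB →L[ℝ] ℝ, IsAgreeingState p f := by
  obtain ⟨m', n', S, hS⟩ := hp
  obtain ⟨f, hf, -⟩ := S.exists_isAgreeingState hS
  have hval (g : BellAlgebra IA OA IB OB →L[ℝ] ℝ) (hg : IsAgreeingState p g) (w v) :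
      g (bellWord w v) = (T.toMatrixStrategy.moment w v.reverse).re := by
    obtain ⟨_, _, S', hS', hmom⟩ := hg.exists_strategy
    rw [hmom, (hself _ _ S' hS').re_moment_eq hT]
  exact ⟨f, hf, fun g hg => ext_bellWord fun w v => by rw [hval g hg, hval f hf]⟩

end Moments

/-! ### Minimal strategies for extreme correlations -/

section Matrices

variable {α : Type*} [Fintype α]

/-- The columns of the matrix `W` are an orthonormal basis of the given subspace. -/
theorem exists_isometry (K : Submodule ℂ (α → ℂ)) :
    ∃ W : Matrix α (Fin (Module.finrank ℂ K)) ℂ, Wᴴ * W = 1 ∧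
      (∀ v ∈ K, (W * Wᴴ) *ᵥ v = v) ∧ ∀ u, W *ᵥ u ∈ K := by
  let e := WithLp.linearEquiv 2 ℂ (α → ℂ)
  let K' : Submodule ℂ (EuclideanSpace ℂ α) := K.comap e.toLinearMap
  have hK : Module.finrank ℂ K' = Module.finrank ℂ K := by
    refine LinearEquiv.finrank_eq (e.ofSubmodules K' K ?_)
    exact Submodule.map_comap_eq_of_surjective e.surjective K
  let b := (stdOrthonormalBasis ℂ K').reindex (finCongr hK)
  let W : Matrix α (Fin (Module.finrank ℂ K)) ℂ := Matrix.of fun i j => (b j).1.ofLp i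
  have hW (u) : W *ᵥ u = e (∑ j, u j • (b j : EuclideanSpace ℂ α)) := by
    ext i
    simp [W, e, Matrix.mulVec, dotProduct, mul_comm]
  refine ⟨W, ?_, fun v hv => ?_, fun u => ?_⟩
  · ext j k
    have h := b.inner_eq_ite j k
    rw [Submodule.coe_inner, PiLp.inner_apply] at h
    simp only [RCLike.inner_apply] at h
    rw [Matrix.one_apply, ← h, Matrix.mul_apply]
    exact Finset.sum_congr rfl fun i _ => mul_comm _ _
  · let v' : K' := ⟨e.symm v, by simpa [K'] using hv⟩
    have h := congrArg (fun z : K' => e (z : EuclideanSpace ℂ α)) (b.sum_repr' v')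
    simp only [AddSubmonoidClass.coe_finsetSum, Submodule.coe_smul] at h
    rw [← Matrix.mulVec_mulVec, hW]
    have h2 (j) : (Wᴴ *ᵥ v) j = inner ℂ (b j) v' := by
      rw [Submodule.coe_inner, PiLp.inner_apply]
      simp only [RCLike.inner_apply]
      exact Finset.sum_congr rfl fun i _ => mul_comm _ _
    simp only [h2]
    rw [h]
    exact e.apply_symm_apply v
  · rw [hW]
    have : ∑ j, u j • (b j : EuclideanSpace ℂ α) ∈ K' :=
      Submodule.sum_mem _ fun j _ => Submodule.smul_mem _ _ (b j).2
    exact this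

theorem exists_projection (K : Submodule ℂ (α → ℂ)) :
    ∃ P : Matrix α α ℂ, Pᴴ = P ∧ P * P = P ∧ ∀ v, P *ᵥ v = v ↔ v ∈ K := by
  obtain ⟨W, h1, h2, h3⟩ := exists_isometry K
  refine ⟨W * Wᴴ, by simp, ?_, fun v => ⟨fun h => ?_, h2 v⟩⟩
  · rw [Matrix.mul_assoc, ← Matrix.mul_assoc Wᴴ, h1, Matrix.one_mul]
  · rw [← h, ← Matrix.mulVec_mulVec]
    exact h3 _

theorem mul_eq_self_iff {β : Type*} [Fintype β] [DecidableEq β] {P : Matrix α α ℂ}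
    {M : Matrix α β ℂ} : P * M = M ↔ ∀ u, P *ᵥ (M *ᵥ u) = M *ᵥ u := by
  simp only [Matrix.mulVec_mulVec]
  exact ⟨fun h u => by rw [h], fun h => Matrix.ext_of_mulVec_single fun j => h _⟩

theorem exists_trace_eq_ofReal {β : Type*} [Fintype β] {M : Matrix α β ℂ} (hM : M ≠ 0) :
    ∃ t : ℝ, 0 < t ∧ (Mᴴ * M).trace = t := by
  have h : (Mᴴ * M).trace = _ := trace_conjTranspose_mul_self_eq_sum fun i : α × β => M i.1 i.2
  refine ⟨_, lt_of_le_of_ne (Finset.sum_nonneg fun i _ => by positivity) fun h0 => hM ?_, h⟩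
  rw [← Matrix.trace_conjTranspose_mul_self_eq_zero_iff, h, ← h0, Complex.ofReal_zero]

end Matrices

namespace MatrixStrategy

variable {IA OA IB OB : Type*} [Fintype OA] [Fintype OB] {α β γ : Type*}
  [Fintype α] [Fintype β] [DecidableEq α] [DecidableEq β] [Fintype γ] [DecidableEq γ]

/-- The correlation produced by a strategy. -/
def correlation (S : MatrixStrategy IA OA IB OB α β) : Correlation IA OA IB OB :=
  fun x y a b => (S.Ψᴴ * S.E x a * S.Ψ * S.G y b).trace.re

theorem produces_correlation (S : MatrixStrategy IA OA IB OB α β) :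
    S.Produces S.correlation := by
  intro x y a b
  refine (Complex.conj_eq_iff_re.mp ?_).symm
  have h := Matrix.trace_conjTranspose (S.Ψᴴ * S.E x a * S.Ψ * S.G y b)
  rw [starRingEnd_apply, ← h, Matrix.conjTranspose_mul, Matrix.conjTranspose_mul,
    Matrix.conjTranspose_mul, S.G_star, S.E_star, Matrix.conjTranspose_conjTranspose,
    Matrix.trace_mul_comm]
  simp only [Matrix.mul_assoc]

theorem Produces.mem_Cq {S : MatrixStrategy IA OA IB OB α β} {p : Correlation IA OA IB OB}
    (h : S.Produces p) : p ∈ Cq IA OA IB OB :=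
  ⟨_, _, _, h.toStrategy⟩

theorem Ψ_ne_zero (S : MatrixStrategy IA OA IB OB α β) : S.Ψ ≠ 0 := by
  intro h
  have := S.norm_Ψ
  simp [h] at this

/-- A strategy with the same measurements and a multiple of the given vector as its state. -/
theorem exists_normalized (S : MatrixStrategy IA OA IB OB α β) {M : Matrix α β ℂ} (hM : M ≠ 0) :
    ∃ (t : ℝ) (S' : MatrixStrategy IA OA IB OB α β), 0 < t ∧ (Mᴴ * M).trace = t ∧
      S'.E = S.E ∧ S'.G = S.G ∧ (∃ c : ℂ, S'.Ψ = c • M) ∧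
      ∀ (X : Matrix α α ℂ) (Y : Matrix β β ℂ), (Mᴴ * X * M * Y).trace =
        t * (S'.Ψᴴ * X * S'.Ψ * Y).trace := by
  obtain ⟨t, ht, htM⟩ := exists_trace_eq_ofReal hM
  have hc : (t : ℂ) * ((((√t)⁻¹ : ℝ) : ℂ) * (((√t)⁻¹ : ℝ) : ℂ)) = 1 := by
    rw [← Complex.ofReal_mul, ← Complex.ofReal_mul, ← mul_inv, Real.mul_self_sqrt ht.le,
      mul_inv_cancel₀ ht.ne', Complex.ofReal_one]
  have hX (X : Matrix α α ℂ) (Y : Matrix β β ℂ) : (Mᴴ * X * M * Y).trace =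
      t * (((((√t)⁻¹ : ℝ) : ℂ) • M)ᴴ * X * ((((√t)⁻¹ : ℝ) : ℂ) • M) * Y).trace := by
    simp only [Matrix.conjTranspose_smul, Matrix.smul_mul, Matrix.mul_smul, Matrix.trace_smul,
      smul_eq_mul, RCLike.star_def, Complex.conj_ofReal]
    rw [← mul_assoc ((((√t)⁻¹ : ℝ) : ℂ)), ← mul_assoc, hc, one_mul]
  refine ⟨t, { S with Ψ := (((√t)⁻¹ : ℝ) : ℂ) • M, norm_Ψ := ?_ }, ht, htM, rfl, rfl, ⟨_, rfl⟩, hX⟩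
  have h := hX 1 1
  rw [Matrix.mul_one, Matrix.mul_one, Matrix.mul_one, Matrix.mul_one, htM] at h
  exact (mul_eq_left₀ (Complex.ofReal_ne_zero.mpr ht.ne')).mp h.symm

/-- `S` produces `p` and no strategy producing `p` has a smaller total dimension. -/
structure IsMinimalFor (S : MatrixStrategy IA OA IB OB α β) (p : Correlation IA OA IB OB) :
    Prop where
  produces : S.Produces p
  minimal : ∀ (m n : ℕ) (S' : Strategy IA OA IB OB m n), S'.Produces p →
    Fintype.card α + Fintype.card β ≤ m + n

variable {p : Correlation IA OA IB OB}

theorem IsMinimalFor.swap {S : MatrixStrategy IA OA IB OB α β} (h : S.IsMinimalFor p) :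
    S.swap.IsMinimalFor fun y x b a => p x y a b where
  produces := h.produces.swap
  minimal m n S' hS' := by
    have h1 := h.minimal _ _ _ (Strategy.toMatrixStrategy_produces.mpr hS').swap.toStrategy
    rw [Fintype.card_fin, Fintype.card_fin] at h1
    omega

theorem swap_mem_Cq (hp : p ∈ Cq IA OA IB OB) : (fun y x b a => p x y a b) ∈ Cq IB OB IA OA := by
  obtain ⟨m, n, S, hS⟩ := hp
  exact (Strategy.toMatrixStrategy_produces.mpr hS).swap.mem_Cq

theorem swap_mem_extremePoints_Cq (h : p ∈ (Cq IA OA IB OB).extremePoints ℝ) :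
    (fun y x b a => p x y a b) ∈ (Cq IB OB IA OA).extremePoints ℝ := by
  refine ⟨swap_mem_Cq h.1, fun q₁ hq₁ q₂ hq₂ hq => ?_⟩
  have h1 : (fun x y a b => q₁ y x b a) = p := h.2 (swap_mem_Cq hq₁) (swap_mem_Cq hq₂) (by
    obtain ⟨s, t, hs, ht, hst, hp⟩ := hq
    refine ⟨s, t, hs, ht, hst, ?_⟩
    funext x y a b
    exact congrFun (congrFun (congrFun (congrFun hp y) x) b) a)
  funext y x b a
  exact congrFun (congrFun (congrFun (congrFun h1 x) y) a) b

theorem IsMinimalFor.exists_right_inverse {S : MatrixStrategy IA OA IB OB α β}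
    (h : S.IsMinimalFor p) : ∃ R : Matrix β α ℂ, S.Ψ * R = 1 := by
  obtain ⟨W, hW, hWΨ, -⟩ := exists_isometry (LinearMap.range S.Ψ.mulVecLin)
  replace hWΨ : W * Wᴴ * S.Ψ = S.Ψ := mul_eq_self_iff.mpr fun u => hWΨ _ ⟨u, rfl⟩
  let S' : MatrixStrategy IA OA IB OB (Fin (Module.finrank ℂ (LinearMap.range S.Ψ.mulVecLin))) β :=
    { Ψ := Wᴴ * S.Ψ
      E := fun x a => Wᴴ * S.E x a * W
      G := S.G
      norm_Ψ := by
        rw [Matrix.conjTranspose_mul, Matrix.conjTranspose_conjTranspose, Matrix.mul_assoc,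
          ← Matrix.mul_assoc W, hWΨ, S.norm_Ψ]
      E_pos := fun x a => (S.E_pos x a).conjTranspose_mul_mul_same W
      G_pos := S.G_pos
      E_sum := fun x => by
        rw [← Matrix.sum_mul, ← Matrix.mul_sum, S.E_sum, Matrix.mul_one, hW]
      G_sum := S.G_sum }
  have hS' : S'.Produces p := by
    intro x y a b
    rw [← h.produces x y a b]
    have h1 : (Wᴴ * S.Ψ)ᴴ * (Wᴴ * S.E x a * W) * (Wᴴ * S.Ψ) =
        (W * Wᴴ * S.Ψ)ᴴ * S.E x a * (W * Wᴴ * S.Ψ) := by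
      simp only [Matrix.conjTranspose_mul, Matrix.conjTranspose_conjTranspose, Matrix.mul_assoc]
    change ((Wᴴ * S.Ψ)ᴴ * (Wᴴ * S.E x a * W) * (Wᴴ * S.Ψ) * S.G y b).trace = _
    rw [h1, hWΨ]
  have hcard := h.minimal _ _ _ hS'.toStrategy
  rw [Fintype.card_fin] at hcard
  have htop : LinearMap.range S.Ψ.mulVecLin = ⊤ := by
    refine Submodule.eq_top_of_finrank_eq (le_antisymm (Submodule.finrank_le _) ?_)
    rw [Module.finrank_fintype_fun_eq_card]
    omega
  have hsurj (i : α) : ∃ u : β → ℂ, S.Ψ *ᵥ u = Pi.single i 1 := by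
    obtain ⟨u, hu⟩ : Pi.single i 1 ∈ LinearMap.range S.Ψ.mulVecLin := htop ▸ Submodule.mem_top
    exact ⟨u, hu⟩
  choose u hu using hsurj
  refine ⟨Matrix.of fun j i => u i j, ?_⟩
  ext i k
  have h1 := congrFun (hu k) i
  rw [Matrix.one_apply, ← Pi.single_apply, ← h1]
  rfl

theorem IsMinimalFor.exists_inverse {S : MatrixStrategy IA OA IB OB α β}
    (h : S.IsMinimalFor p) : ∃ R : Matrix β α ℂ, S.Ψ * R = 1 ∧ R * S.Ψ = 1 := by
  obtain ⟨R, hR⟩ := h.exists_right_inverse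
  obtain ⟨R', hR'⟩ := h.swap.exists_right_inverse
  have h1 : R'ᴴ * S.Ψ = 1 := by
    have := congrArg Matrix.conjTranspose hR'
    rwa [Matrix.conjTranspose_mul, Matrix.conjTranspose_one, MatrixStrategy.swap,
      Matrix.conjTranspose_conjTranspose] at this
  refine ⟨R, hR, ?_⟩
  have h2 : R'ᴴ = R := by
    rw [← Matrix.mul_one R'ᴴ, ← hR, ← Matrix.mul_assoc, h1, Matrix.one_mul]
  rw [← h2, h1]

/-- For an extreme correlation, a projection commuting with the measurements of a minimal strategy
is trivial, since otherwise it splits the strategy into a nontrivial convex combination. -/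
theorem IsMinimalFor.projection_trivial {S : MatrixStrategy IA OA IB OB α β}
    (h : S.IsMinimalFor p) (hp : p ∈ (Cq IA OA IB OB).extremePoints ℝ) {P : Matrix α α ℂ}
    (hP : Pᴴ = P) (hPP : P * P = P) (hPE : ∀ x a, P * S.E x a = S.E x a * P) (hP0 : P ≠ 0) :
    P = 1 := by
  by_contra hP1
  obtain ⟨R, hR, -⟩ := h.exists_inverse
  have hcancel (X : Matrix α α ℂ) (hX : X * S.Ψ = 0) : X = 0 := by
    rw [← Matrix.mul_one X, ← hR, ← Matrix.mul_assoc, hX, Matrix.zero_mul]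
  obtain ⟨t, S₁, ht, htΨ, hE₁, hG₁, ⟨c, hc⟩, htr₁⟩ :=
    S.exists_normalized (M := P * S.Ψ) fun h0 => hP0 (hcancel _ h0)
  obtain ⟨s, S₂, hs, hsΨ, hE₂, hG₂, -, htr₂⟩ :=
    S.exists_normalized (M := (1 - P) * S.Ψ) fun h0 => hP1 (sub_eq_zero.mp (hcancel _ h0)).symm
  have hsplit (X : Matrix α α ℂ) (hX : P * X = X * P) (Y : Matrix β β ℂ) :
      (S.Ψᴴ * X * S.Ψ * Y).trace = t * (S₁.Ψᴴ * X * S₁.Ψ * Y).trace +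
        s * (S₂.Ψᴴ * X * S₂.Ψ * Y).trace := by
    have h1 : (P * S.Ψ)ᴴ * X * (P * S.Ψ) = S.Ψᴴ * (P * X) * S.Ψ := by
      have : S.Ψᴴ * P * X * (P * S.Ψ) = S.Ψᴴ * (P * (X * P)) * S.Ψ := by
        simp only [Matrix.mul_assoc]
      rw [Matrix.conjTranspose_mul, hP, this, ← hX, ← Matrix.mul_assoc P, hPP]
    have h2 : ((1 - P) * S.Ψ)ᴴ * X * ((1 - P) * S.Ψ) = S.Ψᴴ * (X - P * X) * S.Ψ := by
      have h3 : (1 - P) * (X * (1 - P)) = X - P * X := by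
        rw [Matrix.mul_sub, Matrix.mul_one, ← hX, Matrix.sub_mul, Matrix.one_mul, Matrix.mul_sub,
          ← Matrix.mul_assoc P P, hPP, sub_self, sub_zero]
      rw [← h3, Matrix.conjTranspose_mul, Matrix.conjTranspose_sub, hP, Matrix.conjTranspose_one]
      simp only [Matrix.mul_assoc]
    rw [← htr₁, ← htr₂, h1, h2, ← Matrix.trace_add, ← Matrix.add_mul, ← Matrix.add_mul,
      ← Matrix.mul_add, add_sub_cancel]
  have hts : t + s = 1 := by
    have h1 := hsplit 1 (by simp) 1
    simp only [Matrix.mul_one] at h1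
    rw [S.norm_Ψ, S₁.norm_Ψ, S₂.norm_Ψ, mul_one, mul_one] at h1
    exact_mod_cast h1.symm
  have hS₁ : S₁.Produces p := by
    have h1 : S₁.correlation = p := by
      refine hp.2 S₁.produces_correlation.mem_Cq S₂.produces_correlation.mem_Cq
        ⟨t, s, ht, hs, hts, ?_⟩
      funext x y a b
      have h1 := hsplit (S.E x a) (hPE x a) (S.G y b)
      rw [h.produces x y a b] at h1
      have h2 := congrArg Complex.re h1
      rw [Complex.ofReal_re, Complex.add_re, Complex.re_ofReal_mul, Complex.re_ofReal_mul] at h2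
      simp only [correlation, Pi.add_apply, Pi.smul_apply, smul_eq_mul, hE₁, hE₂, hG₁, hG₂]
      exact h2.symm
    rw [← h1]
    exact S₁.produces_correlation
  obtain ⟨R₁, hR₁⟩ := IsMinimalFor.exists_right_inverse ⟨hS₁, h.minimal⟩
  refine hP1 (sub_eq_zero.mp ?_).symm
  have h1 : (1 - P) * S₁.Ψ = 0 := by
    rw [hc, Matrix.mul_smul, ← Matrix.mul_assoc, Matrix.sub_mul, Matrix.one_mul, hPP, sub_self,
      Matrix.zero_mul, smul_zero]
  calc 1 - P = (1 - P) * S₁.Ψ * R₁ := by rw [Matrix.mul_assoc, hR₁, Matrix.mul_one]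
    _ = 0 := by rw [h1, Matrix.zero_mul]

end MatrixStrategy

/-- Only scalar matrices commute with all the matrices of the family. -/
def IsIrreducibleFamily {I O α : Type*} [Fintype α] [DecidableEq α]
    (E : I → O → Matrix α α ℂ) : Prop :=
  ∀ X : Matrix α α ℂ, (∀ x a, E x a * X = X * E x a) → ∃ c : ℂ, X = c • 1

theorem IsIrreducibleFamily.map_conj {I O α : Type*} [Fintype α] [DecidableEq α]
    {E : I → O → Matrix α α ℂ} (hE : IsIrreducibleFamily E) :
    IsIrreducibleFamily fun x a => (E x a).map conj := by
  have hconj (M : Matrix α α ℂ) : (M.map conj).map conj = M := by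
    ext i j
    simp
  intro X hX
  obtain ⟨c, hc⟩ := hE (X.map conj) fun x a => by
    have h := congrArg (fun M => M.map conj) (hX x a)
    rwa [Matrix.map_mul, Matrix.map_mul, hconj] at h
  refine ⟨conj c, ?_⟩
  rw [← hconj X, hc]
  ext i j
  by_cases hij : i = j <;> simp [hij]

namespace MatrixStrategy

variable {IA OA IB OB : Type*} [Fintype OA] [Fintype OB] {α β : Type*}
  [Fintype α] [Fintype β] [DecidableEq α] [DecidableEq β] {p : Correlation IA OA IB OB}

theorem nonempty_left (S : MatrixStrategy IA OA IB OB α β) : Nonempty α := by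
  by_contra h
  rw [not_nonempty_iff] at h
  exact S.Ψ_ne_zero (Subsingleton.elim _ _)

/-- A minimal strategy for an extreme correlation has irreducible measurements. -/
theorem IsMinimalFor.isIrreducibleFamily_E {S : MatrixStrategy IA OA IB OB α β}
    (h : S.IsMinimalFor p) (hp : p ∈ (Cq IA OA IB OB).extremePoints ℝ) :
    IsIrreducibleFamily S.E := by
  intro X hX
  have : Nonempty α := S.nonempty_left
  obtain ⟨c, hc⟩ := Module.End.exists_eigenvalue X.mulVecLin
  obtain ⟨P, hP, hPP, hPK⟩ := exists_projection (Module.End.eigenspace X.mulVecLin c)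
  have hmem (v : α → ℂ) : P *ᵥ v = v ↔ X *ᵥ v = c • v := by
    rw [hPK, Module.End.mem_eigenspace_iff, Matrix.mulVecLin_apply]
  have hrange (v) : X *ᵥ (P *ᵥ v) = c • (P *ᵥ v) := by
    rw [← hmem, Matrix.mulVec_mulVec, hPP]
  have hEP (x a) : P * (S.E x a * P) = S.E x a * P := by
    refine mul_eq_self_iff.mpr fun u => ?_
    rw [hmem, ← Matrix.mulVec_mulVec, Matrix.mulVec_mulVec _ X, ← hX, ← Matrix.mulVec_mulVec,
      hrange, Matrix.mulVec_smul]
  refine ⟨c, ?_⟩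
  have hP1 : P = 1 := by
    refine h.projection_trivial hp hP hPP (fun x a => ?_) fun hP0 => ?_
    · have h1 := congrArg Matrix.conjTranspose (hEP x a)
      rw [Matrix.conjTranspose_mul, Matrix.conjTranspose_mul, hP, S.E_star, Matrix.mul_assoc,
        hEP] at h1
      exact h1.symm
    · obtain ⟨v, hv, hv0⟩ := hc.exists_hasEigenvector
      refine hv0 ?_
      rw [← (hPK v).mpr hv, hP0, Matrix.zero_mulVec]
  refine Matrix.ext_of_mulVec_single fun j => ?_
  have h1 := hrange (Pi.single j 1)
  rw [hP1, Matrix.one_mulVec] at h1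
  rw [h1, Matrix.smul_mulVec, Matrix.one_mulVec]

theorem IsMinimalFor.isIrreducibleFamily_G {S : MatrixStrategy IA OA IB OB α β}
    (h : S.IsMinimalFor p) (hp : p ∈ (Cq IA OA IB OB).extremePoints ℝ) :
    IsIrreducibleFamily S.G :=
  h.swap.isIrreducibleFamily_E (swap_mem_extremePoints_Cq hp)

end MatrixStrategy

/-! ### Consequences of unique moments -/

/-- All strategies producing `p` have the same real parts of moments. -/
def HasUniqueMoments {IA OA IB OB : Type*} [Fintype OA] [Fintype OB]
    (p : Correlation IA OA IB OB) : Prop :=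
  ∀ (m n m' n' : ℕ) (S : Strategy IA OA IB OB m n) (S' : Strategy IA OA IB OB m' n'),
    S.Produces p → S'.Produces p → ∀ w v,
      (S.toMatrixStrategy.moment w v).re = (S'.toMatrixStrategy.moment w v).re

section UniqueMoments

variable {IA OA IB OB : Type*} [Fintype OA] [Fintype OB] {p : Correlation IA OA IB OB}

theorem hasUniqueMoments_of_existsUnique
    (h : ∃! f : BellAlgebra IA OA IB OB →L[ℝ] ℝ, IsAgreeingState p f) : HasUniqueMoments p := by
  intro m n m' n' S S' hS hS' w v
  obtain ⟨f, hf, hfm⟩ := S.exists_isAgreeingState hS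
  obtain ⟨f', hf', hfm'⟩ := S'.exists_isAgreeingState hS'
  have h1 := hfm w v.reverse
  have h2 := hfm' w v.reverse
  rw [List.reverse_reverse] at h1 h2
  rw [← h1, ← h2, h.unique hf hf']

variable {α β α' β' : Type*} [Fintype α] [Fintype β] [DecidableEq α] [DecidableEq β]
  [Fintype α'] [Fintype β'] [DecidableEq α'] [DecidableEq β']

theorem HasUniqueMoments.re_moment_eq (hU : HasUniqueMoments p)
    {S : MatrixStrategy IA OA IB OB α β} {S' : MatrixStrategy IA OA IB OB α' β'}
    (hS : S.Produces p) (hS' : S'.Produces p) (w : List (IA × OA)) (v : List (IB × OB)) :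
    (S.moment w v).re = (S'.moment w v).re := by
  rw [← S.moment_toStrategy, ← S'.moment_toStrategy]
  exact hU _ _ _ _ _ _ hS.toStrategy hS'.toStrategy w v

theorem HasUniqueMoments.swap (hU : HasUniqueMoments p) :
    HasUniqueMoments fun y x b a => p x y a b := by
  intro m n m' n' S S' hS hS' w v
  rw [← Strategy.toMatrixStrategy_produces] at hS hS'
  rw [← MatrixStrategy.moment_swap, ← MatrixStrategy.moment_swap S'.toMatrixStrategy]
  exact hU.re_moment_eq hS.swap hS'.swap v w

/-- If the moments are unique, then the range of the state is invariant under the measurement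
operators: pinching them by the projection onto the range does not change the correlation, so it
does not change the second moments. -/
theorem HasUniqueMoments.exists_E_mul_Ψ (hU : HasUniqueMoments p)
    {S : MatrixStrategy IA OA IB OB α β} (hS : S.Produces p) (x : IA) (a : OA) :
    ∃ M : Matrix β β ℂ, S.E x a * S.Ψ = S.Ψ * M := by
  obtain ⟨P, hP, hPP, hPK⟩ := exists_projection (LinearMap.range S.Ψ.mulVecLin)
  have hPΨ : P * S.Ψ = S.Ψ := mul_eq_self_iff.mpr fun u => (hPK _).mpr ⟨u, rfl⟩
  have hQ : (1 - P)ᴴ = 1 - P := by rw [Matrix.conjTranspose_sub, hP, Matrix.conjTranspose_one]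
  have hΨP : S.Ψᴴ * P = S.Ψᴴ := by
    have := congrArg Matrix.conjTranspose hPΨ
    rwa [Matrix.conjTranspose_mul, hP] at this
  have hQΨ : (1 - P) * S.Ψ = 0 := by rw [Matrix.sub_mul, Matrix.one_mul, hPΨ, sub_self]
  let S' : MatrixStrategy IA OA IB OB α β :=
    { S with
      E := fun x a => P * S.E x a * P + (1 - P) * S.E x a * (1 - P)
      E_pos := fun x a => by
        have h1 := (S.E_pos x a).conjTranspose_mul_mul_same P
        have h2 := (S.E_pos x a).conjTranspose_mul_mul_same (1 - P)
        rw [hP] at h1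
        rw [hQ] at h2
        exact h1.add h2
      E_sum := fun x => by
        rw [Finset.sum_add_distrib, ← Matrix.sum_mul, ← Matrix.sum_mul, ← Matrix.mul_sum,
          ← Matrix.mul_sum, S.E_sum, Matrix.mul_one, Matrix.mul_one, hPP, Matrix.mul_sub,
          Matrix.sub_mul, Matrix.sub_mul, hPP]
        simp }
  have hE' (x a) : S'.E x a * S.Ψ = P * (S.E x a * S.Ψ) := by
    change (P * S.E x a * P + (1 - P) * S.E x a * (1 - P)) * S.Ψ = _
    rw [Matrix.add_mul, Matrix.mul_assoc _ P, hPΨ, Matrix.mul_assoc _ (1 - P), hQΨ, Matrix.mul_zero,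
      add_zero, Matrix.mul_assoc]
  have hS' : S'.Produces p := by
    intro x y a b
    rw [← hS x y a b]
    change (S.Ψᴴ * S'.E x a * S.Ψ * S.G y b).trace = _
    rw [Matrix.mul_assoc S.Ψᴴ, hE', ← Matrix.mul_assoc S.Ψᴴ, hΨP, ← Matrix.mul_assoc S.Ψᴴ]
  have hmom := hU.re_moment_eq hS hS' [(x, a), (x, a)] []
  have h1 : S.moment [(x, a), (x, a)] [] = ((S.E x a * S.Ψ)ᴴ * (S.E x a * S.Ψ)).trace := by
    simp [MatrixStrategy.moment, S.E_star, Matrix.mul_assoc]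
  have h2 : S'.moment [(x, a), (x, a)] [] =
      ((S.E x a * S.Ψ)ᴴ * (P * (S.E x a * S.Ψ))).trace := by
    have h3 : S'.moment [(x, a), (x, a)] [] = ((S'.E x a * S.Ψ)ᴴ * (S'.E x a * S.Ψ)).trace := by
      rw [Matrix.conjTranspose_mul, S'.E_star]
      simp only [MatrixStrategy.moment, word_cons, word_nil, Matrix.mul_one, Matrix.mul_assoc]
      rfl
    rw [h3, hE', Matrix.conjTranspose_mul, hP, Matrix.mul_assoc, ← Matrix.mul_assoc P P, hPP]
  have h3 : (((1 - P) * (S.E x a * S.Ψ))ᴴ * ((1 - P) * (S.E x a * S.Ψ))).trace =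
      S.moment [(x, a), (x, a)] [] - S'.moment [(x, a), (x, a)] [] := by
    have hQQ : (1 - P) * (1 - P) = 1 - P := by
      rw [Matrix.mul_sub, Matrix.sub_mul, Matrix.sub_mul, hPP]
      simp
    rw [Matrix.conjTranspose_mul, hQ, Matrix.mul_assoc, ← Matrix.mul_assoc (1 - P) (1 - P), hQQ,
      h1, h2, ← Matrix.trace_sub, ← Matrix.mul_sub, Matrix.sub_mul, Matrix.one_mul]
  have h4 : (1 - P) * (S.E x a * S.Ψ) = 0 := by
    by_contra h0
    obtain ⟨t, ht, htr⟩ := exists_trace_eq_ofReal h0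
    rw [h3] at htr
    have h5 := congrArg Complex.re htr
    rw [Complex.sub_re, hmom, sub_self, Complex.ofReal_re] at h5
    exact ht.ne h5
  rw [Matrix.sub_mul, Matrix.one_mul, sub_eq_zero] at h4
  have h5 (j : β) : ∃ u : β → ℂ, S.Ψ *ᵥ u = (S.E x a * S.Ψ) *ᵥ Pi.single j 1 :=
    (hPK _).mp (mul_eq_self_iff.mp h4.symm _)
  choose u hu using h5
  refine ⟨Matrix.of fun i j => u j i, ?_⟩
  ext i j
  have h6 := congrFun (hu j) i
  rw [Matrix.mulVec_single_one] at h6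
  exact h6.symm

theorem HasUniqueMoments.exists_Ψ_mul_G (hU : HasUniqueMoments p)
    {S : MatrixStrategy IA OA IB OB α β} (hS : S.Produces p) (y : IB) (b : OB) :
    ∃ M : Matrix α α ℂ, S.Ψ * S.G y b = M * S.Ψ := by
  obtain ⟨M, hM⟩ := hU.swap.exists_E_mul_Ψ hS.swap y b
  refine ⟨Mᴴ, ?_⟩
  have h1 := congrArg Matrix.conjTranspose hM
  rwa [Matrix.conjTranspose_mul, Matrix.conjTranspose_mul, MatrixStrategy.E_star,
    MatrixStrategy.swap, Matrix.conjTranspose_conjTranspose] at h1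

theorem trace_map_conj {n : Type*} [Fintype n] (X : Matrix n n ℂ) :
    (X.map conj).trace = conj X.trace := by
  simp [Matrix.trace]

/-- Let the measurements of a minimal strategy for an extreme correlation with unique moments be
intertwined with their complex conjugates by a nonzero `j` for one party. Then all moments are real.
By irreducibility `j` is a multiple of a unitary, and it turns the conjugate strategy into one
with the same operators for this party. Adding it to the given strategy as a second block for the
other party produces `p` as well, and invariance of the range then yields an equivalence with the
conjugate measurements also for the other party. -/
theorem MatrixStrategy.IsMinimalFor.conj_moment_eq {S : MatrixStrategy IA OA IB OB α β}
    (h : S.IsMinimalFor p) (hp : p ∈ (Cq IA OA IB OB).extremePoints ℝ) (hU : HasUniqueMoments p)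
    {j : Matrix α α ℂ} (hj : j ≠ 0) (hjE : ∀ x a, S.E x a * j = j * (S.E x a).map conj)
    (w : List (IA × OA)) (v : List (IB × OB)) : conj (S.moment w v) = S.moment w v := by
  have hconjE (x a) : ((S.E x a).map conj)ᴴ = (S.E x a).map conj :=
    congrArg (fun M => M.map conj) (S.E_star x a)
  have hconjG (y b) : ((S.G y b).map conj)ᴴ = (S.G y b).map conj :=
    congrArg (fun M => M.map conj) (S.G_star y b)
  have hjE' (x a) : (S.E x a).map conj * jᴴ = jᴴ * S.E x a := by
    have := congrArg Matrix.conjTranspose (hjE x a)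
    rw [Matrix.conjTranspose_mul, Matrix.conjTranspose_mul, hconjE, S.E_star] at this
    exact this.symm
  -- rescale `j` to a unitary `u`
  obtain ⟨u, hu, huE⟩ : ∃ u : Matrix α α ℂ, uᴴ * u = 1 ∧
      ∀ x a, S.E x a * u = u * (S.E x a).map conj := by
    obtain ⟨c, hc⟩ := (h.isIrreducibleFamily_E hp).map_conj (jᴴ * j) fun x a => by
      rw [← Matrix.mul_assoc, hjE', Matrix.mul_assoc, hjE, Matrix.mul_assoc]
    obtain ⟨t, ht, htr⟩ := exists_trace_eq_ofReal hj
    have : Nonempty α := S.nonempty_left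
    have hcard : (0 : ℝ) < Fintype.card α := by exact_mod_cast Fintype.card_pos
    have hct : c = ((t / Fintype.card α : ℝ) : ℂ) := by
      rw [hc, Matrix.trace_smul, Matrix.trace_one, smul_eq_mul] at htr
      rw [Complex.ofReal_div, Complex.ofReal_natCast, ← htr, mul_div_cancel_right₀]
      exact_mod_cast hcard.ne'
    have hs : 0 < t / Fintype.card α := div_pos ht hcard
    refine ⟨(((√(t / Fintype.card α))⁻¹ : ℝ) : ℂ) • j, ?_, fun x a => by
      rw [Matrix.mul_smul, Matrix.smul_mul, hjE]⟩
    rw [Matrix.conjTranspose_smul, Matrix.smul_mul, Matrix.mul_smul, hc, hct, smul_smul, smul_smul,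
      RCLike.star_def, Complex.conj_ofReal, ← Complex.ofReal_mul, ← Complex.ofReal_mul,
      ← mul_inv, Real.mul_self_sqrt hs.le, inv_mul_cancel₀ hs.ne',
      Complex.ofReal_one, one_smul]
  set Ψ' := u * S.Ψ.map conj with hΨ'
  have hmom' (X : Matrix α α ℂ) (X' : Matrix α α ℂ) (hX : X * u = u * X'.map conj)
      (Y : Matrix β β ℂ) : (Ψ'ᴴ * X * Ψ' * Y.map conj).trace =
        conj (S.Ψᴴ * X' * S.Ψ * Y).trace := by
    have h1 : (S.Ψ.map conj)ᴴ = S.Ψᴴ.map conj := rfl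
    have h2 : uᴴ * (X * (u * S.Ψ.map conj)) = X'.map conj * S.Ψ.map conj := by
      rw [← Matrix.mul_assoc X, hX, ← Matrix.mul_assoc, ← Matrix.mul_assoc, hu, Matrix.one_mul]
    rw [hΨ', Matrix.conjTranspose_mul, Matrix.mul_assoc _ X, Matrix.mul_assoc _ uᴴ, h2, h1,
      ← Matrix.map_mul, ← Matrix.map_mul, ← Matrix.map_mul, trace_map_conj, ← Matrix.mul_assoc]
  have hword (w : List (IA × OA)) : word S.E w * u = u * (word S.E w).map conj := by
    rw [map_conj_word]
    exact word_mul_eq_mul_word huE w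
  obtain ⟨R, hR, hR'⟩ := h.exists_inverse
  obtain ⟨g, hg⟩ : ∃ g : Matrix β β ℂ, Ψ' = S.Ψ * g :=
    ⟨R * Ψ', by rw [← Matrix.mul_assoc, hR, Matrix.one_mul]⟩
  have hgG (y b) : S.G y b * g = g * (S.G y b).map conj := by
    have h2 : (((√2)⁻¹ : ℝ) : ℂ) * (((√2)⁻¹ : ℝ) : ℂ) = 1 / 2 := by
      rw [← Complex.ofReal_mul, ← mul_inv, Real.mul_self_sqrt zero_le_two]
      simp
    have htr (X : Matrix α α ℂ) (Y Y' : Matrix β β ℂ) :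
        (((((√2)⁻¹ : ℝ) : ℂ) • fromCols S.Ψ Ψ')ᴴ * X * ((((√2)⁻¹ : ℝ) : ℂ) • fromCols S.Ψ Ψ') *
          fromBlocks Y 0 0 Y').trace =
        1 / 2 * ((S.Ψᴴ * X * S.Ψ * Y).trace + (Ψ'ᴴ * X * Ψ' * Y').trace) := by
      rw [← h2, Matrix.conjTranspose_smul, RCLike.star_def, Complex.conj_ofReal]
      simp only [Matrix.smul_mul, Matrix.mul_smul, Matrix.trace_smul, smul_smul, smul_eq_mul]
      rw [Matrix.conjTranspose_fromCols_eq_fromRows_conjTranspose, Matrix.fromRows_mul,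
        Matrix.fromRows_mul_fromCols, Matrix.fromBlocks_multiply]
      simp [Matrix.trace, Fintype.sum_sum_type]
    let S₂ : MatrixStrategy IA OA IB OB α (β ⊕ β) :=
      { Ψ := (((√2)⁻¹ : ℝ) : ℂ) • fromCols S.Ψ Ψ'
        E := S.E
        G := fun y b => fromBlocks (S.G y b) 0 0 ((S.G y b).map conj)
        norm_Ψ := by
          have h3 := htr 1 1 1
          have h4 := hmom' 1 1 (by simp) 1
          rw [Matrix.map_one _ (by simp) (by simp)] at h4
          rw [Matrix.fromBlocks_one, Matrix.mul_one, Matrix.mul_one] at h3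
          rw [h3, h4]
          simp [S.norm_Ψ]
          norm_num
        E_pos := S.E_pos
        G_pos := fun y b => by
          obtain ⟨B, hB⟩ := exists_eq_conjTranspose_mul_self (S.G_pos y b)
          have h3 : fromBlocks (S.G y b) 0 0 ((S.G y b).map conj) =
              (fromBlocks B 0 0 (B.map conj))ᴴ * fromBlocks B 0 0 (B.map conj) := by
            rw [Matrix.fromBlocks_conjTranspose, Matrix.fromBlocks_multiply, hB, Matrix.map_mul]
            simp
            rfl
          rw [h3]
          exact Matrix.posSemidef_conjTranspose_mul_self _
        E_sum := S.E_sum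
        G_sum := fun y => by
          have h3 := S.G_sum y
          have h4 := congrArg ((starRingEnd ℂ).mapMatrix) h3
          rw [map_sum, _root_.map_one] at h4
          refine Eq.trans ?_ ((congrArg₂ (fun X Y => fromBlocks X 0 0 Y) h3 h4).trans
            Matrix.fromBlocks_one)
          ext (i | i) (j | j) <;> simp [Matrix.sum_apply] }
    have hS₂ : S₂.Produces p := by
      intro x y a b
      refine (htr (S.E x a) (S.G y b) ((S.G y b).map conj)).trans ?_
      rw [hmom' _ _ (huE x a), h.produces x y a b, Complex.conj_ofReal]
      ring
    obtain ⟨M, hM⟩ := hU.exists_Ψ_mul_G hS₂ y b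
    change ((((√2)⁻¹ : ℝ) : ℂ) • fromCols S.Ψ Ψ') * fromBlocks (S.G y b) 0 0 ((S.G y b).map conj) =
      M * ((((√2)⁻¹ : ℝ) : ℂ) • fromCols S.Ψ Ψ') at hM
    have hne : (((√2)⁻¹ : ℝ) : ℂ) ≠ 0 := fun h0 => by simp [h0] at h2
    rw [Matrix.smul_mul, Matrix.mul_smul] at hM
    replace hM := smul_right_injective _ hne hM
    rw [Matrix.fromCols_mul_fromBlocks, Matrix.mul_fromCols, Matrix.fromCols_inj.eq_iff] at hM
    simp only [Matrix.mul_zero, add_zero, zero_add] at hM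
    obtain ⟨h3, h4⟩ := hM
    rw [hg, ← Matrix.mul_assoc M, ← h3] at h4
    have h5 := congrArg (R * ·) h4
    simp only [← Matrix.mul_assoc, hR', Matrix.one_mul] at h5
    exact h5.symm
  have hgG' (y b) : gᴴ * S.G y b = (S.G y b).map conj * gᴴ := by
    have := congrArg Matrix.conjTranspose (hgG y b)
    rwa [Matrix.conjTranspose_mul, Matrix.conjTranspose_mul, hconjG, S.G_star] at this
  obtain ⟨c, hc⟩ := h.isIrreducibleFamily_G hp (g * gᴴ) fun y b => by
    rw [← Matrix.mul_assoc, hgG, Matrix.mul_assoc, ← hgG', Matrix.mul_assoc]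
  have hkey (w : List (IA × OA)) (v : List (IB × OB)) :
      conj (S.moment w v) = c * S.moment w v := by
    have h1 : g * (word S.G v).map conj = word S.G v * g := by
      rw [map_conj_word]
      exact (word_mul_eq_mul_word hgG v).symm
    rw [MatrixStrategy.moment, ← hmom' _ _ (hword w), hg, Matrix.conjTranspose_mul]
    have h2 : gᴴ * S.Ψᴴ * word S.E w * (S.Ψ * g) * (word S.G v).map conj =
        gᴴ * (S.Ψᴴ * word S.E w * S.Ψ * word S.G v * g) := by
      simp only [Matrix.mul_assoc, h1]
    rw [h2, Matrix.trace_mul_comm, Matrix.mul_assoc _ g, hc, Matrix.mul_smul, Matrix.mul_one,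
      Matrix.trace_smul, smul_eq_mul]
  have hc1 : c = 1 := by
    have h1 := hkey [] []
    have h2 : S.moment [] [] = 1 := by simp [MatrixStrategy.moment, S.norm_Ψ]
    rw [h2, _root_.map_one, mul_one] at h1
    exact h1.symm
  rw [hkey, hc1, one_mul]

end UniqueMoments

/-! ### Intertwiners from equality of the real parts of moments -/

section RealIntertwiner

variable {γ H K : Type*} [NormedAddCommGroup H] [InnerProductSpace ℂ H]
  [NormedAddCommGroup K] [InnerProductSpace ℂ K]

theorem inner_prod_map_eq {a : γ → H →ₗ[ℂ] H}
    (ha : ∀ g u v, inner ℂ (a g u) v = inner ℂ u (a g v)) (x u : H) (w : List γ) :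
    inner ℂ ((w.map a).prod x) u = inner ℂ x ((w.reverse.map a).prod u) := by
  induction w generalizing u with
  | nil => rfl
  | cons g w ih =>
    rw [List.map_cons, List.prod_cons, Module.End.mul_apply, ha, ih, List.reverse_cons,
      List.map_append, List.prod_append, Module.End.mul_apply]
    simp

variable [FiniteDimensional ℂ H]

/-- The real version of uniqueness of the GNS construction: if two cyclic vectors have the same real
parts of moments, then a real-linear map intertwines the two families of operators and maps one
vector to the other. It is extended by zero from the real cyclic subspace. -/
theorem exists_real_intertwiner {a : γ → H →ₗ[ℂ] H} {b : γ → K →ₗ[ℂ] K}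
    (ha : ∀ g u v, inner ℂ (a g u) v = inner ℂ u (a g v))
    (hb : ∀ g u v, inner ℂ (b g u) v = inner ℂ u (b g v)) {x : H} {y : K}
    (h : ∀ w : List γ,
      (inner ℂ x ((w.map a).prod x)).re = (inner ℂ y ((w.map b).prod y)).re) :
    ∃ V : H →ₗ[ℝ] K, (∀ g u, V (a g u) = b g (V u)) ∧ V x = y ∧
      ∀ u, (∀ w : List γ, (inner ℂ ((w.map a).prod x) u).re = 0) → V u = 0 := by
  let _ := InnerProductSpace.rclikeToReal ℂ H
  let _ := InnerProductSpace.rclikeToReal ℂ K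
  let A : (List γ →₀ ℝ) →ₗ[ℝ] H := Finsupp.linearCombination ℝ fun w => (w.map a).prod x
  let B : (List γ →₀ ℝ) →ₗ[ℝ] K := Finsupp.linearCombination ℝ fun w => (w.map b).prod y
  have hA (w) (r : ℝ) : A (Finsupp.single w r) = r • (w.map a).prod x :=
    Finsupp.linearCombination_single ℝ r w
  have hB (w) (r : ℝ) : B (Finsupp.single w r) = r • (w.map b).prod y :=
    Finsupp.linearCombination_single ℝ r w
  have hAB (l l') : inner ℝ (A l) (A l') = inner ℝ (B l) (B l') := by
    induction l using Finsupp.induction_linear with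
    | zero => simp
    | add l₁ l₂ h₁ h₂ => rw [map_add, map_add, inner_add_left, inner_add_left, h₁, h₂]
    | single w r =>
      induction l' using Finsupp.induction_linear with
      | zero => simp
      | add l₁ l₂ h₁ h₂ => rw [map_add, map_add, inner_add_right, inner_add_right, h₁, h₂]
      | single w' r' =>
        rw [hA, hA, hB, hB, real_inner_smul_left, real_inner_smul_left, real_inner_smul_right,
          real_inner_smul_right, real_inner_eq_re_inner ℂ, real_inner_eq_re_inner ℂ,
          inner_prod_map_eq ha, inner_prod_map_eq hb, ← Module.End.mul_apply,
          ← Module.End.mul_apply, ← List.prod_append, ← List.prod_append, ← List.map_append,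
          ← List.map_append]
        congr 2
        exact h _
  have hker (l) (hl : A l = 0) : B l = 0 := by
    have h1 := hAB l l
    rw [hl, inner_zero_left] at h1
    exact inner_self_eq_zero.mp h1.symm
  have hcons (g) (l) : ∃ l', a g (A l) = A l' ∧ b g (B l) = B l' := by
    induction l using Finsupp.induction_linear with
    | zero => exact ⟨0, by simp, by simp⟩
    | add l₁ l₂ h₁ h₂ =>
      obtain ⟨l₁', h₁, h₁'⟩ := h₁
      obtain ⟨l₂', h₂, h₂'⟩ := h₂
      exact ⟨l₁' + l₂', by simp only [map_add, h₁, h₂], by simp only [map_add, h₁', h₂']⟩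
    | single w r =>
      refine ⟨Finsupp.single (g :: w) r, ?_, ?_⟩
      · rw [hA, hA, LinearMap.map_smul_of_tower]
        rfl
      · rw [hB, hB, LinearMap.map_smul_of_tower]
        rfl
  obtain ⟨s, hs⟩ := A.rangeRestrict.exists_rightInverse_of_surjective A.range_rangeRestrict
  have hBs (l) : B (s ⟨A l, l, rfl⟩) = B l := by
    rw [← sub_eq_zero, ← map_sub]
    refine hker _ ?_
    have h1 := congrArg Subtype.val (LinearMap.congr_fun hs ⟨A l, l, rfl⟩)
    rw [map_sub, sub_eq_zero]
    exact h1
  have hfin : FiniteDimensional ℝ H := FiniteDimensional.complexToReal H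
  let V : H →ₗ[ℝ] K := B ∘ₗ s ∘ₗ (LinearMap.range A).orthogonalProjectionOnto.toLinearMap
  have hVA (l) : V (A l) = B l := by
    rw [← hBs l]
    change B (s ((LinearMap.range A).orthogonalProjectionOnto (A l))) = _
    congr 2
    exact Submodule.orthogonalProjectionOnto_mem_subspace_eq_self (K := LinearMap.range A)
      ⟨A l, l, rfl⟩
  have hV0 (u) (hu : u ∈ (LinearMap.range A)ᗮ) : V u = 0 := by
    change B (s ((LinearMap.range A).orthogonalProjectionOnto u)) = _
    rw [Submodule.orthogonalProjectionOnto_apply_of_mem_orthogonal hu, map_zero,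
      map_zero]
  refine ⟨V, fun g u => ?_, ?_, fun u hu => hV0 u ?_⟩
  · obtain ⟨_, ⟨l, rfl⟩, u', hu', rfl⟩ := (LinearMap.range A).exists_add_mem_mem_orthogonal u
    obtain ⟨l', hl', hl''⟩ := hcons g l
    rw [map_add, map_add, map_add, hV0 u' hu', hl', hVA, hVA, add_zero, hl'', hV0, add_zero]
    rw [Submodule.mem_orthogonal] at hu' ⊢
    rintro _ ⟨l₁, rfl⟩
    obtain ⟨l₂, hl₂, -⟩ := hcons g l₁
    rw [real_inner_eq_re_inner ℂ, ← ha, ← real_inner_eq_re_inner ℂ, hl₂]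
    exact hu' _ ⟨l₂, rfl⟩
  · have h1 := hVA (Finsupp.single [] 1)
    rw [hA, hB, one_smul, one_smul] at h1
    exact h1
  · rw [Submodule.mem_orthogonal]
    rintro _ ⟨l, rfl⟩
    induction l using Finsupp.induction_linear with
    | zero => simp
    | add l₁ l₂ h₁ h₂ => rw [map_add, inner_add_left, h₁, h₂, add_zero]
    | single w r =>
      rw [hA, real_inner_smul_left, real_inner_eq_re_inner ℂ]
      exact (congrArg (r * ·) (hu w)).trans (mul_zero r)

/-- The complex-linear and the antilinear part of the real intertwiner. If the moments are real,
then multiples of the cyclic vector by imaginary numbers are orthogonal to the real cyclic subspace,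
and the two parts agree on the cyclic vector. -/
theorem exists_linear_antilinear_intertwiners {a : γ → H →ₗ[ℂ] H} {b : γ → K →ₗ[ℂ] K}
    (ha : ∀ g u v, inner ℂ (a g u) v = inner ℂ u (a g v))
    (hb : ∀ g u v, inner ℂ (b g u) v = inner ℂ u (b g v)) {x : H} {y : K}
    (h : ∀ w : List γ,
      (inner ℂ x ((w.map a).prod x)).re = (inner ℂ y ((w.map b).prod y)).re) :
    ∃ (V₀ : H →ₗ[ℂ] K) (V₁ : H →ₗ⋆[ℂ] K), (∀ g u, V₀ (a g u) = b g (V₀ u)) ∧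
      (∀ g u, V₁ (a g u) = b g (V₁ u)) ∧ V₀ x + V₁ x = y ∧
      ((∀ w : List γ, (inner ℂ x ((w.map a).prod x)).im = 0) → V₁ x = V₀ x) := by
  obtain ⟨V, hV, hVx, hV0⟩ := exists_real_intertwiner ha hb h
  have hVsmul (c : ℂ) (u : H) : V (c • u) = (c.re : ℂ) • V u + (c.im : ℂ) • V (Complex.I • u) := by
    conv_lhs => rw [← Complex.re_add_im c, add_smul, mul_smul, map_add]
    rw [Complex.coe_smul, Complex.coe_smul, map_smul, map_smul, Complex.coe_smul, Complex.coe_smul]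
  have hVII (u : H) : V (Complex.I • Complex.I • u) = -V u := by
    rw [smul_smul, Complex.I_mul_I, neg_one_smul, map_neg]
  have hVI (c : ℂ) (u : H) : V (Complex.I • c • u) =
      (c.re : ℂ) • V (Complex.I • u) - (c.im : ℂ) • V u := by
    rw [smul_comm, hVsmul, hVII, smul_neg, sub_eq_add_neg]
  let V₀ : H →ₗ[ℂ] K :=
    { toFun := fun u => (1 / 2 : ℂ) • (V u - Complex.I • V (Complex.I • u))
      map_add' := fun u v => by
        simp only [smul_add, map_add]
        module
      map_smul' := fun c u => by
        rw [hVsmul, hVI, RingHom.id_apply]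
        conv_rhs => rw [← Complex.re_add_im c]
        have hI := Complex.I_mul_I
        match_scalars
        · ring
        · linear_combination (c.im / 2) * hI }
  let V₁ : H →ₗ⋆[ℂ] K :=
    { toFun := fun u => (1 / 2 : ℂ) • (V u + Complex.I • V (Complex.I • u))
      map_add' := fun u v => by
        simp only [smul_add, map_add]
        module
      map_smul' := fun c u => by
        have hc : conj c = c.re - c.im * Complex.I := by
          apply Complex.ext <;> simp
        rw [hVsmul, hVI, hc]
        have hI := Complex.I_mul_I
        match_scalars
        · ring
        · linear_combination (c.im / 2) * hI }
  refine ⟨V₀, V₁, fun g u => ?_, fun g u => ?_, ?_, fun him => ?_⟩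
  · change (1 / 2 : ℂ) • (V (a g u) - Complex.I • V (Complex.I • a g u)) =
      b g ((1 / 2 : ℂ) • (V u - Complex.I • V (Complex.I • u)))
    rw [← (a g).map_smul, hV, hV, (b g).map_smul, map_sub, (b g).map_smul]
  · change (1 / 2 : ℂ) • (V (a g u) + Complex.I • V (Complex.I • a g u)) =
      b g ((1 / 2 : ℂ) • (V u + Complex.I • V (Complex.I • u)))
    rw [← (a g).map_smul, hV, hV, (b g).map_smul, map_add, (b g).map_smul]
  · change (1 / 2 : ℂ) • (V x - Complex.I • V (Complex.I • x)) +
      (1 / 2 : ℂ) • (V x + Complex.I • V (Complex.I • x)) = y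
    rw [← hVx]
    module
  · have h1 : V (Complex.I • x) = 0 := by
      refine hV0 _ fun w => ?_
      have h2 := him w.reverse
      rw [inner_smul_right, inner_prod_map_eq ha, Complex.I_mul_re, h2, neg_zero]
    change (1 / 2 : ℂ) • (V x + Complex.I • V (Complex.I • x)) =
      (1 / 2 : ℂ) • (V x - Complex.I • V (Complex.I • x))
    rw [h1, smul_zero, sub_zero, add_zero]

end RealIntertwiner

/-! ### Orthonormal bases of intertwiners and Schur's lemma -/

section MatrixIntertwiner

variable {IA OA IB OB : Type*} [Fintype OA] [Fintype OB] {α β α' β' : Type*}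
  [Fintype α] [Fintype β] [DecidableEq α] [DecidableEq β]
  [Fintype α'] [Fintype β'] [DecidableEq α'] [DecidableEq β']

/-- The Hilbert-Schmidt inner product. -/
@[reducible]
def hilbertSchmidtCore (α β : Type*) [Fintype α] [Fintype β] :
    InnerProductSpace.Core ℂ (Matrix α β ℂ) where
  inner X Y := (Xᴴ * Y).trace
  conj_inner_symm X Y := by
    rw [starRingEnd_apply, ← Matrix.trace_conjTranspose, Matrix.conjTranspose_mul,
      Matrix.conjTranspose_conjTranspose]
  re_inner_nonneg X := by
    have h : (Xᴴ * X).trace = _ := trace_conjTranspose_mul_self_eq_sum fun i : α × β => X i.1 i.2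
    rw [h, RCLike.re_to_complex, Complex.ofReal_re]
    exact Finset.sum_nonneg fun i _ => by positivity
  add_left X Y Z := by rw [Matrix.conjTranspose_add, Matrix.add_mul, Matrix.trace_add]
  smul_left X Y c := by
    rw [Matrix.conjTranspose_smul, Matrix.smul_mul, Matrix.trace_smul, smul_eq_mul]
    rfl
  definite X h := Matrix.trace_conjTranspose_mul_self_eq_zero_iff.mp h

/-- The measurement operators of both parties, as operators on the space of coefficient matrices. -/
def MatrixStrategy.localOperator (S : MatrixStrategy IA OA IB OB α β) :
    (IA × OA) ⊕ (IB × OB) → Matrix α β ℂ →ₗ[ℂ] Matrix α β ℂ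
  | .inl i =>
    { toFun := fun M => S.E i.1 i.2 * M
      map_add' := fun M N => Matrix.mul_add _ M N
      map_smul' := fun c M => Matrix.mul_smul _ c M }
  | .inr j =>
    { toFun := fun M => M * S.G j.1 j.2
      map_add' := fun M N => Matrix.add_mul M N _
      map_smul' := fun c M => Matrix.smul_mul c M _ }

theorem MatrixStrategy.prod_localOperator (S : MatrixStrategy IA OA IB OB α β)
    (w : List ((IA × OA) ⊕ (IB × OB))) (M : Matrix α β ℂ) :
    (w.map S.localOperator).prod M =
      word S.E (w.filterMap Sum.getLeft?) * M *
        word S.G (w.filterMap Sum.getRight?).reverse := by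
  induction w with
  | nil => simp
  | cons g w ih =>
    rw [List.map_cons, List.prod_cons, Module.End.mul_apply, ih]
    cases g with
    | inl i => simp [localOperator, Matrix.mul_assoc, List.filterMap_cons]
    | inr j => simp [localOperator, Matrix.mul_assoc, word_append, List.filterMap_cons]

theorem MatrixStrategy.trace_localOperator (S : MatrixStrategy IA OA IB OB α β)
    (g : (IA × OA) ⊕ (IB × OB)) (X Y : Matrix α β ℂ) :
    ((S.localOperator g X)ᴴ * Y).trace = (Xᴴ * S.localOperator g Y).trace := by
  cases g with
  | inl i => simp [localOperator, S.E_star, Matrix.mul_assoc]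
  | inr j =>
    simp only [localOperator, LinearMap.coe_mk, AddHom.coe_mk, Matrix.conjTranspose_mul, S.G_star]
    rw [Matrix.mul_assoc, Matrix.trace_mul_comm, Matrix.mul_assoc]

theorem MatrixStrategy.trace_prod_localOperator (S : MatrixStrategy IA OA IB OB α β)
    (w : List ((IA × OA) ⊕ (IB × OB))) :
    (S.Ψᴴ * (w.map S.localOperator).prod S.Ψ).trace =
      S.moment (w.filterMap Sum.getLeft?) (w.filterMap Sum.getRight?).reverse := by
  rw [prod_localOperator, moment]
  simp only [Matrix.mul_assoc]

/-- Two strategies with the same real parts of moments are related by a linear and an antilinear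
intertwiner; they contribute equally if the moments are real. -/
theorem MatrixStrategy.exists_intertwiners {S : MatrixStrategy IA OA IB OB α β}
    {T : MatrixStrategy IA OA IB OB α' β'} (h : ∀ w v, (T.moment w v).re = (S.moment w v).re) :
    ∃ (V₀ : Matrix α' β' ℂ →ₗ[ℂ] Matrix α β ℂ) (V₁ : Matrix α' β' ℂ →ₗ⋆[ℂ] Matrix α β ℂ),
      (∀ x a M, V₀ (T.E x a * M) = S.E x a * V₀ M) ∧
      (∀ y b M, V₀ (M * T.G y b) = V₀ M * S.G y b) ∧
      (∀ x a M, V₁ (T.E x a * M) = S.E x a * V₁ M) ∧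
      (∀ y b M, V₁ (M * T.G y b) = V₁ M * S.G y b) ∧
      V₀ T.Ψ + V₁ T.Ψ = S.Ψ ∧ ((∀ w v, (T.moment w v).im = 0) → V₁ T.Ψ = V₀ T.Ψ) := by
  let _ : NormedAddCommGroup (Matrix α β ℂ) := (hilbertSchmidtCore α β).toNormedAddCommGroup
  let _ : InnerProductSpace ℂ (Matrix α β ℂ) := .ofCore (hilbertSchmidtCore α β).toCore
  let _ : NormedAddCommGroup (Matrix α' β' ℂ) := (hilbertSchmidtCore α' β').toNormedAddCommGroup
  let _ : InnerProductSpace ℂ (Matrix α' β' ℂ) := .ofCore (hilbertSchmidtCore α' β').toCore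
  obtain ⟨V₀, V₁, h₀, h₁, hsum, him⟩ := exists_linear_antilinear_intertwiners
    (a := T.localOperator) (b := S.localOperator) (x := T.Ψ) (y := S.Ψ)
    T.trace_localOperator S.trace_localOperator
    fun w => (congrArg Complex.re (T.trace_prod_localOperator w)).trans
      ((h _ _).trans (congrArg Complex.re (S.trace_prod_localOperator w)).symm)
  exact ⟨V₀, V₁, fun x a M => h₀ (.inl (x, a)) M, fun y b M => h₀ (.inr (y, b)) M,
    fun x a M => h₁ (.inl (x, a)) M, fun y b M => h₁ (.inr (y, b)) M, hsum,
    fun hre => him fun w => (congrArg Complex.im (T.trace_prod_localOperator w)).trans (hre _ _)⟩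

end MatrixIntertwiner

section Schur

variable {I O α δ κ : Type*} [Fintype α] [Fintype δ] [DecidableEq δ]
  [Fintype κ] [DecidableEq κ]

/-- The matrices `X i` are isometries with pairwise orthogonal ranges and form a basis of the space
of intertwiners from the family `D` to the family `E`. -/
structure IsIntertwinerBasis (E : I → O → Matrix α α ℂ) (D : I → O → Matrix δ δ ℂ)
    (X : κ → Matrix α δ ℂ) : Prop where
  intertwines : ∀ i x a, E x a * X i = X i * D x a
  orthonormal : ∀ i j, (X i)ᴴ * X j = if i = j then 1 else 0
  exists_eq_sum : ∀ Z : Matrix α δ ℂ, (∀ x a, E x a * Z = Z * D x a) →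
    ∃ c : κ → ℂ, Z = ∑ i, c i • X i

theorem exists_isIntertwinerBasis [Nonempty δ] {E : I → O → Matrix α α ℂ}
    {D : I → O → Matrix δ δ ℂ} (hE : ∀ x a, (E x a)ᴴ = E x a) (hD : ∀ x a, (D x a)ᴴ = D x a)
    (hirr : IsIrreducibleFamily D) :
    ∃ (k : ℕ) (X : Fin k → Matrix α δ ℂ), IsIntertwinerBasis E D X := by
  let _ : NormedAddCommGroup (Matrix α δ ℂ) := (hilbertSchmidtCore α δ).toNormedAddCommGroup
  let _ : InnerProductSpace ℂ (Matrix α δ ℂ) := .ofCore (hilbertSchmidtCore α δ).toCore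
  let 𝓗 : Submodule ℂ (Matrix α δ ℂ) :=
    { carrier := {Z | ∀ x a, E x a * Z = Z * D x a}
      add_mem' := fun {Z Z'} hZ hZ' x a => by rw [Matrix.mul_add, Matrix.add_mul, hZ, hZ']
      zero_mem' := fun x a => by rw [Matrix.mul_zero, Matrix.zero_mul]
      smul_mem' := fun c Z hZ x a => by rw [Matrix.mul_smul, Matrix.smul_mul, hZ] }
  have hmem (Z) : Z ∈ 𝓗 ↔ ∀ x a, E x a * Z = Z * D x a := Iff.rfl
  let b := stdOrthonormalBasis ℂ 𝓗
  have hb (i j) : ((b i : Matrix α δ ℂ)ᴴ * (b j : Matrix α δ ℂ)).trace = if i = j then 1 else 0 :=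
    b.inner_eq_ite i j
  have hcard : (0 : ℝ) < Fintype.card δ := by exact_mod_cast Fintype.card_pos
  have hcardC : ((Fintype.card δ : ℝ) : ℂ) ≠ 0 := by exact_mod_cast hcard.ne'
  have hs : ((√(Fintype.card δ) : ℝ) : ℂ) * ((√(Fintype.card δ) : ℝ) : ℂ) =
      ((Fintype.card δ : ℝ) : ℂ) := by
    rw [← Complex.ofReal_mul, Real.mul_self_sqrt hcard.le]
  have hs0 : ((√(Fintype.card δ) : ℝ) : ℂ) ≠ 0 := fun h => hcardC (by rw [← hs, h, mul_zero])
  refine ⟨_, fun i => ((√(Fintype.card δ) : ℝ) : ℂ) • (b i : Matrix α δ ℂ), ?_, ?_, ?_⟩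
  · intro i x a
    rw [Matrix.mul_smul, Matrix.smul_mul, (hmem _).mp (b i).2]
  · intro i j
    -- by irreducibility `(b i)ᴴ * b j` is a scalar, determined by its trace
    obtain ⟨c, hc⟩ := hirr ((b i : Matrix α δ ℂ)ᴴ * (b j : Matrix α δ ℂ)) fun x a => by
      have h1 := congrArg Matrix.conjTranspose ((hmem _).mp (b i).2 x a)
      rw [Matrix.conjTranspose_mul, Matrix.conjTranspose_mul, hE, hD] at h1
      rw [← Matrix.mul_assoc, ← h1, Matrix.mul_assoc, (hmem _).mp (b j).2, Matrix.mul_assoc]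
    have h2 := hb i j
    rw [hc, Matrix.trace_smul, Matrix.trace_one, smul_eq_mul] at h2
    rw [Matrix.conjTranspose_smul, Matrix.smul_mul, Matrix.mul_smul, smul_smul, RCLike.star_def,
      Complex.conj_ofReal, hs, hc, smul_smul, mul_comm, Complex.ofReal_natCast, h2]
    split_ifs
    · rw [one_smul]
    · rw [zero_smul]
  · intro Z hZ
    refine ⟨fun i => inner ℂ (b i) ⟨Z, hZ⟩ * ((√(Fintype.card δ) : ℝ) : ℂ)⁻¹, ?_⟩
    have h := congrArg Subtype.val (b.sum_repr' ⟨Z, hZ⟩)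
    rw [AddSubmonoidClass.coe_finsetSum] at h
    refine h.symm.trans (Finset.sum_congr rfl fun i _ => ?_)
    rw [smul_smul, mul_assoc, inv_mul_cancel₀ hs0, mul_one]
    rfl

variable {J Q β ε l : Type*} [Fintype β] [Fintype ε] [DecidableEq ε]
  [Fintype l] [DecidableEq l]

/-- Schur's lemma for linear maps intertwining the left and right actions of two families. -/
theorem exists_eq_sum_of_intertwines [Nonempty δ] {E : I → O → Matrix α α ℂ}
    {D : I → O → Matrix δ δ ℂ} {G : J → Q → Matrix β β ℂ} {D' : J → Q → Matrix ε ε ℂ}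
    (hG : ∀ y b, (G y b)ᴴ = G y b) (hD' : ∀ y b, (D' y b)ᴴ = D' y b)
    {X : κ → Matrix α δ ℂ} {Y : l → Matrix β ε ℂ} (hX : IsIntertwinerBasis E D X)
    (hY : IsIntertwinerBasis G D' Y) {V : Matrix δ ε ℂ →ₗ[ℂ] Matrix α β ℂ}
    (hVE : ∀ x a M, V (D x a * M) = E x a * V M) (hVG : ∀ y b M, V (M * D' y b) = V M * G y b) :
    ∃ c : κ → l → ℂ, ∀ M, V M = ∑ i, ∑ j, c i j • (X i * M * (Y j)ᴴ) := by
  -- for fixed outer indices, the entries of `V` at the matrix units form an intertwiner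
  have hZ (ν : ε) (b : β) : ∃ c : κ → ℂ,
      (Matrix.of fun a μ => V (Matrix.single μ ν 1) a b) = ∑ i, c i • X i := by
    refine hX.exists_eq_sum _ fun x a => ?_
    ext i μ
    have h1 : D x a * Matrix.single μ ν (1 : ℂ) =
        ∑ μ', D x a μ' μ • Matrix.single μ' ν (1 : ℂ) := by
      ext s t
      simp [Matrix.mul_apply, Matrix.sum_apply, Matrix.single_apply, ite_and]
    have h2 := congrFun (congrFun (hVE x a (Matrix.single μ ν 1)) i) b
    rw [h1, map_sum] at h2
    simp only [map_smul, Matrix.sum_apply, Matrix.smul_apply, smul_eq_mul] at h2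
    rw [Matrix.mul_apply] at h2 ⊢
    rw [Matrix.mul_apply]
    simp only [Matrix.of_apply]
    rw [← h2]
    exact Finset.sum_congr rfl fun μ' _ => mul_comm _ _
  choose c hc using hZ
  have hV (M) : V M = ∑ i, X i * M * Matrix.of fun ν b => c ν b i := by
    induction M using Matrix.induction_on' with
    | h_zero => simp
    | h_add M N hM hN =>
      rw [map_add, hM, hN, ← Finset.sum_add_distrib]
      exact Finset.sum_congr rfl fun i _ => by rw [Matrix.mul_add, Matrix.add_mul]
    | h_std_basis μ ν r =>
      have h1 : Matrix.single μ ν r = r • Matrix.single μ ν (1 : ℂ) := by simp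
      rw [h1, map_smul]
      ext a b
      have h2 := congrFun (congrFun (hc ν b) a) μ
      rw [Matrix.of_apply] at h2
      rw [Matrix.smul_apply, h2]
      simp [Matrix.sum_apply, Matrix.mul_apply, Matrix.single_apply, ite_and, Finset.mul_sum,
        mul_comm, mul_left_comm]
  have hcoef (i : κ) (M) : (X i)ᴴ * V M = M * Matrix.of fun ν b => c ν b i := by
    rw [hV, Matrix.mul_sum, Finset.sum_eq_single i]
    · rw [Matrix.mul_assoc (X i), ← Matrix.mul_assoc, hX.orthonormal, if_pos rfl, Matrix.one_mul]
    · intro j _ hj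
      rw [Matrix.mul_assoc (X j), ← Matrix.mul_assoc, hX.orthonormal, if_neg hj.symm,
        Matrix.zero_mul]
    · simp
  have hint (i : κ) (y b) : D' y b * (Matrix.of fun ν b => c ν b i : Matrix ε β ℂ) =
      (Matrix.of fun ν b => c ν b i : Matrix ε β ℂ) * G y b := by
    obtain ⟨μ⟩ := ‹Nonempty δ›
    ext ν t
    have h1 : Matrix.single μ ν (1 : ℂ) * (D' y b * Matrix.of fun ν b => c ν b i) =
        Matrix.single μ ν (1 : ℂ) * ((Matrix.of fun ν b => c ν b i : Matrix ε β ℂ) * G y b) := by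
      rw [← Matrix.mul_assoc, ← hcoef, hVG, ← Matrix.mul_assoc, hcoef, Matrix.mul_assoc]
    have h2 := congrFun (congrFun h1 μ) t
    rwa [Matrix.single_mul_apply_same, Matrix.single_mul_apply_same, one_mul, one_mul] at h2
  have hexp (i : κ) : ∃ d : l → ℂ, (Matrix.of fun ν b => c ν b i : Matrix ε β ℂ)ᴴ =
      ∑ j, d j • Y j := by
    refine hY.exists_eq_sum _ fun y b => ?_
    have h1 := congrArg Matrix.conjTranspose (hint i y b)
    rw [Matrix.conjTranspose_mul, Matrix.conjTranspose_mul, hG, hD'] at h1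
    exact h1.symm
  choose d hd using hexp
  refine ⟨fun i j => conj (d i j), fun M => ?_⟩
  rw [hV]
  refine Finset.sum_congr rfl fun i _ => ?_
  have h1 := congrArg Matrix.conjTranspose (hd i)
  rw [Matrix.conjTranspose_conjTranspose, Matrix.conjTranspose_sum] at h1
  rw [h1, Matrix.mul_sum]
  refine Finset.sum_congr rfl fun j _ => ?_
  rw [Matrix.conjTranspose_smul, Matrix.mul_smul]
  rfl

end Schur

/-! ### Construction of the local dilation -/

section Dilation

variable {α β δ κ l : Type*} [Fintype α] [DecidableEq α] [Fintype δ] [DecidableEq δ]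
  [Fintype κ] [DecidableEq κ]

/-- Isometries `Z i` with pairwise orthogonal ranges are extended to a single isometry, which sends
the range of `Z i` to the block with index `ι i` and tag `ε i`. The complement of the ranges is sent
to additional blocks. -/
theorem exists_isometry_of_orthonormal [Nonempty δ] {Z : κ → Matrix α δ ℂ} (ε : κ → Fin 2)
    (hZ : ∀ i j, (Z i)ᴴ * Z j = if i = j then 1 else 0) :
    ∃ (k : ℕ) (ι : κ → Fin k) (U : Matrix (δ × Fin k × Fin 2) α ℂ), Uᴴ * U = 1 ∧
      ∀ i, U * Z i = Matrix.of fun d d' => if d = (d', ι i, ε i) then 1 else 0 := by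
  obtain ⟨d₀⟩ := ‹Nonempty δ›
  set P : Matrix α α ℂ := ∑ i, Z i * (Z i)ᴴ with hP
  have hPZ (i) : P * Z i = Z i := by
    rw [hP, Matrix.sum_mul, Finset.sum_eq_single i]
    · rw [Matrix.mul_assoc, hZ, if_pos rfl, Matrix.mul_one]
    · intro j _ hj
      rw [Matrix.mul_assoc, hZ, if_neg hj, Matrix.mul_zero]
    · simp
  have hPP : P * P = P := by
    conv_lhs => enter [2]; rw [hP]
    rw [Matrix.mul_sum, hP]
    exact Finset.sum_congr rfl fun i _ => by rw [← hP, ← Matrix.mul_assoc, hPZ]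
  have hPh : Pᴴ = P := by
    rw [hP, Matrix.conjTranspose_sum]
    exact Finset.sum_congr rfl fun i _ => by simp
  have hQQ : (1 - P)ᴴ * (1 - P) = 1 - P := by
    rw [Matrix.conjTranspose_sub, hPh, Matrix.conjTranspose_one, Matrix.mul_sub, Matrix.sub_mul,
      Matrix.sub_mul, hPP]
    simp
  have hQZ (i) : (1 - P) * Z i = 0 := by rw [Matrix.sub_mul, hPZ, Matrix.one_mul, sub_self]
  generalize hQ : 1 - P = Q at hQQ hQZ
  let e := Fintype.equivFin (κ ⊕ α)
  let U' : δ → κ ⊕ α → Fin 2 → α → ℂ := fun d s f a =>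
    Sum.elim (fun i => if f = ε i then (Z i)ᴴ d a else 0)
      (fun μ => if f = 0 then if d = d₀ then Q μ a else 0 else 0) s
  let U : Matrix (δ × Fin (Fintype.card (κ ⊕ α)) × Fin 2) α ℂ :=
    Matrix.of fun d a => U' d.1 (e.symm d.2.1) d.2.2 a
  refine ⟨_, fun i => e (.inl i), U, ?_, fun i => ?_⟩
  · have h1 : ∑ i, Z i * (Z i)ᴴ + Qᴴ * Q = 1 := by
      rw [hQQ, ← hP, ← hQ, add_sub_cancel]
    rw [← h1]
    ext a a'
    have h2 : (Uᴴ * U) a a' = ∑ s : κ ⊕ α, ∑ d, ∑ f, conj (U' d s f a) * U' d s f a' := by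
      rw [Matrix.mul_apply, Fintype.sum_prod_type]
      simp only [Fintype.sum_prod_type]
      rw [Finset.sum_comm]
      exact Equiv.sum_comp e.symm fun s => ∑ d, ∑ f, conj (U' d s f a) * U' d s f a'
    rw [h2, Fintype.sum_sum_type, Matrix.add_apply, Matrix.sum_apply]
    congr 1
    · refine Finset.sum_congr rfl fun i _ => ?_
      simp [U', Matrix.mul_apply]
    · simp [U', Matrix.mul_apply]
  · ext ⟨d, s, f⟩ d'
    obtain ⟨s, rfl⟩ := e.surjective s
    rw [Matrix.mul_apply]
    cases s with
    | inl j =>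
      by_cases hf : f = ε j
      · have h1 := congrFun (congrFun (hZ j i) d) d'
        rw [Matrix.mul_apply] at h1
        simp only [U, U', Matrix.of_apply, Equiv.symm_apply_apply, Sum.elim_inl, hf, if_true, h1,
          Prod.mk.injEq, EmbeddingLike.apply_eq_iff_eq, Sum.inl.injEq]
        by_cases hj : j = i <;> simp [hj, Matrix.one_apply]
      · have h1 : ¬ ((d, e (Sum.inl j), f) = (d', e (Sum.inl i), ε i)) := by
          rintro h
          simp only [Prod.mk.injEq, EmbeddingLike.apply_eq_iff_eq, Sum.inl.injEq] at h
          exact hf (by rw [h.2.1, h.2.2])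
        simp [U, U', hf, h1]
    | inr μ =>
      have h1 := congrFun (congrFun (hQZ i) μ) d'
      rw [Matrix.mul_apply] at h1
      by_cases hd : f = 0 ∧ d = d₀
      · simpa [U, U', hd.1, hd.2] using h1
      · have h2 (a : α) : U' d (Sum.inr μ) f a = 0 := by
          simp only [U', Sum.elim_inr]
          rw [← ite_and, if_neg hd]
        simp [U, h2]

/-- The complex conjugate of a matrix for the tag `1`, the matrix itself for the tag `0`. -/
def conjIf {m n : Type*} (e : Fin 2) (M : Matrix m n ℂ) : Matrix m n ℂ :=
  if e = 0 then M else M.map conj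

theorem conjIf_zero {m n : Type*} (M : Matrix m n ℂ) : conjIf 0 M = M := rfl

theorem conjIf_one {m n : Type*} (M : Matrix m n ℂ) : conjIf 1 M = M.map conj := rfl

theorem conjIf_mul {m n r : Type*} [Fintype n] (e : Fin 2) (M : Matrix m n ℂ) (N : Matrix n r ℂ) :
    conjIf e M * conjIf e N = conjIf e (M * N) := by
  fin_cases e
  · rfl
  · exact Matrix.map_mul.symm

theorem conjTranspose_conjIf {m n : Type*} (e : Fin 2) (M : Matrix m n ℂ) :
    (conjIf e M)ᴴ = conjIf e Mᴴ := by
  fin_cases e <;> rfl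

theorem dilate_sum {m n r s ι : Type*} (t : Finset ι) (V₀ V₁ : Matrix m n ℂ)
    (A₀ A₁ : ι → Matrix r s ℂ) :
    dilate V₀ V₁ (∑ i ∈ t, A₀ i) (∑ i ∈ t, A₁ i) = ∑ i ∈ t, dilate V₀ V₁ (A₀ i) (A₁ i) := by
  ext i j
  simp [dilate, Matrix.sum_apply, Finset.sum_add_distrib, Finset.sum_mul, Finset.mul_sum]

/-- A state that is a combination of the vectors `ψ` and `conj ψ`, transported by local
isometries with pairwise orthogonal ranges, is a complex local dilation. -/
theorem isComplexLocalDilation_of_eq_sum {IA OA IB OB : Type*} [Fintype OA] [Fintype OB]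
    {m n m' n' : ℕ} {S : Strategy IA OA IB OB m n} {T : Strategy IA OA IB OB m' n'}
    {κ l : Type*} [Fintype κ] [DecidableEq κ] [Fintype l] [DecidableEq l] {ε : κ → Fin 2}
    {ε' : l → Fin 2} {Z : κ → Matrix (Fin m) (Fin m') ℂ} {Y : l → Matrix (Fin n) (Fin n') ℂ}
    {c : κ → l → ℂ} (hZ : ∀ i j, (Z i)ᴴ * Z j = if i = j then 1 else 0)
    (hY : ∀ i j, (Y i)ᴴ * Y j = if i = j then 1 else 0)
    (hZE : ∀ i x a, S.E x a * Z i = Z i * conjIf (ε i) (T.E x a))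
    (hYG : ∀ j y b, S.toMatrixStrategy.G y b * Y j =
      Y j * conjIf (ε' j) (T.toMatrixStrategy.G y b))
    (hc : ∀ i j, ε i ≠ ε' j → c i j = 0)
    (hΨ : S.toMatrixStrategy.Ψ =
      ∑ i, ∑ j, c i j • (Z i * conjIf (ε i) T.toMatrixStrategy.Ψ * (Y j)ᴴ)) :
    IsComplexLocalDilation S T := by
  have : Nonempty (Fin m') := T.toMatrixStrategy.nonempty_left
  have : Nonempty (Fin n') := T.toMatrixStrategy.swap.nonempty_left
  obtain ⟨k, ι, U, hU, hUZ⟩ := exists_isometry_of_orthonormal ε hZ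
  obtain ⟨k', ι', V, hV, hVY⟩ := exists_isometry_of_orthonormal ε' hY
  let A (e : Fin 2) : Matrix (Fin k) (Fin k') ℂ :=
    ∑ i, ∑ j, if ε i = e ∧ ε' j = e then c i j • Matrix.single (ι i) (ι' j) 1 else 0
  have hkey (N : Matrix (Fin m') (Fin n') ℂ) :
      U * (∑ i, ∑ j, c i j • (Z i * conjIf (ε i) N * (Y j)ᴴ)) * Vᴴ =
        dilate N (N.map conj) (A 0) (A 1) := by
    simp only [A, dilate_sum, Matrix.mul_sum, Matrix.sum_mul]
    refine Finset.sum_congr rfl fun i _ => Finset.sum_congr rfl fun j _ => ?_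
    by_cases hij : ε i = ε' j
    · have h1 : U * (c i j • (Z i * conjIf (ε i) N * (Y j)ᴴ)) * Vᴴ =
          c i j • ((U * Z i) * conjIf (ε i) N * (V * Y j)ᴴ) := by
        simp only [Matrix.mul_smul, Matrix.smul_mul, Matrix.conjTranspose_mul, Matrix.mul_assoc]
      have h2 (M : Matrix (Fin m') (Fin n') ℂ) : (U * Z i) * M * (V * Y j)ᴴ =
          M ⊗ₖ (Matrix.single (ι i) (ι' j) 1 ⊗ₖ Matrix.single (ε i) (ε i) 1) := by
        rw [hUZ, hVY]
        ext ⟨d, s, f⟩ ⟨d', s', f'⟩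
        rw [← hij]
        simp only [Matrix.mul_apply, Matrix.of_apply, Matrix.conjTranspose_apply,
          Matrix.kroneckerMap_apply, Matrix.single_apply, Prod.mk.injEq]
        by_cases hs : s = ι i ∧ f = ε i
        · by_cases hs' : s' = ι' j ∧ f' = ε i
          · simp [hs.1, hs.2, hs'.1, hs'.2]
          · have h3 : ¬ (ι' j = s' ∧ ε i = f') := fun h => hs' ⟨h.1.symm, h.2.symm⟩
            have h4 (z : Fin n') : ¬ (d' = z ∧ s' = ι' j ∧ f' = ε i) := fun h => hs' h.2
            simp only [if_neg (h4 _), star_zero, mul_zero, Finset.sum_const_zero]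
            by_cases h5 : ι' j = s'
            · have h6 : ¬ (ε i = f') := fun h => h3 ⟨h5, h⟩
              simp [h6]
            · simp [h5]
        · have h4 (z : Fin m') : ¬ (d = z ∧ s = ι i ∧ f = ε i) := fun h => hs h.2
          simp only [if_neg (h4 _), zero_mul, Finset.sum_const_zero]
          by_cases h5 : ι i = s
          · have h6 : ¬ (ε i = f) := fun h => hs ⟨h5.symm, h.symm⟩
            simp [h6]
          · simp [h5]
      rw [h1, h2, ← hij]
      generalize ε i = e
      fin_cases e <;> 
        simp [dilate, conjIf, Matrix.smul_kronecker, Matrix.kronecker_smul, -Matrix.smul_single]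
    · have h1 (e : Fin 2) : ¬ (ε i = e ∧ ε' j = e) := fun h => hij (h.1.trans h.2.symm)
      rw [if_neg (h1 0), if_neg (h1 1), hc i j hij]
      simp [dilate]
  have hE (x a) : S.E x a * S.toMatrixStrategy.Ψ =
      ∑ i, ∑ j, c i j • (Z i * conjIf (ε i) (T.E x a * T.toMatrixStrategy.Ψ) * (Y j)ᴴ) := by
    rw [hΨ]
    simp only [Matrix.mul_sum, Matrix.mul_smul]
    refine Finset.sum_congr rfl fun i _ => Finset.sum_congr rfl fun j _ => ?_
    rw [← conjIf_mul, ← Matrix.mul_assoc, ← Matrix.mul_assoc, hZE, Matrix.mul_assoc (Z i)]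
  have hG (y b) : S.toMatrixStrategy.Ψ * S.toMatrixStrategy.G y b =
      ∑ i, ∑ j, c i j •
        (Z i * conjIf (ε i) (T.toMatrixStrategy.Ψ * T.toMatrixStrategy.G y b) * (Y j)ᴴ) := by
    rw [hΨ]
    simp only [Matrix.sum_mul, Matrix.smul_mul]
    refine Finset.sum_congr rfl fun i _ => Finset.sum_congr rfl fun j _ => ?_
    by_cases hij : ε i = ε' j
    · have h1 := congrArg Matrix.conjTranspose (hYG j y b)
      rw [Matrix.conjTranspose_mul, Matrix.conjTranspose_mul, MatrixStrategy.G_star,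
        conjTranspose_conjIf, MatrixStrategy.G_star, ← hij] at h1
      rw [Matrix.mul_assoc _ (Y j)ᴴ, h1, ← conjIf_mul]
      simp only [Matrix.mul_assoc]
    · rw [hc i j hij, zero_smul, zero_smul]
  have hΦ : U * S.toMatrixStrategy.Ψ * Vᴴ =
      dilate T.toMatrixStrategy.Ψ (T.toMatrixStrategy.Ψ.map conj) (A 0) (A 1) := by
    rw [hΨ]
    exact hkey _
  have hA (e : Fin 2) : ((A e)ᴴ * A e).trace =
      ((∑ i : Fin k × Fin k', ‖A e i.1 i.2‖ ^ 2 : ℝ) : ℂ) :=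
    trace_conjTranspose_mul_self_eq_sum fun i => A e i.1 i.2
  refine ⟨k, k', U, V.map conj, fun i => A 0 i.1 i.2, fun i => A 1 i.1 i.2, hU, ?_, ?_, ?_, ?_, ?_⟩
  · have h1 := congrArg (fun M => M.map conj) hV
    simp only [Matrix.map_mul] at h1
    exact h1.trans (Matrix.map_one _ (by simp) (by simp))
  · -- both sides of the identity for the state have the same norm
    have h1 : ((U * S.toMatrixStrategy.Ψ * Vᴴ)ᴴ * (U * S.toMatrixStrategy.Ψ * Vᴴ)).trace = 1 := by
      rw [← S.toMatrixStrategy.norm_Ψ]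
      calc _ = (V * (S.toMatrixStrategy.Ψᴴ * (Uᴴ * U) * S.toMatrixStrategy.Ψ * Vᴴ)).trace := by
            simp only [Matrix.conjTranspose_mul, Matrix.conjTranspose_conjTranspose,
              Matrix.mul_assoc]
        _ = (S.toMatrixStrategy.Ψᴴ * (Uᴴ * U) * S.toMatrixStrategy.Ψ * (Vᴴ * V)).trace := by
            rw [Matrix.trace_mul_comm, Matrix.mul_assoc _ Vᴴ]
        _ = _ := by rw [hU, hV, Matrix.mul_one, Matrix.mul_one]
    have h2 : (T.toMatrixStrategy.Ψ.map conj)ᴴ = T.toMatrixStrategy.Ψᴴ.map conj := rfl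
    rw [hΦ, conjTranspose_dilate, dilate_mul, trace_dilate, h2, ← Matrix.map_mul, trace_map_conj,
      T.toMatrixStrategy.norm_Ψ, _root_.map_one, one_mul, one_mul, hA, hA] at h1
    exact_mod_cast h1
  · refine coeffMatrix_injective ?_
    rw [coeffMatrix_kronecker_mulVec, coeffMatrix_combine, coeffMatrix_star]
    exact hΦ
  · intro x a
    refine coeffMatrix_injective ?_
    simp only [coeffMatrix_kronecker_mulVec, coeffMatrix_combine, coeffMatrix_star,
      Matrix.transpose_one, Matrix.mul_one]
    rw [← Matrix.map_mul]
    have h1 := hkey (T.E x a * T.toMatrixStrategy.Ψ)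
    rw [← hE] at h1
    exact h1
  · intro y b
    refine coeffMatrix_injective ?_
    simp only [coeffMatrix_kronecker_mulVec, coeffMatrix_combine, coeffMatrix_star, Matrix.one_mul]
    have h1 := hkey (T.toMatrixStrategy.Ψ * T.toMatrixStrategy.G y b)
    rw [← hG, Matrix.map_mul] at h1
    exact h1

end Dilation

/-! ### Self-testing from unique moments -/

section SelfTest

variable {IA OA IB OB : Type*} [Fintype OA] [Fintype OB] {p : Correlation IA OA IB OB}

theorem exists_isMinimalFor (hp : p ∈ Cq IA OA IB OB) :
    ∃ (m n : ℕ) (T : Strategy IA OA IB OB m n), T.toMatrixStrategy.IsMinimalFor p := by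
  classical
  have h : ∃ N, ∃ (m n : ℕ) (T : Strategy IA OA IB OB m n), T.Produces p ∧ m + n = N := by
    obtain ⟨m, n, T, hT⟩ := hp
    exact ⟨_, m, n, T, hT, rfl⟩
  obtain ⟨m, n, T, hT, hN⟩ := Nat.find_spec h
  refine ⟨m, n, T, Strategy.toMatrixStrategy_produces.mpr hT, fun m' n' S hS => ?_⟩
  rw [Fintype.card_fin, Fintype.card_fin, hN]
  exact Nat.find_min' h ⟨m', n', S, hS, rfl⟩

theorem map_conj_map_conj {m n : Type*} (M : Matrix m n ℂ) : (M.map conj).map conj = M := by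
  ext i j
  simp

/-- Intertwiners from irreducible operators and from their conjugates have orthogonal ranges, unless
there is an intertwiner between the operators and their conjugates. -/
theorem orthonormal_sumElim {I O α δ κ κ' : Type*} [Fintype α] [Fintype δ] [DecidableEq δ]
    [DecidableEq κ] [DecidableEq κ'] [Fintype κ] [Fintype κ'] {E : I → O → Matrix α α ℂ}
    {D : I → O → Matrix δ δ ℂ} (hE : ∀ x a, (E x a)ᴴ = E x a) (hD : ∀ x a, (D x a)ᴴ = D x a)
    (hconj : ∀ j : Matrix δ δ ℂ, (∀ x a, D x a * j = j * (D x a).map conj) → j = 0)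
    {X : κ → Matrix α δ ℂ} {X' : κ' → Matrix α δ ℂ} (hX : IsIntertwinerBasis E D X)
    (hX' : IsIntertwinerBasis E (fun x a => (D x a).map conj) X') (i j : κ ⊕ κ') :
    (Sum.elim X X' i)ᴴ * Sum.elim X X' j = if i = j then 1 else 0 := by
  have hcross (i : κ) (j : κ') : (X i)ᴴ * X' j = 0 := by
    refine hconj _ fun x a => ?_
    have h1 := congrArg Matrix.conjTranspose (hX.intertwines i x a)
    rw [Matrix.conjTranspose_mul, Matrix.conjTranspose_mul, hE, hD] at h1
    rw [← Matrix.mul_assoc, ← h1, Matrix.mul_assoc, hX'.intertwines, Matrix.mul_assoc]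
  cases i with
  | inl i =>
    cases j with
    | inl j => simp [hX.orthonormal]
    | inr j => simp [hcross]
  | inr i =>
    cases j with
    | inl j =>
      have h1 := congrArg Matrix.conjTranspose (hcross j i)
      rw [Matrix.conjTranspose_mul, Matrix.conjTranspose_conjTranspose,
        Matrix.conjTranspose_zero] at h1
      simp [h1]
    | inr j => simp [hX'.orthonormal]

/-- A minimal strategy for an extreme correlation with unique moments is self-tested. If its moments
are real, a dilation onto the strategy itself is enough. Otherwise neither party's operators are
equivalent to their conjugates, so the isometries can be built from the linear and the antilinear
intertwiners together. -/
theorem complexSelfTested_of_isMinimalFor {m n : ℕ} {T : Strategy IA OA IB OB m n}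
    (hT : T.toMatrixStrategy.IsMinimalFor p) (hp : p ∈ (Cq IA OA IB OB).extremePoints ℝ)
    (hU : HasUniqueMoments p) : ComplexSelfTested T p := by
  intro m' n' S hS
  set S' := S.toMatrixStrategy with hS'
  set T' := T.toMatrixStrategy with hT'
  have : Nonempty (Fin m) := T'.nonempty_left
  have : Nonempty (Fin n) := T'.swap.nonempty_left
  have hEirr := hT.isIrreducibleFamily_E hp
  have hGirr := hT.isIrreducibleFamily_G hp
  have hconjE (x a) : ((T'.E x a).map conj)ᴴ = (T'.E x a).map conj :=
    congrArg (fun M => M.map conj) (T'.E_star x a)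
  have hconjG (y b) : ((T'.G y b).map conj)ᴴ = (T'.G y b).map conj :=
    congrArg (fun M => M.map conj) (T'.G_star y b)
  obtain ⟨V₀, V₁, h₀E, h₀G, h₁E, h₁G, hsum, him⟩ :=
    MatrixStrategy.exists_intertwiners (S := S') (T := T') fun w v =>
      hU.re_moment_eq hT.produces (Strategy.toMatrixStrategy_produces.mpr hS) w v
  obtain ⟨k, X, hX⟩ := exists_isIntertwinerBasis S'.E_star T'.E_star hEirr
  obtain ⟨l, Y, hY⟩ := exists_isIntertwinerBasis S'.G_star T'.G_star hGirr
  obtain ⟨c, hc⟩ := exists_eq_sum_of_intertwines S'.G_star T'.G_star hX hY h₀E h₀G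
  by_cases hreal : ∀ w v, (T'.moment w v).im = 0
  · have hΨ : S'.Ψ = (2 : ℂ) • V₀ T'.Ψ := by rw [two_smul, ← hsum, him hreal]
    refine isComplexLocalDilation_of_eq_sum (ε := fun _ => 0) (ε' := fun _ => 0)
      (c := fun i j => 2 * c i j) hX.orthonormal hY.orthonormal hX.intertwines hY.intertwines
      (fun i j h => (h rfl).elim) ?_
    rw [← hS', hΨ, hc, Finset.smul_sum]
    refine Finset.sum_congr rfl fun i _ => ?_
    rw [Finset.smul_sum]
    exact Finset.sum_congr rfl fun j _ => by rw [smul_smul, conjIf_zero]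
  · obtain ⟨k', X', hX'⟩ := exists_isIntertwinerBasis S'.E_star hconjE hEirr.map_conj
    obtain ⟨l', Y', hY'⟩ := exists_isIntertwinerBasis S'.G_star hconjG hGirr.map_conj
    -- the antilinear intertwiner, composed with complex conjugation
    let V₂ : Matrix (Fin m) (Fin n) ℂ →ₗ[ℂ] Matrix (Fin m') (Fin n') ℂ :=
      { toFun := fun M => V₁ (M.map conj)
        map_add' := fun M N => by rw [Matrix.map_add _ (by simp), map_add]
        map_smul' := fun r M => by
          have h1 : (r • M).map conj = conj r • M.map conj := by
            ext i j
            simp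
          rw [h1, map_smulₛₗ, Complex.conj_conj, RingHom.id_apply] }
    have hV₂ (M) : V₂ M = V₁ (M.map conj) := rfl
    obtain ⟨c', hc'⟩ := exists_eq_sum_of_intertwines (V := V₂) S'.G_star hconjG hX' hY'
      (fun x a M => by rw [hV₂, hV₂, Matrix.map_mul, map_conj_map_conj, h₁E])
      (fun y b M => by rw [hV₂, hV₂, Matrix.map_mul, map_conj_map_conj, h₁G])
    have hΨ : S'.Ψ = V₀ T'.Ψ + V₂ (T'.Ψ.map conj) := by rw [hV₂, map_conj_map_conj, hsum]
    have hre_of (h : ∀ w v, conj (T'.moment w v) = T'.moment w v) : False :=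
      hreal fun w v => Complex.conj_eq_iff_im.mp (h w v)
    refine isComplexLocalDilation_of_eq_sum (ε := Sum.elim (fun _ => 0) fun _ => 1)
      (ε' := Sum.elim (fun _ => 0) fun _ => 1) (Z := Sum.elim X X') (Y := Sum.elim Y Y')
      (c := Sum.elim (fun i => Sum.elim (c i) 0) fun i => Sum.elim 0 (c' i))
      (orthonormal_sumElim S'.E_star T'.E_star (fun j hj => ?_) hX hX')
      (orthonormal_sumElim S'.G_star T'.G_star (fun j hj => ?_) hY hY') ?_ ?_ ?_ ?_
    · by_contra hj0
      exact hre_of (hT.conj_moment_eq hp hU hj0 hj)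
    · by_contra hj0
      refine hre_of fun w v => ?_
      have h1 := hT.swap.conj_moment_eq (MatrixStrategy.swap_mem_extremePoints_Cq hp) hU.swap
        hj0 hj v w
      rwa [MatrixStrategy.moment_swap] at h1
    · rintro (i | i) x a
      · exact hX.intertwines i x a
      · exact hX'.intertwines i x a
    · rintro (i | i) y b
      · exact hY.intertwines i y b
      · exact hY'.intertwines i y b
    · rintro (i | i) (j | j) h <;> simp_all
    · rw [← hS', hΨ, hc, hc']
      simp [Fintype.sum_sum_type, conjIf_zero, conjIf_one]
      rfl

theorem exists_complexSelfTested (hp : p ∈ (Cq IA OA IB OB).extremePoints ℝ)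
    (h : ∃! f : BellAlgebra IA OA IB OB →L[ℝ] ℝ, IsAgreeingState p f) :
    ∃ (m n : ℕ) (T : Strategy IA OA IB OB m n), ComplexSelfTested T p := by
  obtain ⟨m, n, T, hT⟩ := exists_isMinimalFor hp.1
  exact ⟨m, n, T, complexSelfTested_of_isMinimalFor hT hp (hasUniqueMoments_of_existsUnique h)⟩

end SelfTest

end ComplexSelfTest

end

open ComplexSelfTest in
theorem mainTheorem1 {IA OA IB OB : Type*} [Fintype IA] [Fintype OA] [Fintype IB] [Fintype OB]
    (p : Correlation IA OA IB OB) :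
    (p ∈ Cq IA OA IB OB →
      ∀ (m n : ℕ) (T : Strategy IA OA IB OB m n), T.SupportPreserving → ComplexSelfTested T p →
        ∃! f : BellAlgebra IA OA IB OB →L[ℝ] ℝ, IsAgreeingState p f) ∧
    (p ∈ (Cq IA OA IB OB).extremePoints ℝ →
      (∃! f : BellAlgebra IA OA IB OB →L[ℝ] ℝ, IsAgreeingState p f) →
        ∃ (m n : ℕ) (T : Strategy IA OA IB OB m n), ComplexSelfTested T p) :=
  ⟨fun hp _ _ _ hT hself => existsUnique_isAgreeingState_of_complexSelfTested hp hT hself,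
    fun hp h => exists_complexSelfTested hp h⟩
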